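/- Let $n\in\mathbb N$, $\tfrac12<\alpha\le 1$, $2\alpha\le\beta<2\alpha+1$, $\sigma>0$, $\mu>0$. Put $\lambda_\pm=\frac{\mu}{2}\pm i\sqrt{1-\frac{\mu^2}{4}}$ if $0<\mu<2$ and $\lambda_\pm=\frac{\mu}{2}\pm\sqrt{\frac{\mu^2}{4}-1}$ if $\mu\ge 2$; let $E_{a,b}(z)=\sum_{k\ge0}\frac{z^k}{\Gamma(ak+b)}$ be the Mittag-Leffler function. Let $\widehat\varphi(\xi)=\int_{\mathbb R^n}\varphi(x)e^{-ix\cdot\xi}dx$ and let $(-\Delta)^{\gamma/2}=\mathcal F^{-1}|\xi|^\gamma\mathcal F$. Let $M(t,\cdot)$, $N(t,\cdot)$, $J(t,\cdot)$ be the inverse Fourier transforms $(2\pi)^{-n}\int_{\mathbb R^n}(\cdot)\,e^{ix\cdot\xi}d\xi$ (in the sense of tempered distributions) of the following functions of $\xi$, where $z=|\xi|^\sigma t^\alpha$. For $\mu\ne2$: $$\widehat M=t^{\beta-1}\frac{\lambda_+E_{\alpha,\beta}(-\lambda_+z)-\lambda_-E_{\alpha,\beta}(-\lambda_-z)}{\lambda_+-\lambda_-},\quad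 \widehat N=\frac{E_{\alpha,1}(-\lambda_+z)}{1-\lambda_+^2}+\frac{E_{\alpha,1}(-\lambda_-z)}{1-\lambda_-^2},\quad \widehat J=t\,\frac{\lambda_+E_{\alpha,2}(-\lambda_+z)-\lambda_-E_{\alpha,2}(-\lambda_-z)}{\lambda_+-\lambda_-};$$ for $\mu=2$: $$\widehat M=\frac{t^{\beta-1}}{\alpha}\big(E_{\alpha,\beta-1}(-z)+(1+\alpha-\beta)E_{\alpha,\beta}(-z)\big),\quad \widehat N=E_{\alpha,1}(-z)+\frac{z}{\alpha}E_{\alpha,\alpha}(-z),\quad \widehat J=\frac{t}{\alpha}\big(E_{\alpha,1}(-z)+(\alpha-1)E_{\alpha,2}(-z)\big).$$ Let $u_0,u_1\in\mathcal S(\mathbb R^n)$ and let $f(t,\cdot)\in\mathcal S(\mathbb R^n)$ for $t\ge0$ depend continuously on $t$, i.e. $f\in C([0,\infty);\mathcal S(\mathbb R^n))$. Then $$u(t,x)=(N(t,\cdot)*u_0)(x)+(J(t,\cdot)*u_1)(x)+\int_0^t[M(t-\tau,\cdot)*f(\tau,\cdot)](x)\,d\tau$$ is well defined on $[0,\infty)\times\mathbb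 R^n$, is real-valued if $u_0,u_1,f$ are, and solves $$\partial_t^{2\alpha}u+\mu(-\Delta)^{\sigma/2}\partial_t^\alpha u+(-\Delta)^\sigma u=I_{0^+}^{\beta-2\alpha}f\ \text{ in }(0,\infty)\times\mathbb R^n,\qquad u(0,x)=u_0(x),\quad \partial_tu(0,x)=u_1(x).$$ Here $I^{\gamma}_{0^+}g(t)=\int_0^t\frac{(t-\tau)^{\gamma-1}}{\Gamma(\gamma)}g(\tau)d\tau$ for $\gamma>0$ and $I^0_{0^+}g=g$, and $\partial_t^\gamma$ ($m-1<\gamma\le m$, $m\in\mathbb N$) is the Caputo–Djrbashian derivative in the generalized sense $\partial_t^\gamma g=\frac{d^m}{dt^m}I_{0^+}^{m-\gamma}\big(g-\sum_{k<m}g^{(k)}(0)\frac{t^k}{k!}\big)$. If moreover $f\in C^1([0,\infty);\mathcal S(\mathbb R^n))$, then $u(\cdot,x)$ is $C^2$ on $(0,\infty)$ with $\partial_t^2u(\cdot,x)$ integrable on every $(0,t)$, and the equation holds with the classical Caputo–Djrbashian derivatives $\partial_t^\gamma g(t)=\int_0^t\frac{(t-\tau)^{m-\gamma-1}}{\Gamma(m-\gamma)}g^{(m)}(\tau)d\tau$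 for $m-1<\gamma<m$ and $\partial_t^{m}g=g^{(m)}$. -/

import Mathlib

open MeasureTheory Set
open scoped SchwartzMap

namespace FracDamped

/-- The space `ℝⁿ` with its Euclidean structure. -/
abbrev Space (n : ℕ) := EuclideanSpace ℝ (Fin n)

noncomputable section

/-! ### Fourier analysis, with the convention `𝓕 φ (ξ) = ∫ φ(x) e^{-i x·ξ} dx` -/

/-- The inverse Fourier integral `(2π)⁻ⁿ ∫ h(ξ) e^{i x·ξ} dξ`. -/
def invFourier {n : ℕ} (h : Space n → ℂ) (x : Space n) : ℂ :=
  (((2 * Real.pi) ^ n : ℝ) : ℂ)⁻¹ * ∫ ξ, h ξ * Complex.exp (Complex.I * (inner ℝ x ξ : ℝ))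

/-- `ψ = (-Δ)^{γ/2} φ` by the spectral formula: `φ` is the inverse Fourier integral of some
`h` (so `h = 𝓕 φ`, almost everywhere unique), and `ψ` is that of `|ξ|^γ h(ξ)`. -/
def HasFracLaplacian {n : ℕ} (γ : ℝ) (φ ψ : Space n → ℂ) : Prop :=
  ∃ h : Space n → ℂ, Integrable h ∧ Integrable (fun ξ => ((‖ξ‖ ^ γ : ℝ) : ℂ) * h ξ) ∧
    (∀ x, φ x = invFourier h x) ∧
    (∀ x, ψ x = invFourier (fun ξ => ((‖ξ‖ ^ γ : ℝ) : ℂ) * h ξ) x)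

/-- For a symbol `m`, the kernel `K = (2π)⁻ⁿ ∫ m(ξ) e^{i x·ξ} dξ` is in general (a symbol that
is merely bounded) a tempered distribution: `⟨K, θ⟩ = ∫ m(ξ) (𝓕⁻¹ θ)(ξ) dξ`. -/
def kernelPairing {n : ℕ} (m : Space n → ℂ) (θ : Space n → ℂ) : ℂ :=
  ∫ ξ, m ξ * invFourier θ ξ

/-- The convolution `(K * φ)(x) = ⟨K, φ(x - ·)⟩` of the kernel `K` with symbol `m` and a
Schwartz function `φ`. -/
def kernelConv {n : ℕ} (m : Space n → ℂ) (φ : 𝓢(Space n, ℂ)) (x : Space n) : ℂ :=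
  kernelPairing m (fun y => φ (x - y))

/-- The integral that defines `(K * φ)(x)` converges absolutely. -/
def KernelConvExists {n : ℕ} (m : Space n → ℂ) (φ : 𝓢(Space n, ℂ)) (x : Space n) : Prop :=
  Integrable (fun ξ => m ξ * invFourier (fun y => φ (x - y)) ξ)

/-! ### Fractional calculus in time -/

/-- The Riemann–Liouville integral `I^γ g (t)`, with `I^0 g = g`. -/
def rlIntegral (γ : ℝ) (g : ℝ → ℂ) (t : ℝ) : ℂ :=
  if γ = 0 then g t
  else ∫ τ in (0 : ℝ)..t, (((t - τ) ^ (γ - 1) / Real.Gamma γ : ℝ) : ℂ) * g τ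

/-- The Caputo–Djrbashian derivative of order `γ > 0`, where `m - 1 < γ ≤ m`. -/
def caputoDeriv (γ : ℝ) (g : ℝ → ℂ) (t : ℝ) : ℂ :=
  if γ = (⌈γ⌉₊ : ℝ) then iteratedDeriv ⌈γ⌉₊ g t
  else ∫ τ in (0 : ℝ)..t,
    (((t - τ) ^ ((⌈γ⌉₊ : ℝ) - γ - 1) / Real.Gamma ((⌈γ⌉₊ : ℝ) - γ) : ℝ) : ℂ) *
      iteratedDeriv ⌈γ⌉₊ g τ

/-- `D` is the Caputo–Djrbashian derivative of order `γ` of `g` on `(0, ∞)`, and this is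
meaningful: `g` is `C^m` on `(0, ∞)`, its `m`-th derivative is integrable on every `(0, t)`, and
the integral in the definition converges absolutely for every `t > 0`. -/
def HasCaputoDeriv (γ : ℝ) (g D : ℝ → ℂ) : Prop :=
  ContDiffOn ℝ (⌈γ⌉₊ : ℕ) g (Ioi 0) ∧
  ∀ t > 0, IntervalIntegrable (iteratedDeriv ⌈γ⌉₊ g) volume 0 t ∧
    (γ ≠ (⌈γ⌉₊ : ℝ) → IntervalIntegrable (fun τ =>
      (((t - τ) ^ ((⌈γ⌉₊ : ℝ) - γ - 1) / Real.Gamma ((⌈γ⌉₊ : ℝ) - γ) : ℝ) : ℂ) *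
        iteratedDeriv ⌈γ⌉₊ g τ) volume 0 t) ∧
    D t = caputoDeriv γ g t

/-- The Taylor polynomial `∑_{k<m} g^{(k)}(0) t^k / k!`, with one-sided derivatives at `0`. -/
def taylorAtZero (m : ℕ) (g : ℝ → ℂ) (t : ℝ) : ℂ :=
  ∑ k ∈ Finset.range m, iteratedDerivWithin k g (Ici 0) 0 * ((t ^ k / (k.factorial : ℝ) : ℝ) : ℂ)

/-- `D` is the Caputo–Djrbashian derivative of order `γ` of `g` on `(0, ∞)` in the generalized
(regularized Riemann–Liouville) sense, in which the derivatives act after the integral: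
`D = (d/dt)^m I^{m-γ} (g - ∑_{k<m} g^{(k)}(0) t^k / k!)`. Here `g` need only be `C^{m-1}` on
`[0, ∞)`; for `g` with an `m`-th derivative that is integrable near `0` it is the classical
notion. -/
def HasWeakCaputoDeriv (γ : ℝ) (g D : ℝ → ℂ) : Prop :=
  ContDiffOn ℝ (⌈γ⌉₊ - 1 : ℕ) g (Ici 0) ∧
  ContDiffOn ℝ (⌈γ⌉₊ : ℕ)
    (rlIntegral ((⌈γ⌉₊ : ℝ) - γ) (fun τ => g τ - taylorAtZero ⌈γ⌉₊ g τ)) (Ioi 0) ∧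
  ∀ t > 0, D t = iteratedDeriv ⌈γ⌉₊
    (rlIntegral ((⌈γ⌉₊ : ℝ) - γ) (fun τ => g τ - taylorAtZero ⌈γ⌉₊ g τ)) t

/-- `u : [0, ∞) × ℝⁿ → ℂ` (values at negative times are irrelevant) satisfies, pointwise,
`∂_t^{2α} u + μ (-Δ)^{σ/2} ∂_t^α u + (-Δ)^σ u = I^{β-2α} f` in `(0, ∞) × ℝⁿ`, `u(0) = u₀` and
`∂_t u(0) = u₁`; in particular this is so on `[0, T] × ℝⁿ` for every `T > 0`.
The parameter `IsCaputo` is the notion of Caputo–Djrbashian derivative that is used, either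
`HasCaputoDeriv` or `HasWeakCaputoDeriv`. -/
structure SolvesCauchyProblem {n : ℕ} (IsCaputo : ℝ → (ℝ → ℂ) → (ℝ → ℂ) → Prop)
    (α β σ μ : ℝ) (u₀ u₁ : 𝓢(Space n, ℂ)) (f : ℝ → 𝓢(Space n, ℂ)) (u : ℝ → Space n → ℂ) :
    Prop where
  initial_value : ∀ x, u 0 x = u₀ x
  initial_velocity : ∀ x, HasDerivWithinAt (fun t => u t x) (u₁ x) (Ici 0) 0
  equation : ∃ Dα D2α A B : ℝ → Space n → ℂ,
    (∀ x, IsCaputo α (fun t => u t x) (fun t => Dα t x)) ∧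
    (∀ x, IsCaputo (2 * α) (fun t => u t x) (fun t => D2α t x)) ∧
    ∀ t > 0, HasFracLaplacian σ (Dα t) (A t) ∧ HasFracLaplacian (2 * σ) (u t) (B t) ∧
      ∀ x, D2α t x + (μ : ℂ) * A t x + B t x = rlIntegral (β - 2 * α) (fun τ => f τ x) t

/-! ### The kernels -/

/-- The two-parameter Mittag-Leffler function `E_{α,β}(z) = ∑ z^k / Γ(α k + β)`. -/
def mittagLeffler (α β : ℝ) (z : ℂ) : ℂ :=
  ∑' k : ℕ, z ^ k / (Real.Gamma (α * k + β) : ℂ)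

/-- The root `λ₊`. -/
def lamPlus (μ : ℝ) : ℂ :=
  if μ < 2 then (μ / 2 : ℝ) + Complex.I * (Real.sqrt (1 - μ ^ 2 / 4) : ℝ)
  else (μ / 2 : ℝ) + (Real.sqrt (μ ^ 2 / 4 - 1) : ℝ)

/-- The root `λ₋`. -/
def lamMinus (μ : ℝ) : ℂ :=
  if μ < 2 then (μ / 2 : ℝ) - Complex.I * (Real.sqrt (1 - μ ^ 2 / 4) : ℝ)
  else (μ / 2 : ℝ) - (Real.sqrt (μ ^ 2 / 4 - 1) : ℝ)

/-- The quantity `|ξ|^σ t^α`. -/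
def phase {n : ℕ} (α σ t : ℝ) (ξ : Space n) : ℂ := ((‖ξ‖ ^ σ * t ^ α : ℝ) : ℂ)

/-- The symbol of the kernel `M`. For `μ = 2` it is `t^{β-1} E²_{α,β}(-|ξ|^σ t^α)`, where
`E²_{α,β}(z) = ∑ (k + 1) z^k / Γ(α k + β)` is a three-parameter Mittag-Leffler function. -/
def symbolM {n : ℕ} (α β σ μ t : ℝ) (ξ : Space n) : ℂ :=
  if μ = 2 then
    ((t ^ (β - 1) / α : ℝ) : ℂ) * (mittagLeffler α (β - 1) (-phase α σ t ξ)
      + ((1 + α - β : ℝ) : ℂ) * mittagLeffler α β (-phase α σ t ξ))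
  else
    ((t ^ (β - 1) : ℝ) : ℂ) *
      ((lamPlus μ * mittagLeffler α β (-lamPlus μ * phase α σ t ξ)
        - lamMinus μ * mittagLeffler α β (-lamMinus μ * phase α σ t ξ))
        / (lamPlus μ - lamMinus μ))

/-- The symbol of the kernel `N`. -/
def symbolN {n : ℕ} (α σ μ t : ℝ) (ξ : Space n) : ℂ :=
  if μ = 2 then
    mittagLeffler α 1 (-phase α σ t ξ)
      + phase α σ t ξ / (α : ℂ) * mittagLeffler α α (-phase α σ t ξ)
  else
    mittagLeffler α 1 (-lamPlus μ * phase α σ t ξ) / (1 - lamPlus μ ^ 2)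
      + mittagLeffler α 1 (-lamMinus μ * phase α σ t ξ) / (1 - lamMinus μ ^ 2)

/-- The symbol of the kernel `J`. For `μ = 2` it is `t E²_{α,2}(-|ξ|^σ t^α)`. -/
def symbolJ {n : ℕ} (α σ μ t : ℝ) (ξ : Space n) : ℂ :=
  if μ = 2 then
    ((t / α : ℝ) : ℂ) * (mittagLeffler α 1 (-phase α σ t ξ)
      + ((α - 1 : ℝ) : ℂ) * mittagLeffler α 2 (-phase α σ t ξ))
  else
    (t : ℂ) *
      ((lamPlus μ * mittagLeffler α 2 (-lamPlus μ * phase α σ t ξ)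
        - lamMinus μ * mittagLeffler α 2 (-lamMinus μ * phase α σ t ξ))
        / (lamPlus μ - lamMinus μ))

/-- `u(t,x) = (N(t) * u₀)(x) + (J(t) * u₁)(x) + ∫₀ᵗ (M(t-τ) * f(τ))(x) dτ`. -/
def representation {n : ℕ} (α β σ μ : ℝ) (u₀ u₁ : 𝓢(Space n, ℂ)) (f : ℝ → 𝓢(Space n, ℂ))
    (t : ℝ) (x : Space n) : ℂ :=
  kernelConv (symbolN α σ μ t) u₀ x + kernelConv (symbolJ α σ μ t) u₁ x
    + ∫ τ in (0 : ℝ)..t, kernelConv (symbolM α β σ μ (t - τ)) (f τ) x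

/-- `f` is continuously differentiable in time, `f ∈ C¹([0, ∞); 𝓢)`. -/
def IsC1InTime {n : ℕ} (f : ℝ → 𝓢(Space n, ℂ)) : Prop :=
  ∃ f' : ℝ → 𝓢(Space n, ℂ), ContinuousOn f' (Ici 0) ∧
    ∀ t ≥ 0, ∀ x, HasDerivWithinAt (fun s => f s x) (f' t x) (Ici 0) t

end

end FracDamped

open scoped FourierTransform

namespace FracDamped

/-! ### Growth of the Gamma function -/

/-! Put ω = |ξ|^σ. On the Fourier side the equation is the scalar fractional equation D^{2α}û + μω
D^α û + ω²û = I^{β-2α}f̂. Its resolvent family is k_b(t) = t^{b-1} ∑ c_k (-ωt^α)^k / Γ(αk+b)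
(`dampKernel`), where ∑ c_k X^k = 1/(1-μX+X²). Expanding this rational function in partial fractions
gives M̂ = k_β, Ĵ = k_2 and N̂ = 1 - ω² k_{2α+1}, with a simple or a double pole according to
whether μ ≠ 2 or μ = 2 (`symbolM_eq`, `symbolJ_eq`, `symbolN_eq`). All the algebra rests on two
identities: I^a k_b = k_{a+b} (`integral_rlKernel_mul_dampKernel`) and k_b + μω k_{b+α} + ω²
k_{b+2α} = t^{b-1}/Γ(b) (`dampKernel_recurrence`).

To return to physical space, k_b must grow at most polynomially in ω (`exists_dampML_le`).
Asymptotics of Mittag-Leffler functions are avoided by an energy estimate. Since I^α is a positive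
operator (`integral_mul_fractional_nonneg`), testing the second identity with k_{b+α} = I^α k_b
bounds k_{b+α} in L²(0,1). As α > 1/2, the kernel of I^α is square integrable, so k_{b+2α}(1) is
bounded for b ≥ 1 (`exists_dampML_bound_of_large`). The second identity then carries the bound down
to smaller orders, at the cost of powers of ω.

The representation formula equals u₀ + t u₁ + V_{2α}, where V_b is the inverse Fourier transform of
the time convolution k_b * h and h collects f and the terms produced by u₀ + t u₁
(`representation_eq`). Since I^a V_b = V_{a+b}, Caputo derivatives of u lower the order b. The
derivative of order 2α would be V_0, which lies outside the scale. It is the inverse transform of h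
- μω k_α * h - ω² k_{2α} * h, because the second identity at b = 1 says that the primitive of this
function is V_1 (`invFourier_dampConv_one`). With this expression the equation is an algebraic
identity (`derivTwoHat_add`). If f is C¹ in time, each V_b with b > 0 is differentiable for t > 0,
with a derivative that may be singular but is integrable at 0 (`derivScale_eq`). Hence u'' exists
and the classical derivatives agree with the generalized ones. -/

theorem exists_inv_gamma_le {R : ℝ} (hR : 0 < R) :
    ∃ C > 0, ∀ x > 0, (Real.Gamma x)⁻¹ ≤ C * R ^ x := by
  -- On [M, M+1] the integrand of Γ(x+1) is at least e^{-(M+1)} M^x = e^{-(M+1)} e^x / R^x. The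
  -- factor e^x in this choice of M absorbs the x of Γ(x+1) = xΓ(x), since x ≤ e^x.
  set M : ℝ := Real.exp 1 / R with hM
  have hM0 : 0 < M := by positivity
  refine ⟨Real.exp (M + 1), Real.exp_pos _, fun x hx => ?_⟩
  have key : Real.exp (-(M + 1)) * M ^ x ≤ Real.Gamma (x + 1) := by
    rw [Real.Gamma_eq_integral (by linarith)]
    have hint := Real.GammaIntegral_convergent (s := x + 1) (by linarith)
    have hsub : Ioc M (M + 1) ⊆ Ioi 0 := fun t ht => hM0.trans ht.1
    have h1 : ∫ _t in Ioc M (M + 1), Real.exp (-(M + 1)) * M ^ x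
        ≤ ∫ t in Ioc M (M + 1), Real.exp (-t) * t ^ (x + 1 - 1) := by
      refine setIntegral_mono_on (integrableOn_const (by simp)) (hint.mono_set hsub) measurableSet_Ioc
        fun t ht => ?_
      rw [add_sub_cancel_right]
      have := ht.1.le
      have := ht.2
      gcongr
    have h2 := setIntegral_mono_set hint
      (by
        filter_upwards [self_mem_ae_restrict measurableSet_Ioi] with t ht
        have : 0 < t := ht
        simp only [Pi.zero_apply]
        positivity) (Filter.Eventually.of_forall hsub)
    simp only [integral_const, measureReal_restrict_apply_univ, Real.volume_real_Ioc, smul_eq_mul,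
      add_sub_cancel_left, max_eq_left zero_le_one, one_mul] at h1
    exact h1.trans h2
  have hpos : 0 < Real.Gamma x := Real.Gamma_pos_of_pos hx
  rw [Real.Gamma_add_one hx.ne'] at key
  have hxe : x ≤ Real.exp x := by linarith [Real.add_one_le_exp x]
  have hMx : M ^ x = Real.exp x / R ^ x := by
    rw [hM, Real.div_rpow (Real.exp_pos _).le hR.le, ← Real.exp_mul, one_mul]
  have hRx : 0 < R ^ x := Real.rpow_pos_of_pos hR x
  rw [hMx, Real.exp_neg] at key
  rw [inv_le_comm₀ hpos (by positivity)]
  have e1 := Real.exp_pos x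
  have h3 : (Real.exp (M + 1))⁻¹ * (Real.exp x / R ^ x) ≤ Real.exp x * Real.Gamma x :=
    key.trans (by gcongr)
  have h4 : (Real.exp (M + 1))⁻¹ * (Real.exp x / R ^ x)
      = Real.exp x * (Real.exp (M + 1) * R ^ x)⁻¹ := by
    rw [mul_inv]; ring
  rw [h4] at h3
  exact le_of_mul_le_mul_left h3 e1

theorem exists_inv_gamma_le_geometric {α b ρ : ℝ} (hα : 0 < α) (hb : 0 < b) (hρ : 0 < ρ) :
    ∃ C > 0, ∀ k : ℕ, (Real.Gamma (α * k + b))⁻¹ ≤ C * ρ ^ k := by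
  obtain ⟨C, hC, h⟩ := exists_inv_gamma_le (R := ρ ^ α⁻¹) (by positivity)
  refine ⟨C * (ρ ^ α⁻¹) ^ b, by positivity, fun k => (h _ (by positivity)).trans_eq ?_⟩
  rw [Real.rpow_add (by positivity), ← Real.rpow_mul hρ.le, ← mul_assoc α⁻¹,
    inv_mul_cancel₀ hα.ne', one_mul, Real.rpow_natCast]
  ring

theorem summable_pow_div_gamma {α b : ℝ} (hα : 0 < α) (hb : 0 < b) {R : ℝ} (hR : 0 ≤ R) :
    Summable fun k : ℕ => R ^ k / Real.Gamma (α * k + b) := by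
  -- The rate ρ is chosen so that Rρ ≤ 1/2.
  obtain ⟨C, hC, h⟩ := exists_inv_gamma_le_geometric hα hb (ρ := (2 * (R + 1))⁻¹) (by positivity)
  refine Summable.of_nonneg_of_le (fun k => ?_) (fun k => ?_)
    ((summable_geometric_two).mul_left C)
  · exact div_nonneg (by positivity) (Real.Gamma_pos_of_pos (by positivity)).le
  · calc R ^ k / Real.Gamma (α * k + b) ≤ R ^ k * (C * ((2 * (R + 1))⁻¹) ^ k) := by
          rw [div_eq_mul_inv]; gcongr; exact h k
      _ = C * (R * (2 * (R + 1))⁻¹) ^ k := by rw [mul_pow]; ring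
      _ ≤ C * (1 / 2) ^ k := by
          gcongr
          rw [← div_eq_mul_inv, div_le_div_iff₀ (by positivity) (by norm_num)]
          linarith

/-! ### The Mittag-Leffler type function of the damped equation -/

/-- The power series coefficients of `1 / (1 - μ X + X ^ 2)`. -/
def dampCoeff (μ : ℝ) : ℕ → ℝ
  | 0 => 1
  | 1 => μ
  | k + 2 => μ * dampCoeff μ (k + 1) - dampCoeff μ k

/-- A crude bound by induction, from μ(1+μ) + 1 ≤ (1+μ)². Any geometric bound is enough, because
1/Γ(αk+b) decays faster than every geometric sequence. -/
theorem abs_dampCoeff_le {μ : ℝ} (hμ : 0 < μ) : ∀ k, |dampCoeff μ k| ≤ (1 + μ) ^ k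
  | 0 => by simp [dampCoeff]
  | 1 => by simp [dampCoeff, abs_of_pos hμ]
  | k + 2 => by
    have h1 := abs_dampCoeff_le hμ k
    have h2 := abs_dampCoeff_le hμ (k + 1)
    rw [dampCoeff]
    calc |μ * dampCoeff μ (k + 1) - dampCoeff μ k|
        ≤ |μ * dampCoeff μ (k + 1)| + |dampCoeff μ k| := abs_sub _ _
      _ = μ * |dampCoeff μ (k + 1)| + |dampCoeff μ k| := by rw [abs_mul, abs_of_pos hμ]
      _ ≤ μ * (1 + μ) ^ (k + 1) + (1 + μ) ^ k := by gcongr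
      _ = (1 + μ) ^ k * (μ * (1 + μ) + 1) := by ring
      _ ≤ (1 + μ) ^ k * (1 + μ) ^ 2 := by gcongr; nlinarith
      _ = (1 + μ) ^ (k + 2) := by ring

/-- `∑ c_k (-z)^k / Γ(α k + b)`, where `∑ c_k X^k = 1 / (1 - μ X + X ^ 2)`. -/
noncomputable def dampML (α μ b z : ℝ) : ℝ :=
  ∑' k : ℕ, dampCoeff μ k * (-z) ^ k / Real.Gamma (α * k + b)

section
variable {α μ b : ℝ}

theorem abs_dampML_term_le (hα : 0 < α) (hμ : 0 < μ) (hb : 0 < b) {z R : ℝ}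
    (hz : |z| ≤ R) (k : ℕ) :
    ‖dampCoeff μ k * (-z) ^ k / Real.Gamma (α * k + b)‖
      ≤ ((1 + μ) * R) ^ k / Real.Gamma (α * k + b) := by
  have hG : 0 < Real.Gamma (α * k + b) := Real.Gamma_pos_of_pos (by positivity)
  rw [norm_div, norm_mul, norm_pow, norm_neg, Real.norm_of_nonneg hG.le, mul_pow]
  gcongr
  · exact abs_dampCoeff_le hμ k
  · exact hz

theorem summable_dampML (hα : 0 < α) (hμ : 0 < μ) (hb : 0 < b) (z : ℝ) :
    Summable fun k : ℕ => dampCoeff μ k * (-z) ^ k / Real.Gamma (α * k + b) :=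
  Summable.of_norm_bounded (summable_pow_div_gamma hα hb (by positivity))
    (abs_dampML_term_le hα hμ hb le_rfl)

theorem continuous_dampML (hα : 0 < α) (hμ : 0 < μ) (hb : 0 < b) :
    Continuous (dampML α μ b) := by
  rw [continuous_iff_continuousAt]
  intro z₀
  have : ContinuousOn (dampML α μ b) (Metric.ball 0 (|z₀| + 1)) := by
    refine continuousOn_tsum (fun k => by fun_prop)
      (summable_pow_div_gamma hα hb (R := (1 + μ) * (|z₀| + 1)) (by positivity))
      fun k z hz => abs_dampML_term_le hα hμ hb ?_ k
    simpa using (mem_ball_zero_iff.1 hz).le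
  exact this.continuousAt (Metric.isOpen_ball.mem_nhds (by simp))

/-- This is (1 - μX + X²) ∑ c_k X^k = 1 at X = -z: raising b by α matches a shift of the index in
Γ(αk+b), so all terms cancel except the constant one. -/
theorem dampML_recurrence (hα : 0 < α) (hμ : 0 < μ) (hb : 0 < b) (z : ℝ) :
    dampML α μ b z + μ * z * dampML α μ (b + α) z + z ^ 2 * dampML α μ (b + 2 * α) z
      = (Real.Gamma b)⁻¹ := by
  have hA := (summable_dampML hα hμ hb z)
  have hB := (summable_dampML (b := b + α) hα hμ (by positivity) z)
  have hC := (summable_dampML (b := b + 2 * α) hα hμ (by positivity) z)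
  have hA' := hA.sum_add_tsum_nat_add 2
  have hB' := hB.sum_add_tsum_nat_add 1
  have hAs := (summable_nat_add_iff 2).2 hA
  have hBs := (summable_nat_add_iff 1).2 hB
  unfold dampML
  rw [← hA', ← hB']
  -- Aligned at the same Gamma factor, the three series cancel term by term by the recursion for
  -- `dampCoeff`. The terms k = 0, 1 of the first series and k = 0 of the second are left out.
  have hzero : (∑' k : ℕ, dampCoeff μ (k + 2) * (-z) ^ (k + 2) / Real.Gamma (α * ↑(k + 2) + b))
      + μ * z * (∑' k : ℕ, dampCoeff μ (k + 1) * (-z) ^ (k + 1)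
          / Real.Gamma (α * ↑(k + 1) + (b + α)))
      + z ^ 2 * (∑' k : ℕ, dampCoeff μ k * (-z) ^ k / Real.Gamma (α * k + (b + 2 * α))) = 0 := by
    rw [← tsum_mul_left, ← tsum_mul_left, ← hAs.tsum_add (hBs.mul_left _),
      ← (hAs.add (hBs.mul_left _)).tsum_add (hC.mul_left _)]
    convert tsum_zero with k
    have e1 : α * ↑(k + 2) + b = α * k + (b + 2 * α) := by push_cast; ring
    have e2 : α * ↑(k + 1) + (b + α) = α * k + (b + 2 * α) := by push_cast; ring
    rw [e1, e2, dampCoeff]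
    ring
  simp only [Finset.sum_range_succ, Finset.range_zero, Finset.sum_empty]
  have h0 : dampCoeff μ 0 = 1 := rfl
  have h1 : dampCoeff μ 1 = μ := rfl
  rw [h0, h1]
  simp only [Nat.cast_zero, mul_zero, zero_add, pow_zero, mul_one, Nat.cast_one, pow_one, one_div]
  rw [add_comm α b]
  linear_combination hzero

end

/-! ### Identification of the symbols -/

theorem summable_mittagLeffler {α b : ℝ} (hα : 0 < α) (hb : 0 < b) (z : ℂ) :
    Summable fun k : ℕ => z ^ k / (Real.Gamma (α * k + b) : ℂ) := by
  refine Summable.of_norm_bounded (summable_pow_div_gamma hα hb (norm_nonneg z)) fun k => ?_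
  have hG : 0 < Real.Gamma (α * k + b) := Real.Gamma_pos_of_pos (by positivity)
  rw [norm_div, norm_pow, Complex.norm_real, Real.norm_of_nonneg hG.le]

theorem mittagLeffler_recurrence {α b : ℝ} (hα : 0 < α) (hb : 0 < b) (z : ℂ) :
    mittagLeffler α b z = (Real.Gamma b : ℂ)⁻¹ + z * mittagLeffler α (b + α) z := by
  unfold mittagLeffler
  rw [(summable_mittagLeffler hα hb z).tsum_eq_zero_add, ← tsum_mul_left]
  simp only [pow_zero, Nat.cast_zero, mul_zero, zero_add, one_div]
  congr 2
  ext k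
  rw [show α * ↑(k + 1) + b = α * k + (b + α) by push_cast; ring]
  ring

theorem lamPlus_add_lamMinus (μ : ℝ) : lamPlus μ + lamMinus μ = μ := by
  unfold lamPlus lamMinus
  split_ifs <;> push_cast <;> ring

theorem lamPlus_mul_lamMinus {μ : ℝ} (hμ : 0 < μ) : lamPlus μ * lamMinus μ = 1 := by
  unfold lamPlus lamMinus
  split_ifs with h
  · have hs : ((Real.sqrt (1 - μ ^ 2 / 4) : ℝ) : ℂ) ^ 2 = 1 - (μ : ℂ) ^ 2 / 4 := by
      rw [← Complex.ofReal_pow, Real.sq_sqrt (by nlinarith)]; push_cast; ring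
    push_cast
    linear_combination hs - ((Real.sqrt (1 - μ ^ 2 / 4) : ℝ) : ℂ) ^ 2 * Complex.I_sq
  · have hs : ((Real.sqrt (μ ^ 2 / 4 - 1) : ℝ) : ℂ) ^ 2 = (μ : ℂ) ^ 2 / 4 - 1 := by
      rw [← Complex.ofReal_pow, Real.sq_sqrt (by nlinarith)]; push_cast; ring
    push_cast
    linear_combination -hs

/-- The discriminant is (λ₊ - λ₋)² = μ² - 4. -/
theorem lamPlus_ne_lamMinus {μ : ℝ} (hμ : 0 < μ) (h2 : μ ≠ 2) : lamPlus μ - lamMinus μ ≠ 0 := by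
  intro h
  have h1 := lamPlus_add_lamMinus μ
  have h3 := lamPlus_mul_lamMinus hμ
  have h4 : ((μ ^ 2 : ℝ) : ℂ) = ((4 : ℝ) : ℂ) := by
    push_cast
    linear_combination 4 * h3 - (lamPlus μ + lamMinus μ + μ) * h1
      + (lamPlus μ - lamMinus μ) * h
  have h5 : μ ^ 2 = 4 := by exact_mod_cast h4
  exact h2 (by nlinarith)

/-- Partial fractions of 1/(1 - μX + X²): λ₊ and λ₋ are the roots of λ² - μλ + 1, so both sides
satisfy the same two-term recursion. -/
theorem dampCoeff_mul_sub {μ : ℝ} (hμ : 0 < μ) : ∀ k : ℕ,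
    (dampCoeff μ k : ℂ) * (lamPlus μ - lamMinus μ) = lamPlus μ ^ (k + 1) - lamMinus μ ^ (k + 1)
  | 0 => by simp [dampCoeff]
  | 1 => by
    simp only [dampCoeff]
    linear_combination -(lamPlus μ - lamMinus μ) * lamPlus_add_lamMinus μ
  | k + 2 => by
    have h1 := dampCoeff_mul_sub hμ k
    have h2 := dampCoeff_mul_sub hμ (k + 1)
    have h3 := lamPlus_add_lamMinus μ
    have h4 := lamPlus_mul_lamMinus hμ
    rw [dampCoeff]
    push_cast
    rw [sub_mul, mul_assoc, h1, h2, ← h3]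
    linear_combination (lamPlus μ ^ (k + 1) - lamMinus μ ^ (k + 1)) * h4

/-- For μ = 2 the generating function is 1/(1-X)². -/
theorem dampCoeff_two : ∀ k : ℕ, dampCoeff 2 k = k + 1
  | 0 => by simp [dampCoeff]
  | 1 => by simp [dampCoeff]; norm_num
  | k + 2 => by
    rw [dampCoeff, dampCoeff_two k, dampCoeff_two (k + 1)]; push_cast; ring

theorem ofReal_dampML_of_ne {α μ b : ℝ} (hα : 0 < α) (hμ : 0 < μ) (h2 : μ ≠ 2) (hb : 0 < b)
    (z : ℝ) :
    (dampML α μ b z : ℂ) = (lamPlus μ * mittagLeffler α b (-lamPlus μ * z)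
        - lamMinus μ * mittagLeffler α b (-lamMinus μ * z)) / (lamPlus μ - lamMinus μ) := by
  rw [eq_div_iff (lamPlus_ne_lamMinus hμ h2)]
  unfold dampML mittagLeffler
  have h1 := summable_mittagLeffler hα hb (-lamPlus μ * z)
  have h2 := summable_mittagLeffler hα hb (-lamMinus μ * z)
  rw [Complex.ofReal_tsum, ← tsum_mul_left, ← tsum_mul_left, ← tsum_mul_right,
    ← (h1.mul_left _).tsum_sub (h2.mul_left _)]
  congr 1
  ext k
  push_cast
  have h := dampCoeff_mul_sub hμ k
  rw [div_mul_eq_mul_div, mul_div_assoc', mul_div_assoc', div_sub_div_same]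
  congr 1
  rw [show -lamPlus μ * (z : ℂ) = lamPlus μ * (-z) by ring,
    show -lamMinus μ * (z : ℂ) = lamMinus μ * (-z) by ring, mul_pow, mul_pow]
  linear_combination (-(z : ℂ)) ^ k * h

/-- With y = αk + b - 1 one has α(k+1) = y + (1+α-b) and Γ(y+1) = yΓ(y), so (k+1)/Γ(αk+b) splits
into the terms of the two Mittag-Leffler series. The condition b > 1 keeps y positive at k = 0. -/
theorem ofReal_dampML_two {α b : ℝ} (hα : 0 < α) (hb : 1 < b) (z : ℝ) :
    (dampML α 2 b z : ℂ) = (α : ℂ)⁻¹ * (mittagLeffler α (b - 1) (-z)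
      + ((1 + α - b : ℝ) : ℂ) * mittagLeffler α b (-z)) := by
  have h1 := summable_mittagLeffler hα (sub_pos.2 hb) (-z)
  have h2 := summable_mittagLeffler hα (zero_lt_one.trans hb) (-z)
  unfold dampML mittagLeffler
  rw [Complex.ofReal_tsum, ← tsum_mul_left, ← h1.tsum_add (h2.mul_left _), ← tsum_mul_left]
  congr 1
  ext k
  have hx : 0 < α * k + (b - 1) := by have := sub_pos.2 hb; positivity
  have hG := Real.Gamma_pos_of_pos hx
  rw [show α * k + b = α * k + (b - 1) + 1 by ring, Real.Gamma_add_one hx.ne', dampCoeff_two]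
  generalize hy : α * (k : ℝ) + (b - 1) = y at *
  have hk : (k : ℂ) = (y - (b - 1)) / α := by
    rw [eq_div_iff (by exact_mod_cast hα.ne'), ← hy]; push_cast; ring
  have hGc : (Real.Gamma y : ℂ) ≠ 0 := by exact_mod_cast hG.ne'
  have hyc : (y : ℂ) ≠ 0 := by exact_mod_cast hx.ne'
  have hαc : (α : ℂ) ≠ 0 := by exact_mod_cast hα.ne'
  push_cast
  rw [hk]
  field_simp
  ring

section
variable {n : ℕ} {α β σ μ : ℝ}

theorem symbolM_eq (hα : 0 < α) (hμ : 0 < μ) (hβ : 1 < β) (t : ℝ) (ξ : Space n) :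
    symbolM α β σ μ t ξ = ((t ^ (β - 1) * dampML α μ β (‖ξ‖ ^ σ * t ^ α) : ℝ) : ℂ) := by
  unfold symbolM phase
  generalize ‖ξ‖ ^ σ * t ^ α = z
  split_ifs with h
  · subst h
    rw [Complex.ofReal_mul, ofReal_dampML_two hα hβ]
    push_cast
    ring
  · rw [Complex.ofReal_mul, ofReal_dampML_of_ne hα hμ h (by linarith)]

theorem symbolJ_eq (hα : 0 < α) (hμ : 0 < μ) (t : ℝ) (ξ : Space n) :
    symbolJ α σ μ t ξ = ((t * dampML α μ 2 (‖ξ‖ ^ σ * t ^ α) : ℝ) : ℂ) := by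
  unfold symbolJ phase
  generalize ‖ξ‖ ^ σ * t ^ α = z
  split_ifs with h
  · subst h
    rw [Complex.ofReal_mul, ofReal_dampML_two hα one_lt_two, show (2 - 1 : ℝ) = 1 by norm_num,
      show 1 + α - 2 = α - 1 by ring]
    push_cast
    ring
  · rw [Complex.ofReal_mul, ofReal_dampML_of_ne hα hμ h two_pos]

/-- Splitting two terms off each E_{α,1} leaves E_{α,2α+1}. For μ ≠ 2 the relation λ₊λ₋ = 1 makes
the constant terms add up to 1 and the linear terms cancel. In this form N̂ is visibly 1 minus ω²
times a kernel of the family. -/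
theorem symbolN_eq (hα : 0 < α) (hμ : 0 < μ) (t : ℝ) (ξ : Space n) :
    symbolN α σ μ t ξ = ((1 - (‖ξ‖ ^ σ * t ^ α) ^ 2
      * dampML α μ (2 * α + 1) (‖ξ‖ ^ σ * t ^ α) : ℝ) : ℂ) := by
  unfold symbolN phase
  generalize ‖ξ‖ ^ σ * t ^ α = z
  have hαc : (α : ℂ) ≠ 0 := by exact_mod_cast hα.ne'
  have hG : (Real.Gamma α : ℂ) ≠ 0 := by exact_mod_cast (Real.Gamma_pos_of_pos hα).ne'
  split_ifs with h
  · subst h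
    have e1 := mittagLeffler_recurrence hα one_pos (-(z : ℂ))
    have e2 := mittagLeffler_recurrence hα (show 0 < 1 + α by positivity) (-(z : ℂ))
    have e3 := mittagLeffler_recurrence hα hα (-(z : ℂ))
    push_cast
    rw [ofReal_dampML_two hα (by linarith : 1 < 2 * α + 1), e1, e2, e3, add_comm 1 α,
      Real.Gamma_add_one hα.ne', Real.Gamma_one, show 2 * α + 1 - 1 = α + α by ring,
      show α + 1 + α = 2 * α + 1 by ring]
    push_cast
    field_simp
    ring
  · have e1 := mittagLeffler_recurrence hα one_pos (-lamPlus μ * z)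
    have e2 := mittagLeffler_recurrence hα (show 0 < 1 + α by positivity) (-lamPlus μ * z)
    have e3 := mittagLeffler_recurrence hα one_pos (-lamMinus μ * z)
    have e4 := mittagLeffler_recurrence hα (show 0 < 1 + α by positivity) (-lamMinus μ * z)
    have hG1 : (Real.Gamma (1 + α) : ℂ) ≠ 0 := by
      exact_mod_cast (Real.Gamma_pos_of_pos (by positivity)).ne'
    push_cast
    rw [ofReal_dampML_of_ne hα hμ h (by positivity : 0 < 2 * α + 1), e1, e2, e3, e4,
      Real.Gamma_one, show 1 + α + α = 2 * α + 1 by ring]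
    have hne := lamPlus_ne_lamMinus hμ h
    have hm := lamPlus_mul_lamMinus hμ
    have hp0 : lamPlus μ ≠ 0 := left_ne_zero_of_mul_eq_one hm
    generalize mittagLeffler α (2 * α + 1) (-lamPlus μ * z) = E1
    generalize mittagLeffler α (2 * α + 1) (-lamMinus μ * z) = E2
    generalize lamMinus μ = q at *
    generalize lamPlus μ = p at *
    have hq0 : q ≠ 0 := right_ne_zero_of_mul_eq_one hm
    have d1 : 1 - p ^ 2 = -(p * (p - q)) := by linear_combination -hm
    have d2 : 1 - q ^ 2 = q * (p - q) := by linear_combination -hm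
    rw [d1, d2]
    push_cast
    field_simp
    linear_combination -(p - q) * Real.Gamma (1 + α) * hm

end

/-! ### Riemann–Liouville integrals of the kernels -/

theorem integral_sub_rpow_mul_rpow {a c t : ℝ} (ha : 0 < a) (hc : 0 < c) (ht : 0 < t) :
    ∫ τ in (0 : ℝ)..t, (t - τ) ^ (a - 1) * τ ^ (c - 1)
      = t ^ (a + c - 1) * (Real.Gamma a * Real.Gamma c / Real.Gamma (a + c)) := by
  have h := Complex.betaIntegral_scaled (c : ℂ) (a : ℂ) ht
  rw [Complex.betaIntegral_eq_Gamma_mul_div _ _ (by simpa) (by simpa)] at h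
  rw [← Complex.ofReal_add, Complex.Gamma_ofReal, Complex.Gamma_ofReal, Complex.Gamma_ofReal,
    ← Complex.ofReal_one, ← Complex.ofReal_sub (c + a), ← Complex.ofReal_cpow ht.le] at h
  have h2 : ∫ τ in (0 : ℝ)..t, (τ : ℂ) ^ (((c : ℝ) : ℂ) - ((1 : ℝ) : ℂ))
        * ((t : ℂ) - (τ : ℂ)) ^ (((a : ℝ) : ℂ) - ((1 : ℝ) : ℂ))
      = ∫ τ in (0 : ℝ)..t, (((t - τ) ^ (a - 1) * τ ^ (c - 1) : ℝ) : ℂ) := by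
    refine intervalIntegral.integral_congr fun τ hτ => ?_
    rw [uIcc_of_le ht.le] at hτ
    rw [Complex.ofReal_mul, Complex.ofReal_cpow hτ.1, Complex.ofReal_cpow (sub_nonneg.2 hτ.2)]
    push_cast
    ring
  rw [h2, intervalIntegral.integral_ofReal] at h
  have h3 : ∫ τ in (0 : ℝ)..t, (t - τ) ^ (a - 1) * τ ^ (c - 1)
      = t ^ (c + a - 1) * (Real.Gamma c * Real.Gamma a / Real.Gamma (c + a)) := by
    exact_mod_cast h
  rw [h3, add_comm c a, mul_comm (Real.Gamma c)]

theorem intervalIntegrable_sub_rpow_mul_rpow {a c t : ℝ} (ha : 0 < a) (hc : 0 < c) (ht : 0 < t) :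
    IntervalIntegrable (fun τ => (t - τ) ^ (a - 1) * τ ^ (c - 1)) volume 0 t := by
  rw [intervalIntegrable_iff_integrableOn_Ioc_of_le ht.le]
  -- A non-integrable function has integral `0` by convention, so the nonzero value of the Beta
  -- integral already proves integrability.
  refine Integrable.of_integral_ne_zero ?_
  rw [← intervalIntegral.integral_of_le ht.le, integral_sub_rpow_mul_rpow ha hc ht]
  have := Real.Gamma_pos_of_pos ha
  have := Real.Gamma_pos_of_pos hc
  have := Real.Gamma_pos_of_pos (add_pos ha hc)
  positivity

theorem integral_rlKernel_mul_rpow {a c t : ℝ} (ha : 0 < a) (hc : 0 < c) (ht : 0 < t) :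
    ∫ τ in (0 : ℝ)..t, (t - τ) ^ (a - 1) / Real.Gamma a * (τ ^ (c - 1) / Real.Gamma c)
      = t ^ (a + c - 1) / Real.Gamma (a + c) := by
  have h1 := Real.Gamma_pos_of_pos ha
  have h2 := Real.Gamma_pos_of_pos hc
  have e : ∀ τ : ℝ, (t - τ) ^ (a - 1) / Real.Gamma a * (τ ^ (c - 1) / Real.Gamma c)
      = ((Real.Gamma a)⁻¹ * (Real.Gamma c)⁻¹) * ((t - τ) ^ (a - 1) * τ ^ (c - 1)) :=
    fun τ => by ring
  simp_rw [e]
  rw [intervalIntegral.integral_const_mul, integral_sub_rpow_mul_rpow ha hc ht]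
  field_simp

/-- The fundamental solution `t^(b-1) ∑ c_k (-ω t^α)^k / Γ(α k + b)`. -/
noncomputable def dampKernel (α μ b ω t : ℝ) : ℝ := t ^ (b - 1) * dampML α μ b (ω * t ^ α)

/-- The series is integrated term by term; each term is a Beta integral and Γ(αk+b) becomes
Γ(αk+a+b). -/
theorem integral_rlKernel_mul_dampKernel {α μ a b t : ℝ} (hα : 0 < α) (hμ : 0 < μ) (ha : 0 < a)
    (hb : 0 < b) (ht : 0 < t) (ω : ℝ) :
    ∫ τ in (0 : ℝ)..t, (t - τ) ^ (a - 1) / Real.Gamma a * dampKernel α μ b ω τ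
      = dampKernel α μ (a + b) ω t := by
  set F : ℕ → ℝ → ℝ := fun k τ => (dampCoeff μ k * (-ω) ^ k)
    * ((t - τ) ^ (a - 1) / Real.Gamma a * (τ ^ (α * k + b - 1) / Real.Gamma (α * k + b))) with hF
  have hk : ∀ k : ℕ, 0 < α * k + b := fun k => by positivity
  have hGa := Real.Gamma_pos_of_pos ha
  have hnn : ∀ (k : ℕ), ∀ τ ∈ Ioc 0 t, 0 ≤
      (t - τ) ^ (a - 1) / Real.Gamma a * (τ ^ (α * k + b - 1) / Real.Gamma (α * k + b)) := by
    intro k τ hτ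
    have h1 : 0 ≤ t - τ := sub_nonneg.2 hτ.2
    have h2 : 0 ≤ τ := hτ.1.le
    have h3 := Real.Gamma_pos_of_pos (hk k)
    positivity
  have hval : ∀ k : ℕ, t ^ (a + (α * k + b) - 1) / Real.Gamma (a + (α * k + b))
      = t ^ (a + b - 1) * ((t ^ α) ^ k / Real.Gamma (α * k + (a + b))) := by
    intro k
    rw [show a + (α * k + b) - 1 = (a + b - 1) + α * k by ring, Real.rpow_add ht,
      Real.rpow_mul ht.le, Real.rpow_natCast, show a + (α * k + b) = α * k + (a + b) by ring]
    ring
  have hint : ∀ k, Integrable (F k) (volume.restrict (Ioc 0 t)) := by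
    intro k
    have := (intervalIntegrable_sub_rpow_mul_rpow ha (hk k) ht).const_mul
      (dampCoeff μ k * (-ω) ^ k * ((Real.Gamma a)⁻¹ * (Real.Gamma (α * k + b))⁻¹))
    rw [intervalIntegrable_iff_integrableOn_Ioc_of_le ht.le] at this
    refine this.congr (Filter.Eventually.of_forall fun τ => ?_)
    simp only [hF]
    ring
  have hI : ∀ k, ∫ τ in Ioc 0 t, F k τ
      = t ^ (a + b - 1) * (dampCoeff μ k * (-(ω * t ^ α)) ^ k
        / Real.Gamma (α * k + (a + b))) := by
    intro k
    rw [hF, integral_const_mul, ← intervalIntegral.integral_of_le ht.le,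
      integral_rlKernel_mul_rpow ha (hk k) ht, hval, neg_mul_eq_neg_mul, mul_pow]
    ring
  -- Each `F k` has constant sign on the interval, so its L¹ norm is the absolute value of its
  -- integral, and these values are summable.
  have hInorm : ∀ k, ∫ τ in Ioc 0 t, ‖F k τ‖
      = ‖t ^ (a + b - 1) * (dampCoeff μ k * (-(ω * t ^ α)) ^ k
        / Real.Gamma (α * k + (a + b)))‖ := by
    intro k
    rw [← hI k, hF, integral_const_mul, norm_mul, Real.norm_of_nonneg
      (setIntegral_nonneg measurableSet_Ioc (hnn k)), ← integral_const_mul]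
    refine setIntegral_congr_fun measurableSet_Ioc fun τ hτ => ?_
    simp only
    rw [norm_mul, Real.norm_of_nonneg (hnn k τ hτ)]
  have hsum := hasSum_integral_of_summable_integral_norm hint (by
    simp_rw [hInorm]
    exact ((summable_dampML hα hμ (add_pos ha hb) _).mul_left _).norm)
  simp_rw [hI] at hsum
  have h2 := (summable_dampML hα hμ (add_pos ha hb) (ω * t ^ α)).hasSum.mul_left (t ^ (a + b - 1))
  rw [dampKernel, dampML, h2.unique hsum, intervalIntegral.integral_of_le ht.le]
  refine setIntegral_congr_fun measurableSet_Ioc fun τ hτ => ?_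
  simp only [hF, dampKernel, dampML]
  rw [← tsum_mul_left, ← tsum_mul_left]
  refine tsum_congr fun k => ?_
  rw [show α * k + b - 1 = (b - 1) + α * k by ring, Real.rpow_add hτ.1, Real.rpow_mul hτ.1.le,
    Real.rpow_natCast, neg_mul_eq_neg_mul, mul_pow]
  ring

theorem dampKernel_recurrence {α μ b t : ℝ} (hα : 0 < α) (hμ : 0 < μ) (hb : 0 < b) (ht : 0 < t)
    (ω : ℝ) :
    dampKernel α μ b ω t + μ * ω * dampKernel α μ (b + α) ω t
      + ω ^ 2 * dampKernel α μ (b + 2 * α) ω t = t ^ (b - 1) / Real.Gamma b := by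
  unfold dampKernel
  have h := dampML_recurrence hα hμ hb (ω * t ^ α)
  rw [show b + α - 1 = (b - 1) + α by ring, show b + 2 * α - 1 = (b - 1) + α + α by ring,
    Real.rpow_add ht, Real.rpow_add ht, Real.rpow_add ht, div_eq_mul_inv, ← h]
  ring

theorem intervalIntegrable_sub_rpow {a t : ℝ} (ha : 0 < a) :
    IntervalIntegrable (fun τ => (t - τ) ^ (a - 1)) volume 0 t := by
  have := (intervalIntegral.intervalIntegrable_rpow' (a := 0) (b := t)
    (by linarith : -1 < a - 1)).comp_sub_left t
  simpa using this.symm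

/-! ### Positivity of the fractional integral -/

/-- The inner convolution w solves w' + rw = v with w(0) = 0, so the integral equals w(1)²/2 + r∫w².
-/
theorem integral_mul_exp_conv_nonneg {v : ℝ → ℝ} (hv : Continuous v) {r : ℝ} (hr : 0 ≤ r) :
    0 ≤ ∫ t in (0 : ℝ)..1, v t * ∫ s in (0 : ℝ)..t, Real.exp (-(r * (t - s))) * v s := by
  set P : ℝ → ℝ := fun t => ∫ s in (0 : ℝ)..t, Real.exp (r * s) * v s with hP
  have hcont : Continuous fun s => Real.exp (r * s) * v s := by fun_prop
  have hPd : ∀ t, HasDerivAt P (Real.exp (r * t) * v t) t := fun t =>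
    intervalIntegral.integral_hasDerivAt_right (hcont.intervalIntegrable _ _)
      (hcont.stronglyMeasurableAtFilter _ _) hcont.continuousAt
  have hPc : Continuous P := continuous_iff_continuousAt.2 fun t => (hPd t).continuousAt
  have hw : ∀ t, ∫ s in (0 : ℝ)..t, Real.exp (-(r * (t - s))) * v s
      = Real.exp (-(r * t)) * P t := by
    intro t
    rw [hP, ← intervalIntegral.integral_const_mul]
    congr 1
    ext s
    rw [← mul_assoc, ← Real.exp_add]
    congr 2
    ring
  simp_rw [hw]
  have hd : ∀ t, HasDerivAt (fun t => Real.exp (-(r * t)) ^ 2 * P t ^ 2 / 2)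
      (v t * (Real.exp (-(r * t)) * P t) - r * (Real.exp (-(r * t)) * P t) ^ 2) t := by
    intro t
    have h1 : HasDerivAt (fun t => Real.exp (-(r * t))) (Real.exp (-(r * t)) * -(r * 1)) t :=
      (((hasDerivAt_id t).const_mul r).neg).exp
    refine (((h1.fun_pow 2).fun_mul ((hPd t).fun_pow 2)).div_const 2).congr_deriv ?_
    have he : Real.exp (-(r * t)) * Real.exp (r * t) = 1 := by
      rw [← Real.exp_add]; simp
    push_cast
    linear_combination (v t * Real.exp (-(r * t)) * P t) * he
  have hint := intervalIntegral.integral_eq_sub_of_hasDerivAt (a := 0) (b := 1)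
    (fun t _ => hd t) (Continuous.intervalIntegrable (by fun_prop) _ _)
  rw [intervalIntegral.integral_sub (Continuous.intervalIntegrable (by fun_prop) _ _)
    (Continuous.intervalIntegrable (by fun_prop) _ _)] at hint
  have h0 : P 0 = 0 := by simp [hP]
  have h2 : 0 ≤ ∫ t in (0 : ℝ)..1, r * (Real.exp (-(r * t)) * P t) ^ 2 :=
    intervalIntegral.integral_nonneg zero_le_one fun t _ => by positivity
  have h3 : 0 ≤ Real.exp (-(r * 1)) ^ 2 * P 1 ^ 2 / 2 := by positivity
  rw [h0] at hint
  linarith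

theorem integral_rpow_neg_mul_exp {α x : ℝ} (hα : α < 1) (hx : 0 < x) :
    ∫ r in Ioi (0 : ℝ), r ^ (-α) * Real.exp (-(r * x)) = Real.Gamma (1 - α) * x ^ (α - 1) := by
  have h := Real.integral_rpow_mul_exp_neg_mul_Ioi (a := 1 - α) (sub_pos.2 hα) hx
  rw [show (1 - α - 1) = -α by ring, one_div, Real.inv_rpow hx.le, ← Real.rpow_neg hx.le,
    neg_sub, mul_comm] at h
  rw [← h]
  simp_rw [mul_comm x]

theorem integrableOn_rpow_neg_mul_exp {α x : ℝ} (hα : α < 1) (hx : 0 < x) :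
    IntegrableOn (fun r : ℝ => r ^ (-α) * Real.exp (-(r * x))) (Ioi 0) := by
  refine Integrable.of_integral_ne_zero ?_
  rw [integral_rpow_neg_mul_exp hα hx]
  have := Real.Gamma_pos_of_pos (sub_pos.2 hα)
  positivity

/-- The kernel x^{α-1} is a positive mixture of the exponentials e^{-rx} with weight r^{-α}; the
rest is Fubini. -/
theorem integral_rpow_mul_eq_laplace {v : ℝ → ℝ} (hv : Continuous v) {α t : ℝ} (h0 : 0 < α)
    (hα : α < 1) (ht : 0 < t) :
    Real.Gamma (1 - α) * ∫ s in (0 : ℝ)..t, (t - s) ^ (α - 1) * v s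
      = ∫ r in Ioi (0 : ℝ), r ^ (-α) * ∫ s in (0 : ℝ)..t, Real.exp (-(r * (t - s))) * v s := by
  -- At s = t the exponential does not decay and the integral in r diverges.
  have hlt : ∀ᵐ s ∂(volume.restrict (Ioc 0 t)), s < t := by
    filter_upwards [ae_restrict_mem measurableSet_Ioc, Measure.ae_ne _ t] with s hs hne
    exact lt_of_le_of_ne hs.2 hne
  have hint : Integrable (Function.uncurry fun s r : ℝ =>
      v s * (r ^ (-α) * Real.exp (-(r * (t - s)))))
      ((volume.restrict (Ioc 0 t)).prod (volume.restrict (Ioi 0))) := by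
    have hmeas : Measurable (Function.uncurry fun s r : ℝ =>
        v s * (r ^ (-α) * Real.exp (-(r * (t - s))))) := by
      unfold Function.uncurry
      have := hv.measurable
      fun_prop
    rw [integrable_prod_iff hmeas.aestronglyMeasurable]
    refine ⟨?_, ?_⟩
    · filter_upwards [hlt] with s hs
      exact (integrableOn_rpow_neg_mul_exp hα (sub_pos.2 hs)).const_mul (v s)
    · have h1 : IntegrableOn (fun s => (Real.Gamma (1 - α) * (t - s) ^ (α - 1)) * ‖v s‖)
          (Ioc 0 t) := by
        have := ((intervalIntegrable_sub_rpow h0 (t := t)).const_mul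
          (Real.Gamma (1 - α))).mul_continuousOn hv.norm.continuousOn
        rwa [intervalIntegrable_iff_integrableOn_Ioc_of_le ht.le] at this
      refine Integrable.congr h1 ?_
      filter_upwards [hlt] with s hs
      rw [← integral_rpow_neg_mul_exp hα (sub_pos.2 hs), mul_comm, ← integral_const_mul]
      refine setIntegral_congr_fun measurableSet_Ioi fun r hr => ?_
      have : (0 : ℝ) < r := hr
      simp only [Function.uncurry]
      rw [norm_mul, Real.norm_of_nonneg (by positivity : 0 ≤ r ^ (-α) * _)]
  have hswap := integral_integral_swap hint
  rw [intervalIntegral.integral_of_le ht.le, ← integral_const_mul]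
  trans ∫ s in Ioc 0 t, ∫ r in Ioi 0, v s * (r ^ (-α) * Real.exp (-(r * (t - s))))
  · refine integral_congr_ae ?_
    filter_upwards [hlt] with s hs
    rw [integral_const_mul, integral_rpow_neg_mul_exp hα (sub_pos.2 hs)]
    ring
  · rw [hswap]
    congr 1
    ext r
    rw [intervalIntegral.integral_of_le ht.le, ← integral_const_mul]
    congr 1
    ext s
    ring

/-- Supplies the dominating function for integrating in r: against r^{-α}, the bound 1 serves near r
= 0 (as α < 1) and r⁻¹ serves near infinity (as α > 0). -/
theorem abs_exp_conv_le {v : ℝ → ℝ} {V : ℝ} (hV : ∀ s ∈ Icc (0 : ℝ) 1, |v s| ≤ V)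
    {t r : ℝ} (ht : t ∈ Icc (0 : ℝ) 1) (hr : 0 < r) :
    |∫ s in (0 : ℝ)..t, Real.exp (-(r * (t - s))) * v s| ≤ V * min 1 r⁻¹ := by
  have hV0 : 0 ≤ V := (abs_nonneg _).trans (hV 0 (by simp))
  have hvs : ∀ s ∈ Ioc 0 t, |v s| ≤ V := fun s hs => hV s ⟨hs.1.le, hs.2.trans ht.2⟩
  have hb : ∀ s ∈ Ioc 0 t, ‖Real.exp (-(r * (t - s))) * v s‖ ≤ Real.exp (-(r * (t - s))) * V := by
    intro s hs
    rw [norm_mul, Real.norm_of_nonneg (Real.exp_pos _).le]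
    gcongr
    exact hvs s hs
  have h := intervalIntegral.norm_integral_le_of_norm_le (μ := volume) ht.1 (Filter.Eventually.of_forall hb)
    (Continuous.intervalIntegrable (by fun_prop) _ _)
  rw [Real.norm_eq_abs, intervalIntegral.integral_mul_const] at h
  have hI : ∫ s in (0 : ℝ)..t, Real.exp (-(r * (t - s))) = r⁻¹ - Real.exp (-(r * t)) / r := by
    have hd : ∀ s, HasDerivAt (fun s => Real.exp (-(r * (t - s))) / r)
        (Real.exp (-(r * (t - s)))) s := by
      intro s
      have h1 : HasDerivAt (fun s => -(r * (t - s))) (-(r * -1)) s :=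
        (((hasDerivAt_id s).const_sub t).const_mul r).neg
      refine (h1.exp.div_const r).congr_deriv ?_
      field_simp
    rw [intervalIntegral.integral_eq_sub_of_hasDerivAt (fun s _ => hd s)
      (Continuous.intervalIntegrable (by fun_prop) _ _)]
    simp
  have h1 : ∫ s in (0 : ℝ)..t, Real.exp (-(r * (t - s))) ≤ 1 := by
    have := intervalIntegral.integral_mono_on (μ := volume) (f := fun s => Real.exp (-(r * (t - s))))
      (g := fun _ => (1 : ℝ)) ht.1
      (Continuous.intervalIntegrable (by fun_prop) _ _)
      (Continuous.intervalIntegrable (by fun_prop) _ _) (fun s hs => by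
        rw [Real.exp_le_one_iff, neg_nonpos]
        exact mul_nonneg hr.le (sub_nonneg.2 hs.2))
    simp only [intervalIntegral.integral_const, sub_zero, smul_eq_mul, mul_one] at this
    exact this.trans ht.2
  have h2 : ∫ s in (0 : ℝ)..t, Real.exp (-(r * (t - s))) ≤ r⁻¹ := by
    rw [hI]
    have := Real.exp_pos (-(r * t))
    have : 0 < Real.exp (-(r * t)) / r := by positivity
    linarith
  calc _ ≤ _ := h
    _ ≤ min 1 r⁻¹ * V := by gcongr; exact le_min h1 h2
    _ = V * min 1 r⁻¹ := mul_comm _ _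

theorem integrableOn_rpow_neg_mul_min {α : ℝ} (h0 : 0 < α) (hα : α < 1) :
    IntegrableOn (fun r : ℝ => r ^ (-α) * min 1 r⁻¹) (Ioi 0) := by
  rw [← Ioc_union_Ioi_eq_Ioi (zero_le_one' ℝ)]
  refine IntegrableOn.union ?_ ?_
  · have := intervalIntegral.intervalIntegrable_rpow' (a := 0) (b := 1)
      (by linarith : -1 < -α)
    rw [intervalIntegrable_iff_integrableOn_Ioc_of_le zero_le_one] at this
    refine this.congr_fun (fun r hr => ?_) measurableSet_Ioc
    simp only
    rw [min_eq_left (one_le_inv_iff₀.2 hr), mul_one]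
  · have := integrableOn_Ioi_rpow_of_lt (by linarith : -α - 1 < -1) zero_lt_one
    refine this.congr_fun (fun r hr => ?_) measurableSet_Ioi
    have hr' : (1 : ℝ) < r := hr
    simp only
    rw [min_eq_right (inv_le_one_of_one_le₀ hr'.le), Real.rpow_sub_one (by positivity)]
    rfl

/-- Averaging the positivity for exponential kernels over r with the weight r^{-α} gives it for the
fractional kernel. -/
theorem integral_mul_fractional_nonneg {v : ℝ → ℝ} (hv : Continuous v) {α : ℝ} (h0 : 0 < α)
    (hα : α ≤ 1) :
    0 ≤ ∫ t in (0 : ℝ)..1, v t * ∫ s in (0 : ℝ)..t, (t - s) ^ (α - 1) * v s := by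
  rcases hα.eq_or_lt with rfl | hα
  -- For α = 1 the kernel is constant, which is the exponential kernel with r = 0.
  · simpa using integral_mul_exp_conv_nonneg hv le_rfl
  have hG := Real.Gamma_pos_of_pos (sub_pos.2 hα)
  suffices h : 0 ≤ Real.Gamma (1 - α) * ∫ t in (0 : ℝ)..1,
      v t * ∫ s in (0 : ℝ)..t, (t - s) ^ (α - 1) * v s from
    nonneg_of_mul_nonneg_right h hG
  set W : ℝ → ℝ → ℝ := fun t r => ∫ s in (0 : ℝ)..t, Real.exp (-(r * (t - s))) * v s with hW
  have hWc : Continuous (Function.uncurry W) := by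
    have h1 : Continuous (Function.uncurry fun (p : ℝ × ℝ) (s : ℝ) =>
        Real.exp (-(p.2 * (p.1 - s))) * v s) := by
      unfold Function.uncurry; fun_prop
    have h2 := intervalIntegral.continuous_parametric_primitive_of_continuous
      (μ := volume) (a₀ := 0) h1
    exact h2.comp (f := fun p : ℝ × ℝ => (p, p.1)) (by fun_prop)
  obtain ⟨V, hV⟩ := isCompact_Icc.exists_bound_of_continuousOn (hv.continuousOn (s := Icc 0 1))
  have hint : Integrable (Function.uncurry fun t r : ℝ => v t * (r ^ (-α) * W t r))
      ((volume.restrict (Ioc 0 1)).prod (volume.restrict (Ioi 0))) := by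
    have hdom : Integrable (fun p : ℝ × ℝ => (V * V) * (p.2 ^ (-α) * min 1 p.2⁻¹))
        ((volume.restrict (Ioc 0 1)).prod (volume.restrict (Ioi 0))) :=
      Integrable.mul_prod (f := fun _ : ℝ => V * V)
        (g := fun r : ℝ => r ^ (-α) * min 1 r⁻¹)
        (integrable_const _) (integrableOn_rpow_neg_mul_min h0 hα)
    refine hdom.mono' ?_ ?_
    · have h1 : Measurable fun p : ℝ × ℝ => v p.1 * (p.2 ^ (-α) * W p.1 p.2) := by
        have := hv.measurable
        have := hWc.measurable
        have h3 : Measurable fun p : ℝ × ℝ => W p.1 p.2 := hWc.measurable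
        fun_prop
      exact h1.aestronglyMeasurable
    · rw [Measure.prod_restrict]
      filter_upwards [ae_restrict_mem (measurableSet_Ioc.prod measurableSet_Ioi)] with p hp
      have hp1 : p.1 ∈ Icc (0 : ℝ) 1 := ⟨hp.1.1.le, hp.1.2⟩
      have hp2 : (0 : ℝ) < p.2 := hp.2
      have hV0 : 0 ≤ V := (norm_nonneg _).trans (hV 0 (by simp))
      simp only [Function.uncurry]
      rw [norm_mul, norm_mul, Real.norm_of_nonneg (by positivity : 0 ≤ p.2 ^ (-α))]
      calc ‖v p.1‖ * (p.2 ^ (-α) * ‖W p.1 p.2‖)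
          ≤ V * (p.2 ^ (-α) * (V * min 1 p.2⁻¹)) := by
            gcongr
            · exact hV _ hp1
            · exact abs_exp_conv_le hV hp1 hp2
        _ = _ := by ring
  rw [← intervalIntegral.integral_const_mul, intervalIntegral.integral_of_le zero_le_one]
  have e1 : ∫ t in Ioc (0 : ℝ) 1, Real.Gamma (1 - α)
        * (v t * ∫ s in (0 : ℝ)..t, (t - s) ^ (α - 1) * v s)
      = ∫ t in Ioc (0 : ℝ) 1, ∫ r in Ioi (0 : ℝ), v t * (r ^ (-α) * W t r) := by
    refine setIntegral_congr_fun measurableSet_Ioc fun t ht => ?_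
    rw [mul_left_comm, integral_rpow_mul_eq_laplace hv h0 hα ht.1, integral_const_mul]
  rw [e1, integral_integral_swap hint]
  refine setIntegral_nonneg measurableSet_Ioi fun r hr => ?_
  have hr' : (0 : ℝ) < r := hr
  have e2 : ∫ t in Ioc (0 : ℝ) 1, v t * (r ^ (-α) * W t r)
      = r ^ (-α) * ∫ t in (0 : ℝ)..1, v t * W t r := by
    rw [intervalIntegral.integral_of_le zero_le_one, ← integral_const_mul]
    congr 1
    ext t
    ring
  rw [e2]
  exact mul_nonneg (by positivity) (integral_mul_exp_conv_nonneg hv hr'.le)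

/-! ### Polynomial growth of the symbols -/

theorem continuous_dampKernel {α μ b : ℝ} (hα : 0 < α) (hμ : 0 < μ) (hb : 1 ≤ b) (ω : ℝ) :
    Continuous (dampKernel α μ b ω) := by
  unfold dampKernel
  have h1 := Real.continuous_rpow_const (sub_nonneg.2 hb)
  have h2 := Real.continuous_rpow_const hα.le
  have h3 := continuous_dampML hα hμ (zero_lt_one.trans_le hb)
  fun_prop

theorem integral_dampKernel_mul_nonneg {α μ b : ℝ} (hα : 0 < α) (hα' : α ≤ 1) (hμ : 0 < μ)
    (hb : 1 ≤ b) (ω : ℝ) :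
    0 ≤ ∫ t in (0 : ℝ)..1, dampKernel α μ b ω t * dampKernel α μ (b + α) ω t := by
  have hG := Real.Gamma_pos_of_pos hα
  have h := integral_mul_fractional_nonneg (continuous_dampKernel hα hμ hb ω) hα hα'
  have e : ∫ t in (0 : ℝ)..1, dampKernel α μ b ω t *
        ∫ s in (0 : ℝ)..t, (t - s) ^ (α - 1) * dampKernel α μ b ω s
      = Real.Gamma α * ∫ t in (0 : ℝ)..1, dampKernel α μ b ω t * dampKernel α μ (b + α) ω t := by
    rw [← intervalIntegral.integral_const_mul, intervalIntegral.integral_of_le zero_le_one,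
      intervalIntegral.integral_of_le zero_le_one]
    refine setIntegral_congr_fun measurableSet_Ioc fun t ht => ?_
    rw [add_comm b α, ← integral_rlKernel_mul_dampKernel hα hμ hα (by linarith) ht.1,
      mul_left_comm]
    congr 1
    rw [← intervalIntegral.integral_const_mul]
    refine intervalIntegral.integral_congr fun s _ => ?_
    field_simp
  rw [e] at h
  exact nonneg_of_mul_nonneg_right h hG

/-- Energy estimate. With v, y, q the kernels of orders b, b+α, b+2α, the identity v + μωy + ω²q = g
is multiplied by y and integrated over [0,1]. Since y = I^α v and q = I^α y, the outer terms are
nonnegative and ∫y² is bounded uniformly in ω ≥ 1. Then q(1) = (I^α y)(1) is controlled by the L²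
norms of y and of the kernel of I^α. -/
theorem exists_dampML_bound_of_large {α μ b : ℝ} (hα : 1 / 2 < α) (hα' : α ≤ 1) (hμ : 0 < μ)
    (hb : 1 ≤ b) : ∃ C, ∀ ω ≥ 1, |dampML α μ (b + 2 * α) ω| ≤ C := by
  have hα0 : 0 < α := by linarith
  set g : ℝ → ℝ := fun t => t ^ (b - 1) / Real.Gamma b with hg
  have hgc : Continuous g := by
    have h1 := Real.continuous_rpow_const (sub_nonneg.2 hb)
    fun_prop
  -- The square of the kernel of I^α at t = 1; its exponent 2α - 2 exceeds -1 exactly because α >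
  -- 1/2.
  set k : ℝ → ℝ := fun s => (1 - s) ^ ((2 * α - 1) - 1) / Real.Gamma α ^ 2 with hk
  have hki : IntervalIntegrable k volume 0 1 :=
    (intervalIntegrable_sub_rpow (by linarith)).div_const _
  refine ⟨((∫ s in (0 : ℝ)..1, k s) + (∫ t in (0 : ℝ)..1, g t ^ 2) / μ ^ 2) / 2,
    fun ω hω => ?_⟩
  set v := dampKernel α μ b ω
  set y := dampKernel α μ (b + α) ω with hy
  set q := dampKernel α μ (b + 2 * α) ω with hq
  have hvc : Continuous v := continuous_dampKernel hα0 hμ hb ω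
  have hyc : Continuous y := continuous_dampKernel hα0 hμ (by linarith) ω
  have hqc : Continuous q := continuous_dampKernel hα0 hμ (by linarith) ω
  have hvy : 0 ≤ ∫ t in (0 : ℝ)..1, v t * y t :=
    integral_dampKernel_mul_nonneg hα0 hα' hμ hb ω
  have hyq : 0 ≤ ∫ t in (0 : ℝ)..1, y t * q t := by
    have := integral_dampKernel_mul_nonneg hα0 hα' hμ (show 1 ≤ b + α by linarith) ω
    rwa [show b + α + α = b + 2 * α by ring] at this
  have hω0 : 0 < ω := by linarith
  have henergy : (∫ t in (0 : ℝ)..1, v t * y t) + μ * ω * (∫ t in (0 : ℝ)..1, y t ^ 2)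
      + ω ^ 2 * (∫ t in (0 : ℝ)..1, y t * q t) = ∫ t in (0 : ℝ)..1, g t * y t := by
    rw [← intervalIntegral.integral_const_mul, ← intervalIntegral.integral_const_mul,
      ← intervalIntegral.integral_add, ← intervalIntegral.integral_add,
      intervalIntegral.integral_of_le zero_le_one, intervalIntegral.integral_of_le zero_le_one]
    · refine setIntegral_congr_fun measurableSet_Ioc fun t ht => ?_
      have := dampKernel_recurrence hα0 hμ (zero_lt_one.trans_le hb) ht.1 ω
      simp only [hg, ← this]
      ring
    all_goals exact Continuous.intervalIntegrable (by fun_prop) _ _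
  -- Young's inequality weighted so that the term in y² is absorbed by half of the damping term
  -- μω∫y².
  have hyoung : ∫ t in (0 : ℝ)..1, g t * y t
      ≤ (2 * (μ * ω))⁻¹ * (∫ t in (0 : ℝ)..1, g t ^ 2)
        + (μ * ω / 2) * ∫ t in (0 : ℝ)..1, y t ^ 2 := by
    rw [← intervalIntegral.integral_const_mul, ← intervalIntegral.integral_const_mul,
      ← intervalIntegral.integral_add]
    · refine intervalIntegral.integral_mono_on zero_le_one ?_ ?_ fun t _ => ?_
      · exact Continuous.intervalIntegrable (by fun_prop) _ _
      · exact Continuous.intervalIntegrable (by fun_prop) _ _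
      · have hm : 0 < μ * ω := by positivity
        have : (2 * (μ * ω))⁻¹ * g t ^ 2 + μ * ω / 2 * y t ^ 2 - g t * y t
            = (2 * (μ * ω))⁻¹ * (g t - μ * ω * y t) ^ 2 := by
          field_simp
          ring
        have h2 : 0 ≤ (2 * (μ * ω))⁻¹ * (g t - μ * ω * y t) ^ 2 := by positivity
        linarith
    all_goals exact Continuous.intervalIntegrable (by fun_prop) _ _
  have hg2 : 0 ≤ ∫ t in (0 : ℝ)..1, g t ^ 2 :=
    intervalIntegral.integral_nonneg zero_le_one fun t _ => by positivity
  have hy2 : 0 ≤ ∫ t in (0 : ℝ)..1, y t ^ 2 :=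
    intervalIntegral.integral_nonneg zero_le_one fun t _ => by positivity
  have hyle : ∫ t in (0 : ℝ)..1, y t ^ 2 ≤ (∫ t in (0 : ℝ)..1, g t ^ 2) / μ ^ 2 := by
    generalize (∫ t in (0 : ℝ)..1, g t ^ 2) = G at *
    generalize (∫ t in (0 : ℝ)..1, y t ^ 2) = Y at *
    have hm : 0 < μ * ω := by positivity
    have h1 : μ * ω / 2 * Y ≤ (2 * (μ * ω))⁻¹ * G := by nlinarith [mul_nonneg (sq_nonneg ω) hyq]
    have h2 : (μ * ω) ^ 2 * Y ≤ G := by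
      calc (μ * ω) ^ 2 * Y = (2 * (μ * ω)) * (μ * ω / 2 * Y) := by ring
        _ ≤ (2 * (μ * ω)) * ((2 * (μ * ω))⁻¹ * G) := by gcongr
        _ = G := by field_simp
    rw [le_div_iff₀ (by positivity)]
    have h3 : μ ^ 2 * Y ≤ (μ * ω) ^ 2 * Y := by
      gcongr
      nlinarith
    linarith
  have hq1 : q 1 = ∫ s in (0 : ℝ)..1, (1 - s) ^ (α - 1) / Real.Gamma α * y s := by
    rw [hy, integral_rlKernel_mul_dampKernel hα0 hμ hα0 (by linarith) one_pos,
      show α + (b + α) = b + 2 * α by ring]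
  have hq1' : q 1 = dampML α μ (b + 2 * α) ω := by
    simp [hq, dampKernel]
  rw [← hq1', hq1, ← Real.norm_eq_abs]
  have hbound := intervalIntegral.norm_integral_le_of_norm_le (μ := volume)
    (f := fun s => (1 - s) ^ (α - 1) / Real.Gamma α * y s)
    (g := fun s => (k s + y s ^ 2) / 2) zero_le_one
    (Filter.Eventually.of_forall fun s hs => by
      have h1 : k s = ((1 - s) ^ (α - 1) / Real.Gamma α) ^ 2 := by
        simp only [hk]
        rw [div_pow, ← Real.rpow_mul_natCast (sub_nonneg.2 hs.2)]
        congr 2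
        push_cast
        ring
      rw [h1, norm_mul, Real.norm_eq_abs, Real.norm_eq_abs,
        ← sq_abs ((1 - s) ^ (α - 1) / Real.Gamma α), ← sq_abs (y s)]
      nlinarith [sq_nonneg (|(1 - s) ^ (α - 1) / Real.Gamma α| - |y s|)])
    ((hki.add (Continuous.intervalIntegrable (by fun_prop) _ _)).div_const 2)
  refine hbound.trans ?_
  rw [intervalIntegral.integral_div,
    intervalIntegral.integral_add hki (Continuous.intervalIntegrable (by fun_prop) _ _)]
  gcongr

/-- Descent in b: the recurrence expresses order b through orders b+α and b+2α at the cost of a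
factor of degree two in z. -/
theorem exists_dampML_le {α μ : ℝ} (hα : 1 / 2 < α) (hα' : α ≤ 1) (hμ : 0 < μ) {b : ℝ}
    (hb : 0 < b) : ∃ C ≥ 0, ∃ k : ℕ, ∀ z ≥ 0, |dampML α μ b z| ≤ C * (1 + z) ^ k := by
  have hα0 : 0 < α := by linarith
  -- Here j bounds the number of steps of length α from b up to 1 + 2α, the threshold from which the
  -- energy estimate applies.
  suffices H : ∀ (j : ℕ) (b : ℝ), 0 < b → 1 + 2 * α - j * α ≤ b →
      ∃ C ≥ 0, ∃ k : ℕ, ∀ z ≥ 0, |dampML α μ b z| ≤ C * (1 + z) ^ k by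
    obtain ⟨j, hj⟩ := exists_nat_ge ((1 + 2 * α) / α)
    rw [div_le_iff₀ hα0] at hj
    exact H j b hb (by linarith)
  intro j
  induction j with
  | zero =>
    intro b hb hjb
    obtain ⟨C, hC⟩ := exists_dampML_bound_of_large hα hα' hμ (b := b - 2 * α)
      (by push_cast at hjb; linarith)
    rw [sub_add_cancel] at hC
    obtain ⟨D, hD⟩ := isCompact_Icc.exists_bound_of_continuousOn
      ((continuous_dampML hα0 hμ hb).continuousOn (s := Icc 0 1))
    refine ⟨max C D, (abs_nonneg _).trans ((hC 1 le_rfl).trans (le_max_left _ _)), 0,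
      fun z hz => ?_⟩
    rw [pow_zero, mul_one]
    rcases le_total z 1 with h | h
    · exact (hD z ⟨hz, h⟩).trans (le_max_right _ _)
    · exact (hC z h).trans (le_max_left _ _)
  | succ j ih =>
    intro b hb hjb
    push_cast at hjb
    obtain ⟨C₁, h1, k₁, H1⟩ := ih (b + α) (by linarith) (by linarith)
    obtain ⟨C₂, h2, k₂, H2⟩ := ih (b + 2 * α) (by linarith) (by linarith)
    have hG := Real.Gamma_pos_of_pos hb
    refine ⟨(Real.Gamma b)⁻¹ + μ * C₁ + C₂, by positivity, k₁ + k₂ + 2, fun z hz => ?_⟩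
    have hrec : dampML α μ b z = (Real.Gamma b)⁻¹ - μ * z * dampML α μ (b + α) z
        - z ^ 2 * dampML α μ (b + 2 * α) z := by
      linarith [dampML_recurrence hα0 hμ hb z]
    have hz1 : 1 ≤ 1 + z := by linarith
    have hzz : z ≤ 1 + z := by linarith
    calc |dampML α μ b z| ≤ |(Real.Gamma b)⁻¹| + |μ * z * dampML α μ (b + α) z|
          + |z ^ 2 * dampML α μ (b + 2 * α) z| := by
          rw [hrec]
          exact (abs_sub _ _).trans (by gcongr; exact abs_sub _ _)
      _ = (Real.Gamma b)⁻¹ * 1 + μ * z * |dampML α μ (b + α) z|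
          + z ^ 2 * |dampML α μ (b + 2 * α) z| := by
          rw [abs_mul (μ * z), abs_mul (z ^ 2), abs_of_pos (inv_pos.2 hG),
            abs_of_nonneg (by positivity : 0 ≤ μ * z), abs_of_nonneg (by positivity : 0 ≤ z ^ 2), mul_one]
      _ ≤ (Real.Gamma b)⁻¹ * (1 + z) ^ (k₁ + k₂ + 2) + μ * (1 + z) * (C₁ * (1 + z) ^ (k₁ + k₂ + 1))
          + (1 + z) ^ 2 * (C₂ * (1 + z) ^ (k₁ + k₂)) := by
          gcongr
          · exact one_le_pow₀ hz1
          · exact (H1 z hz).trans (by gcongr; first | exact hz1 | omega)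
          · exact (H2 z hz).trans (by gcongr; first | exact hz1 | omega)
      _ = _ := by ring

/-! ### Associativity of convolution on the half-line -/

theorem integrable_indicator_Icc {p : ℝ → ℂ} {t : ℝ} (ht : 0 ≤ t)
    (hp : IntervalIntegrable p volume 0 t) : Integrable ((Icc 0 t).indicator p) := by
  rw [integrable_indicator_iff measurableSet_Icc, integrableOn_Icc_iff_integrableOn_Ioc,
    ← intervalIntegrable_iff_integrableOn_Ioc_of_le ht]
  exact hp

/-- Fubini on the whole plane after extending by zero. The kernels are only integrable, as they may
be singular at 0, and h is bounded on [0,t]. -/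
theorem intervalIntegral_conv_assoc {p₁ p₂ h : ℝ → ℂ} {t : ℝ} (ht : 0 ≤ t)
    (h₁ : IntervalIntegrable p₁ volume 0 t) (h₂ : IntervalIntegrable p₂ volume 0 t)
    (hh : Continuous h) :
    ∫ τ in (0 : ℝ)..t, p₁ (t - τ) * ∫ s in (0 : ℝ)..τ, p₂ (τ - s) * h s
      = ∫ s in (0 : ℝ)..t, (∫ r in (0 : ℝ)..(t - s), p₁ (t - s - r) * p₂ r) * h s := by
  set P₁ := (Icc 0 t).indicator p₁ with hP₁
  set P₂ := (Icc 0 t).indicator p₂ with hP₂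
  set H := (Icc 0 t).indicator h with hH
  have i₁ := integrable_indicator_Icc ht h₁
  have i₂ := integrable_indicator_Icc ht h₂
  obtain ⟨C, hC⟩ := isCompact_Icc.exists_bound_of_continuousOn (hh.continuousOn (s := Icc 0 t))
  have hHb : ∀ s, ‖H s‖ ≤ max C 0 := by
    intro s
    by_cases hs : s ∈ Icc 0 t
    · rw [hH, indicator_of_mem hs]
      exact (hC s hs).trans (le_max_left _ _)
    · rw [hH, indicator_of_notMem hs]
      simp
  have hint : Integrable (Function.uncurry fun s τ : ℝ => P₁ (t - τ) * P₂ (τ - s) * H s)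
      (volume.prod volume) := by
    -- Joint integrability of the two kernels is that of a convolution integrand, once the second
    -- kernel is reflected.
    have hconv : Integrable (fun p : ℝ × ℝ => P₁ (t - p.2) * P₂ (-(p.1 - p.2)))
        (volume.prod volume) :=
      (i₁.comp_sub_left t).convolution_integrand (ContinuousLinearMap.mul ℂ ℂ) i₂.comp_neg
    have hHm : AEStronglyMeasurable (fun p : ℝ × ℝ => H p.1) (volume.prod volume) :=
      ((hh.stronglyMeasurable.indicator measurableSet_Icc).comp_measurable
        measurable_fst).aestronglyMeasurable
    have := hconv.mul_bdd (c := max C 0) hHm (Filter.Eventually.of_forall fun p => hHb p.1)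
    refine this.congr (Filter.Eventually.of_forall fun p => ?_)
    simp [Function.uncurry]
  have hswap := integral_integral_swap hint
  have hL : ∫ τ, ∫ s, P₁ (t - τ) * P₂ (τ - s) * H s
      = ∫ τ in (0 : ℝ)..t, p₁ (t - τ) * ∫ s in (0 : ℝ)..τ, p₂ (τ - s) * h s := by
    rw [intervalIntegral.integral_of_le ht, ← integral_Icc_eq_integral_Ioc,
      ← integral_indicator measurableSet_Icc]
    congr 1
    ext τ
    by_cases hτ : τ ∈ Icc 0 t
    · rw [indicator_of_mem hτ, intervalIntegral.integral_of_le hτ.1,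
        ← integral_Icc_eq_integral_Ioc, ← integral_indicator measurableSet_Icc,
        ← integral_const_mul]
      congr 1
      ext s
      have e1 : P₁ (t - τ) = p₁ (t - τ) :=
        indicator_of_mem (s := Icc 0 t) ⟨sub_nonneg.2 hτ.2, by linarith [hτ.1]⟩ _
      rw [e1, mul_assoc]
      congr 1
      by_cases hs : s ∈ Icc 0 τ
      · have m1 : τ - s ∈ Icc 0 t := ⟨sub_nonneg.2 hs.2, by linarith [hs.1, hτ.2]⟩
        have m2 : s ∈ Icc 0 t := ⟨hs.1, hs.2.trans hτ.2⟩
        simp only [hP₂, hH, indicator_of_mem hs, indicator_of_mem m1, indicator_of_mem m2]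
      · rw [indicator_of_notMem hs]
        by_cases m1 : τ - s ∈ Icc 0 t
        · have m2 : s ∉ Icc 0 t := fun m => hs ⟨m.1, by linarith [m1.1]⟩
          simp only [hH, indicator_of_notMem m2, mul_zero]
        · simp only [hP₂, indicator_of_notMem m1, zero_mul]
    · have m1 : t - τ ∉ Icc 0 t := fun m => hτ ⟨by linarith [m.2], by linarith [m.1]⟩
      simp only [hP₁, indicator_of_notMem m1, indicator_of_notMem hτ, zero_mul, integral_zero]
  have hR : ∫ s, ∫ τ, P₁ (t - τ) * P₂ (τ - s) * H s
      = ∫ s in (0 : ℝ)..t, (∫ r in (0 : ℝ)..(t - s), p₁ (t - s - r) * p₂ r) * h s := by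
    rw [intervalIntegral.integral_of_le ht, ← integral_Icc_eq_integral_Ioc,
      ← integral_indicator measurableSet_Icc]
    congr 1
    ext s
    rw [integral_mul_const]
    by_cases hs : s ∈ Icc 0 t
    · have hts : 0 ≤ t - s := sub_nonneg.2 hs.2
      rw [indicator_of_mem hs, intervalIntegral.integral_of_le hts,
        ← integral_Icc_eq_integral_Ioc, ← integral_indicator measurableSet_Icc]
      congr 1
      · rw [← integral_add_right_eq_self _ s]
        congr 1
        ext r
        by_cases hr : r ∈ Icc 0 (t - s)
        · have m1 : t - (r + s) ∈ Icc 0 t := ⟨by linarith [hr.2], by linarith [hr.1, hs.1]⟩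
          have m2 : r + s - s ∈ Icc 0 t := ⟨by linarith [hr.1], by linarith [hr.2, hs.1]⟩
          simp only [hP₁, hP₂, indicator_of_mem m1, indicator_of_mem m2, indicator_of_mem hr]
          congr 2 <;> ring
        · rw [indicator_of_notMem hr]
          by_cases m1 : t - (r + s) ∈ Icc 0 t
          · have m2 : r + s - s ∉ Icc 0 t := fun m => hr ⟨by linarith [m.1], by linarith [m1.1]⟩
            simp only [hP₂, indicator_of_notMem m2, mul_zero]
          · simp only [hP₁, indicator_of_notMem m1, zero_mul]
      · simp only [hH, indicator_of_mem hs]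
    · simp only [hH, indicator_of_notMem hs, mul_zero]
  rw [← hL, ← hswap, hR]

theorem intervalIntegral_conv_comm (p₁ p₂ : ℝ → ℂ) (t : ℝ) :
    ∫ r in (0 : ℝ)..t, p₁ (t - r) * p₂ r = ∫ r in (0 : ℝ)..t, p₂ (t - r) * p₁ r := by
  have h := intervalIntegral.integral_comp_sub_left (a := 0) (b := t)
    (fun r => p₁ (t - r) * p₂ r) t
  simp only [sub_sub_cancel, sub_zero, sub_self] at h
  rw [← h]
  simp_rw [mul_comm]

/-! ### Families of symbols depending continuously on time -/

section
variable {n : ℕ}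

/-- A continuous family of rapidly decaying functions, locally uniformly in time. -/
structure RapidDecay (h : ℝ → Space n → ℂ) : Prop where
  cont : Continuous (Function.uncurry h)
  decay : ∀ (T : ℝ) (k : ℕ), ∃ C, ∀ τ, |τ| ≤ T → ∀ ξ, (1 + ‖ξ‖) ^ k * ‖h τ ξ‖ ≤ C

/-- A continuous family of functions of polynomial growth, locally uniformly in time. -/
structure PolyGrowth (q : ℝ → Space n → ℂ) : Prop where
  cont : Continuous (Function.uncurry q)
  growth : ∀ T : ℝ, ∃ C, ∃ k : ℕ, ∀ τ, |τ| ≤ T → ∀ ξ, ‖q τ ξ‖ ≤ C * (1 + ‖ξ‖) ^ k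

/-- Two independent times, because a Volterra integrand evaluates the symbol at t - τ and the datum
at τ. -/
theorem PolyGrowth.exists_mul_le {q h : ℝ → Space n → ℂ} (hq : PolyGrowth q) (hh : RapidDecay h)
    (T : ℝ) (j : ℕ) :
    ∃ C, ∀ τ τ', |τ| ≤ T → |τ'| ≤ T → ∀ ξ, (1 + ‖ξ‖) ^ j * ‖q τ ξ * h τ' ξ‖ ≤ C := by
  obtain ⟨C₁, k, h₁⟩ := hq.growth T
  obtain ⟨C₂, h₂⟩ := hh.decay T (j + k)
  refine ⟨max C₁ 0 * C₂, fun τ τ' hτ hτ' ξ => ?_⟩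
  have hpos : 0 < 1 + ‖ξ‖ := by positivity
  calc (1 + ‖ξ‖) ^ j * ‖q τ ξ * h τ' ξ‖ = (1 + ‖ξ‖) ^ j * (‖q τ ξ‖ * ‖h τ' ξ‖) := by
        rw [norm_mul]
    _ ≤ (1 + ‖ξ‖) ^ j * ((max C₁ 0 * (1 + ‖ξ‖) ^ k) * ‖h τ' ξ‖) := by
        gcongr
        exact (h₁ τ hτ ξ).trans (by gcongr; exact le_max_left _ _)
    _ = max C₁ 0 * ((1 + ‖ξ‖) ^ (j + k) * ‖h τ' ξ‖) := by ring
    _ ≤ max C₁ 0 * C₂ := by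
        gcongr
        exact h₂ τ' hτ' ξ

theorem PolyGrowth.mul_rapid {q h : ℝ → Space n → ℂ} (hq : PolyGrowth q) (hh : RapidDecay h) :
    RapidDecay fun τ ξ => q τ ξ * h τ ξ where
  cont := hq.cont.mul hh.cont
  decay T j := by
    obtain ⟨C, hC⟩ := hq.exists_mul_le hh T j
    exact ⟨C, fun τ hτ ξ => hC τ τ hτ hτ ξ⟩

theorem RapidDecay.add {g h : ℝ → Space n → ℂ} (hg : RapidDecay g) (hh : RapidDecay h) :
    RapidDecay fun τ ξ => g τ ξ + h τ ξ where
  cont := hg.cont.add hh.cont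
  decay T k := by
    obtain ⟨C₁, h₁⟩ := hg.decay T k
    obtain ⟨C₂, h₂⟩ := hh.decay T k
    refine ⟨C₁ + C₂, fun τ hτ ξ => ?_⟩
    calc (1 + ‖ξ‖) ^ k * ‖g τ ξ + h τ ξ‖ ≤ (1 + ‖ξ‖) ^ k * (‖g τ ξ‖ + ‖h τ ξ‖) := by
          gcongr; exact norm_add_le _ _
      _ ≤ C₁ + C₂ := by rw [mul_add]; exact add_le_add (h₁ τ hτ ξ) (h₂ τ hτ ξ)

theorem RapidDecay.neg {h : ℝ → Space n → ℂ} (hh : RapidDecay h) :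
    RapidDecay fun τ ξ => -h τ ξ where
  cont := hh.cont.neg
  decay T k := by simpa using hh.decay T k

theorem RapidDecay.sub {g h : ℝ → Space n → ℂ} (hg : RapidDecay g) (hh : RapidDecay h) :
    RapidDecay fun τ ξ => g τ ξ - h τ ξ := by
  simpa only [sub_eq_add_neg] using hg.add hh.neg

theorem PolyGrowth.of_time {g : ℝ → ℂ} (hg : Continuous g) :
    PolyGrowth fun τ (_ : Space n) => g τ where
  cont := hg.comp continuous_fst
  growth T := by
    obtain ⟨C, hC⟩ := isCompact_Icc.exists_bound_of_continuousOn
      (hg.continuousOn (s := Icc (-T) T))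
    exact ⟨C, 0, fun τ hτ ξ => by simpa using hC τ (abs_le.1 hτ)⟩

theorem PolyGrowth.mul {q r : ℝ → Space n → ℂ} (hq : PolyGrowth q) (hr : PolyGrowth r) :
    PolyGrowth fun τ ξ => q τ ξ * r τ ξ where
  cont := hq.cont.mul hr.cont
  growth T := by
    obtain ⟨C₁, k₁, h₁⟩ := hq.growth T
    obtain ⟨C₂, k₂, h₂⟩ := hr.growth T
    refine ⟨C₁ * C₂, k₁ + k₂, fun τ hτ ξ => ?_⟩
    calc ‖q τ ξ * r τ ξ‖ = ‖q τ ξ‖ * ‖r τ ξ‖ := norm_mul _ _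
      _ ≤ (C₁ * (1 + ‖ξ‖) ^ k₁) * (C₂ * (1 + ‖ξ‖) ^ k₂) :=
          mul_le_mul (h₁ τ hτ ξ) (h₂ τ hτ ξ) (norm_nonneg _) ((norm_nonneg _).trans (h₁ τ hτ ξ))
      _ = _ := by ring

theorem PolyGrowth.comp_time {q : ℝ → Space n → ℂ} (hq : PolyGrowth q) {g : ℝ → ℝ}
    (hg : Continuous g) : PolyGrowth fun τ ξ => q (g τ) ξ where
  cont := hq.cont.comp (f := fun p : ℝ × Space n => (g p.1, p.2)) (by fun_prop)
  growth T := by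
    obtain ⟨B, hB⟩ := isCompact_Icc.exists_bound_of_continuousOn
      (hg.continuousOn (s := Icc (-T) T))
    obtain ⟨C, k, h⟩ := hq.growth B
    exact ⟨C, k, fun τ hτ ξ => h _ (hB τ (abs_le.1 hτ)) ξ⟩

/-- The symbol `|ξ|^σ`. -/
noncomputable def freqPow (σ : ℝ) (ξ : Space n) : ℂ := ((‖ξ‖ ^ σ : ℝ) : ℂ)

theorem norm_rpow_le_one_add_pow {σ : ℝ} (hσ : 0 < σ) (ξ : Space n) :
    ‖ξ‖ ^ σ ≤ (1 + ‖ξ‖) ^ ⌈σ⌉₊ := by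
  have h1 : 1 ≤ 1 + ‖ξ‖ := by linarith [norm_nonneg ξ]
  calc ‖ξ‖ ^ σ ≤ (1 + ‖ξ‖) ^ σ :=
        Real.rpow_le_rpow (norm_nonneg _) (by linarith) hσ.le
    _ ≤ (1 + ‖ξ‖) ^ ((⌈σ⌉₊ : ℕ) : ℝ) := Real.rpow_le_rpow_of_exponent_le h1 (Nat.le_ceil σ)
    _ = _ := Real.rpow_natCast _ _

theorem continuous_norm_rpow {σ : ℝ} (hσ : 0 < σ) : Continuous fun ξ : Space n => ‖ξ‖ ^ σ :=
  continuous_norm.rpow_const fun _ => Or.inr hσ.le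

theorem PolyGrowth.freqPow {σ : ℝ} (hσ : 0 < σ) :
    PolyGrowth fun _ (ξ : Space n) => freqPow σ ξ where
  cont := Complex.continuous_ofReal.comp ((continuous_norm_rpow hσ).comp continuous_snd)
  growth T := by
    refine ⟨1, ⌈σ⌉₊, fun τ _ ξ => ?_⟩
    rw [FracDamped.freqPow, Complex.norm_real, Real.norm_of_nonneg (by positivity), one_mul]
    exact norm_rpow_le_one_add_pow hσ ξ

/-- The symbol of the fundamental solution without its singular factor `t^(b-1)`. -/
noncomputable def dampSymbol (α σ μ b τ : ℝ) (ξ : Space n) : ℂ :=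
  ((dampML α μ b (‖ξ‖ ^ σ * |τ| ^ α) : ℝ) : ℂ)

theorem PolyGrowth.dampSymbol {α σ μ b : ℝ} (hα : 1 / 2 < α) (hα' : α ≤ 1) (hσ : 0 < σ)
    (hμ : 0 < μ) (hb : 0 < b) :
    PolyGrowth fun τ (ξ : Space n) => dampSymbol α σ μ b τ ξ where
  cont := by
    have hα0 : 0 < α := by linarith
    have h1 := continuous_dampML hα0 hμ hb
    have h2 : Continuous fun p : ℝ × Space n => ‖p.2‖ ^ σ * |p.1| ^ α :=
      ((continuous_norm_rpow hσ).comp continuous_snd).mul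
        ((Real.continuous_rpow_const hα0.le).comp (continuous_abs.comp continuous_fst))
    exact Complex.continuous_ofReal.comp (h1.comp h2)
  growth T := by
    obtain ⟨C, hC, k, h⟩ := exists_dampML_le hα hα' hμ hb
    have hα0 : 0 < α := by linarith
    refine ⟨C * (1 + |T| ^ α) ^ k, ⌈σ⌉₊ * k, fun τ hτ ξ => ?_⟩
    have hτ' : |τ| ^ α ≤ |T| ^ α :=
      Real.rpow_le_rpow (abs_nonneg _) (hτ.trans (le_abs_self T)) hα0.le
    have h0 : 0 ≤ |T| ^ α := by positivity
    have hw := norm_rpow_le_one_add_pow hσ ξ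
    have h1 : (1 : ℝ) ≤ (1 + ‖ξ‖) ^ ⌈σ⌉₊ := one_le_pow₀ (by linarith [norm_nonneg ξ])
    have hz : 0 ≤ ‖ξ‖ ^ σ * |τ| ^ α := by positivity
    rw [FracDamped.dampSymbol, Complex.norm_real, Real.norm_eq_abs]
    calc _ ≤ C * (1 + ‖ξ‖ ^ σ * |τ| ^ α) ^ k := h _ hz
      _ ≤ C * ((1 + |T| ^ α) * (1 + ‖ξ‖) ^ ⌈σ⌉₊) ^ k := by
          gcongr
          calc 1 + ‖ξ‖ ^ σ * |τ| ^ α ≤ (1 + ‖ξ‖) ^ ⌈σ⌉₊ + (1 + ‖ξ‖) ^ ⌈σ⌉₊ * |T| ^ α := by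
                gcongr
            _ = _ := by ring
      _ = _ := by rw [mul_pow, pow_mul]; ring

/-! ### Volterra operators on such families -/

/-- The convolution in time with the kernel `r^(b-1) q(r, ξ)`, rescaled to a fixed interval. -/
noncomputable def volterra (b : ℝ) (q h : ℝ → Space n → ℂ) (t : ℝ) (ξ : Space n) : ℂ :=
  ((|t| ^ b : ℝ) : ℂ) * ∫ s in (0 : ℝ)..1,
    (((1 - s) ^ (b - 1) : ℝ) : ℂ) * (q (t * (1 - s)) ξ * h (t * s) ξ)

/-- The substitution τ = ts. The rescaled form makes sense for every real t and keeps the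
singularity at the fixed point s = 1, which is what continuity in t needs. -/
theorem volterra_eq {b t : ℝ} (hb : 0 < b) (ht : 0 ≤ t) (q h : ℝ → Space n → ℂ) (ξ : Space n) :
    volterra b q h t ξ
      = ∫ τ in (0 : ℝ)..t, (((t - τ) ^ (b - 1) : ℝ) : ℂ) * (q (t - τ) ξ * h τ ξ) := by
  unfold volterra
  rcases ht.eq_or_lt with rfl | ht
  · simp [hb.ne']
  have h := intervalIntegral.integral_comp_mul_left (a := 0) (b := 1)
    (fun τ => (((t - τ) ^ (b - 1) : ℝ) : ℂ) * (q (t - τ) ξ * h τ ξ)) ht.ne'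
  rw [mul_zero, mul_one, Complex.real_smul, eq_comm] at h
  have htc : (t : ℂ) ≠ 0 := by exact_mod_cast ht.ne'
  rw [Complex.ofReal_inv, inv_mul_eq_iff_eq_mul₀ htc] at h
  rw [h, ← intervalIntegral.integral_const_mul, ← intervalIntegral.integral_const_mul]
  refine intervalIntegral.integral_congr fun s hs => ?_
  rw [uIcc_of_le zero_le_one] at hs
  have e1 : t - t * s = t * (1 - s) := by ring
  have e2 : ((|t| ^ b : ℝ) : ℂ) = t * ((t ^ (b - 1) : ℝ) : ℂ) := by
    rw [abs_of_pos ht, ← Complex.ofReal_mul, ← Real.rpow_one_add' ht.le (by linarith)]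
    congr 2
    ring
  rw [e1, e2, Real.mul_rpow ht.le (sub_nonneg.2 hs.2)]
  push_cast
  ring

theorem intervalIntegrable_one_sub_rpow {b : ℝ} (hb : 0 < b) (C : ℝ) :
    IntervalIntegrable (fun s => (1 - s) ^ (b - 1) * C) volume 0 1 :=
  (intervalIntegrable_sub_rpow hb).mul_const C

theorem abs_mul_le_of_mem {t T s : ℝ} (ht : |t| ≤ T) (hs : s ∈ Icc (0 : ℝ) 1) : |t * s| ≤ T := by
  rw [abs_mul, abs_of_nonneg hs.1]
  exact (mul_le_of_le_one_right (abs_nonneg _) hs.2).trans ht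

/-- For t in a bounded set the integrand is dominated by a constant multiple of the integrable
weight (1-s)^{b-1}, even after multiplication by a power of 1+|ξ|. -/
theorem RapidDecay.volterra {b : ℝ} (hb : 0 < b) {q h : ℝ → Space n → ℂ} (hq : PolyGrowth q)
    (hh : RapidDecay h) : RapidDecay (volterra b q h) := by
  have hbound : ∀ (T : ℝ) (j : ℕ), ∃ C, ∀ t, |t| ≤ T → ∀ ξ, ∀ s ∈ Ioc (0 : ℝ) 1,
      (1 + ‖ξ‖) ^ j * ‖(((1 - s) ^ (b - 1) : ℝ) : ℂ) * (q (t * (1 - s)) ξ * h (t * s) ξ)‖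
        ≤ (1 - s) ^ (b - 1) * C := by
    intro T j
    obtain ⟨C, hC⟩ := hq.exists_mul_le hh T j
    refine ⟨C, fun t ht ξ s hs => ?_⟩
    have h1 : 0 ≤ 1 - s := sub_nonneg.2 hs.2
    rw [norm_mul, Complex.norm_real, Real.norm_of_nonneg (by positivity), mul_left_comm]
    gcongr
    exact hC _ _ (abs_mul_le_of_mem ht ⟨h1, by linarith [hs.1]⟩)
      (abs_mul_le_of_mem ht ⟨hs.1.le, hs.2⟩) ξ
  have hcontI : ∀ s, Continuous fun p : ℝ × Space n =>
      (((1 - s) ^ (b - 1) : ℝ) : ℂ) * (q (p.1 * (1 - s)) p.2 * h (p.1 * s) p.2) := by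
    intro s
    refine continuous_const.mul (Continuous.mul ?_ ?_)
    · exact hq.cont.comp (f := fun p : ℝ × Space n => (p.1 * (1 - s), p.2)) (by fun_prop)
    · exact hh.cont.comp (f := fun p : ℝ × Space n => (p.1 * s, p.2)) (by fun_prop)
  have hmeas : ∀ p : ℝ × Space n, AEStronglyMeasurable (fun s : ℝ =>
      (((1 - s) ^ (b - 1) : ℝ) : ℂ) * (q (p.1 * (1 - s)) p.2 * h (p.1 * s) p.2))
      (volume.restrict (uIoc 0 1)) := by
    intro p
    have h1 : Continuous fun s : ℝ => q (p.1 * (1 - s)) p.2 * h (p.1 * s) p.2 :=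
      (hq.cont.comp (f := fun s : ℝ => (p.1 * (1 - s), p.2)) (by fun_prop)).mul
        (hh.cont.comp (f := fun s : ℝ => (p.1 * s, p.2)) (by fun_prop))
    have h2 : Measurable fun s : ℝ => (((1 - s) ^ (b - 1) : ℝ) : ℂ) := by fun_prop
    exact (h2.mul h1.measurable).aestronglyMeasurable
  refine ⟨?_, ?_⟩
  · refine Continuous.mul ?_ ?_
    · exact Complex.continuous_ofReal.comp
        ((Real.continuous_rpow_const hb.le).comp (continuous_abs.comp continuous_fst))
    · rw [continuous_iff_continuousAt]
      intro p₀
      obtain ⟨C, hC⟩ := hbound (|p₀.1| + 1) 0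
      refine intervalIntegral.continuousAt_of_dominated_interval
        (bound := fun s => (1 - s) ^ (b - 1) * C) (Filter.Eventually.of_forall hmeas) ?_
        (intervalIntegrable_one_sub_rpow hb C)
        (Filter.Eventually.of_forall fun s _ => (hcontI s).continuousAt)
      have : ∀ᶠ p : ℝ × Space n in nhds p₀, |p.1| < |p₀.1| + 1 :=
        (continuous_fst.abs).continuousAt.eventually_lt continuousAt_const (by simp)
      filter_upwards [this] with p hp
      refine Filter.Eventually.of_forall fun s hs => ?_
      rw [uIoc_of_le zero_le_one] at hs
      simpa using hC p.1 hp.le p.2 s hs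
  · intro T j
    obtain ⟨C, hC⟩ := hbound T j
    refine ⟨|T| ^ b * ∫ s in (0 : ℝ)..1, (1 - s) ^ (b - 1) * C, fun t ht ξ => ?_⟩
    have hn := intervalIntegral.norm_integral_le_of_norm_le (μ := volume) zero_le_one
      (f := fun s => (((1 + ‖ξ‖) ^ j : ℝ) : ℂ) *
        ((((1 - s) ^ (b - 1) : ℝ) : ℂ) * (q (t * (1 - s)) ξ * h (t * s) ξ)))
      (g := fun s => (1 - s) ^ (b - 1) * C) (Filter.Eventually.of_forall fun s hs => by
        rw [norm_mul, Complex.norm_real, Real.norm_of_nonneg (by positivity)]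
        exact hC t ht ξ s hs) (intervalIntegrable_one_sub_rpow hb C)
    rw [intervalIntegral.integral_const_mul, norm_mul, Complex.norm_real,
      Real.norm_of_nonneg (by positivity)] at hn
    rw [FracDamped.volterra, norm_mul, Complex.norm_real, Real.norm_of_nonneg (by positivity),
      mul_left_comm]
    have hT : |t| ^ b ≤ |T| ^ b :=
      Real.rpow_le_rpow (abs_nonneg _) (ht.trans (le_abs_self T)) hb.le
    exact mul_le_mul hT hn (by positivity) (by positivity)

/-! ### Integration in frequency -/

theorem RapidDecay.exists_integrable_bound {h : ℝ → Space n → ℂ} (hh : RapidDecay h) (T : ℝ) :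
    ∃ G : Space n → ℝ, Integrable G ∧ ∀ τ, |τ| ≤ T → ∀ ξ, ‖h τ ξ‖ ≤ G ξ := by
  -- Decay of order n + 1 is integrable on ℝⁿ.
  obtain ⟨C, hC⟩ := hh.decay T (n + 1)
  refine ⟨fun ξ => C * (1 + ‖ξ‖) ^ (-((n + 1 : ℕ) : ℝ)), ?_, fun τ hτ ξ => ?_⟩
  · exact (integrable_one_add_norm (by simp)).const_mul C
  · have hpos : 0 < 1 + ‖ξ‖ := by positivity
    beta_reduce
    rw [Real.rpow_neg hpos.le, Real.rpow_natCast, ← div_eq_mul_inv, le_div_iff₀ (by positivity),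
      mul_comm]
    exact hC τ hτ ξ

theorem RapidDecay.integrable {h : ℝ → Space n → ℂ} (hh : RapidDecay h) (t : ℝ) :
    Integrable (h t) := by
  obtain ⟨G, hG, hle⟩ := hh.exists_integrable_bound |t|
  have hc : Continuous (h t) := hh.cont.comp (f := fun ξ => (t, ξ)) (by fun_prop)
  exact hG.mono' hc.aestronglyMeasurable (Filter.Eventually.of_forall (hle t le_rfl))

theorem RapidDecay.integrable_mul {h : ℝ → Space n → ℂ} (hh : RapidDecay h) {e : Space n → ℂ}
    (he : Continuous e) (he1 : ∀ ξ, ‖e ξ‖ ≤ 1) (t : ℝ) : Integrable fun ξ => h t ξ * e ξ :=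
  (hh.integrable t).mul_bdd (c := 1) he.aestronglyMeasurable (Filter.Eventually.of_forall he1)

theorem RapidDecay.continuous_integral {h : ℝ → Space n → ℂ} (hh : RapidDecay h)
    {e : Space n → ℂ} (he : Continuous e) (he1 : ∀ ξ, ‖e ξ‖ ≤ 1) :
    Continuous fun t => ∫ ξ, h t ξ * e ξ := by
  rw [continuous_iff_continuousAt]
  intro t₀
  obtain ⟨G, hG, hle⟩ := hh.exists_integrable_bound (|t₀| + 1)
  refine continuousAt_of_dominated (bound := G)
    (Filter.Eventually.of_forall fun t => (hh.integrable_mul he he1 t).aestronglyMeasurable)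
    ?_ hG (Filter.Eventually.of_forall fun ξ => ?_)
  · have : ∀ᶠ t in nhds t₀, |t| < |t₀| + 1 :=
      continuous_abs.continuousAt.eventually_lt continuousAt_const (by simp)
    filter_upwards [this] with t ht
    refine Filter.Eventually.of_forall fun ξ => ?_
    rw [norm_mul]
    exact (mul_le_of_le_one_right (norm_nonneg _) (he1 ξ)).trans (hle t ht.le ξ)
  · have : Continuous fun t => h t ξ * e ξ :=
      (hh.cont.comp (f := fun t => (t, ξ)) (by fun_prop)).mul continuous_const
    exact this.continuousAt

/-- Stated for a general bounded multiplier `e`, since it serves for the inverse Fourier integral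
and, in `hat_sub_eq_integral`, for the direct one. -/
theorem RapidDecay.integral_swap {h : ℝ → Space n → ℂ} (hh : RapidDecay h) {e : Space n → ℂ}
    (he : Continuous e) (he1 : ∀ ξ, ‖e ξ‖ ≤ 1) {t : ℝ} (ht : 0 ≤ t) {w : ℝ → ℂ}
    (hw : IntervalIntegrable w volume 0 t) :
    ∫ τ in (0 : ℝ)..t, w τ * ∫ ξ, h τ ξ * e ξ
      = ∫ ξ, (∫ τ in (0 : ℝ)..t, w τ * h τ ξ) * e ξ := by
  obtain ⟨G, hG, hle⟩ := hh.exists_integrable_bound t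
  rw [intervalIntegrable_iff_integrableOn_Ioc_of_le ht] at hw
  have hint : Integrable (Function.uncurry fun τ ξ => w τ * (h τ ξ * e ξ))
      ((volume.restrict (Ioc 0 t)).prod volume) := by
    have hdom := Integrable.mul_prod hw.norm hG
    have hwm : AEStronglyMeasurable (fun p : ℝ × Space n => w p.1)
        ((volume.restrict (Ioc 0 t)).prod volume) := hw.aestronglyMeasurable.comp_fst
    have hm : Continuous fun p : ℝ × Space n => h p.1 p.2 * e p.2 :=
      hh.cont.mul (he.comp continuous_snd)
    refine hdom.mono' (hwm.mul hm.aestronglyMeasurable) ?_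
    rw [← Measure.restrict_univ (μ := (volume : Measure (Space n))), Measure.prod_restrict]
    filter_upwards [ae_restrict_mem (measurableSet_Ioc.prod MeasurableSet.univ)] with p hp
    have h1 : |p.1| ≤ t := by rw [abs_of_pos hp.1.1]; exact hp.1.2
    simp only [Function.uncurry]
    rw [norm_mul, norm_mul]
    gcongr
    exact (mul_le_of_le_one_right (norm_nonneg _) (he1 _)).trans (hle _ h1 _)
  have hswap := integral_integral_swap hint
  rw [intervalIntegral.integral_of_le ht]
  simp_rw [integral_const_mul] at hswap
  rw [hswap]
  congr 1
  ext ξ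
  rw [intervalIntegral.integral_of_le ht, ← integral_mul_const]
  simp_rw [mul_assoc]

end

theorem intervalIntegrable_ofReal {p : ℝ → ℝ} {a b : ℝ} (hp : IntervalIntegrable p volume a b) :
    IntervalIntegrable (fun τ => ((p τ : ℝ) : ℂ)) volume a b :=
  ⟨hp.1.ofReal, hp.2.ofReal⟩

/-! ### Linearity of Volterra operators; Riemann–Liouville integrals of families -/

section
variable {n : ℕ}

theorem intervalIntegrable_volterra_integrand {b : ℝ} (hb : 0 < b) {q h : ℝ → Space n → ℂ}
    (hq : PolyGrowth q) (hh : RapidDecay h) (t : ℝ) (ξ : Space n) :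
    IntervalIntegrable (fun s => (((1 - s) ^ (b - 1) : ℝ) : ℂ)
      * (q (t * (1 - s)) ξ * h (t * s) ξ)) volume 0 1 := by
  have h1 : IntervalIntegrable (fun s => (((1 - s) ^ (b - 1) : ℝ) : ℂ)) volume 0 1 :=
    intervalIntegrable_ofReal (intervalIntegrable_sub_rpow hb)
  refine h1.mul_continuousOn (Continuous.continuousOn ?_)
  exact (hq.cont.comp (f := fun s : ℝ => (t * (1 - s), ξ)) (by fun_prop)).mul
    (hh.cont.comp (f := fun s : ℝ => (t * s, ξ)) (by fun_prop))

theorem volterra_add {b : ℝ} (hb : 0 < b) {q g h : ℝ → Space n → ℂ} (hq : PolyGrowth q)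
    (hg : RapidDecay g) (hh : RapidDecay h) (t : ℝ) (ξ : Space n) :
    volterra b q (fun τ ξ => g τ ξ + h τ ξ) t ξ = volterra b q g t ξ + volterra b q h t ξ := by
  unfold volterra
  rw [← mul_add, ← intervalIntegral.integral_add
    (intervalIntegrable_volterra_integrand hb hq hg t ξ)
    (intervalIntegrable_volterra_integrand hb hq hh t ξ)]
  simp_rw [mul_add]

theorem volterra_sub {b : ℝ} (hb : 0 < b) {q g h : ℝ → Space n → ℂ} (hq : PolyGrowth q)
    (hg : RapidDecay g) (hh : RapidDecay h) (t : ℝ) (ξ : Space n) :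
    volterra b q (fun τ ξ => g τ ξ - h τ ξ) t ξ = volterra b q g t ξ - volterra b q h t ξ := by
  unfold volterra
  rw [← mul_sub, ← intervalIntegral.integral_sub
    (intervalIntegrable_volterra_integrand hb hq hg t ξ)
    (intervalIntegrable_volterra_integrand hb hq hh t ξ)]
  simp_rw [mul_sub]

theorem volterra_mul_left (b : ℝ) (q h : ℝ → Space n → ℂ) (c : Space n → ℂ) (t : ℝ)
    (ξ : Space n) :
    volterra b q (fun τ ξ => c ξ * h τ ξ) t ξ = c ξ * volterra b q h t ξ := by
  unfold volterra
  rw [mul_left_comm, ← intervalIntegral.integral_const_mul (c ξ)]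
  congr 2
  ext s
  ring

theorem volterra_zero {b : ℝ} (hb : 0 < b) (q h : ℝ → Space n → ℂ) (ξ : Space n) :
    volterra b q h 0 ξ = 0 := by
  simp [volterra, hb.ne']

theorem rlIntegral_of_pos {a : ℝ} (ha : 0 < a) (g : ℝ → ℂ) (t : ℝ) :
    rlIntegral a g t
      = ∫ τ in (0 : ℝ)..t, (((t - τ) ^ (a - 1) / Real.Gamma a : ℝ) : ℂ) * g τ := by
  rw [rlIntegral, if_neg ha.ne']

theorem rlIntegral_congr {γ t : ℝ} (ht : 0 < t) {g g' : ℝ → ℂ} (h : ∀ τ ∈ Ioc 0 t, g τ = g' τ) :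
    rlIntegral γ g t = rlIntegral γ g' t := by
  unfold rlIntegral
  split_ifs
  · exact h t ⟨ht, le_rfl⟩
  · rw [intervalIntegral.integral_of_le ht.le, intervalIntegral.integral_of_le ht.le]
    refine setIntegral_congr_fun measurableSet_Ioc fun τ hτ => ?_
    simp only [h τ hτ]

theorem intervalIntegrable_rlKernel {a : ℝ} (ha : 0 < a) (t : ℝ) :
    IntervalIntegrable (fun τ => (((t - τ) ^ (a - 1) / Real.Gamma a : ℝ) : ℂ)) volume 0 t :=
  intervalIntegrable_ofReal ((intervalIntegrable_sub_rpow ha).div_const _)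

/-- The Riemann–Liouville integral of a family. -/
noncomputable def rlFamily (a : ℝ) (h : ℝ → Space n → ℂ) : ℝ → Space n → ℂ :=
  if a = 0 then h else volterra a (fun _ _ => (((Real.Gamma a)⁻¹ : ℝ) : ℂ)) h

theorem RapidDecay.rl {a : ℝ} (ha : 0 ≤ a) {h : ℝ → Space n → ℂ} (hh : RapidDecay h) :
    RapidDecay (rlFamily a h) := by
  unfold rlFamily
  split_ifs with h0
  · exact hh
  · exact hh.volterra (ha.lt_of_ne' h0) (PolyGrowth.of_time continuous_const)

theorem rlFamily_eq {a t : ℝ} (ha : 0 ≤ a) (ht : 0 ≤ t) (h : ℝ → Space n → ℂ) (ξ : Space n) :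
    rlFamily a h t ξ = rlIntegral a (fun τ => h τ ξ) t := by
  unfold rlFamily rlIntegral
  split_ifs with h0
  · rfl
  · rw [volterra_eq (ha.lt_of_ne' h0) ht]
    congr 1
    ext τ
    push_cast
    ring

/-- Convolution in time with the fundamental solution. -/
noncomputable def dampConv (α σ μ b : ℝ) (h : ℝ → Space n → ℂ) : ℝ → Space n → ℂ :=
  volterra b (dampSymbol α σ μ b) h

end

section
variable {n : ℕ}

theorem RapidDecay.dampConv {α σ μ : ℝ} (hα : 1 / 2 < α) (hα' : α ≤ 1) (hσ : 0 < σ)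
    (hμ : 0 < μ) {b : ℝ} (hb : 0 < b) {h : ℝ → Space n → ℂ} (hh : RapidDecay h) :
    RapidDecay (dampConv α σ μ b h) :=
  hh.volterra hb (PolyGrowth.dampSymbol hα hα' hσ hμ hb)

end

/-! ### Algebra of time convolution with the fundamental solutions -/

section
variable {n : ℕ} {α σ μ : ℝ}

theorem dampConv_eq {b t : ℝ} (hb : 0 < b) (ht : 0 ≤ t) (h : ℝ → Space n → ℂ) (ξ : Space n) :
    dampConv α σ μ b h t ξ
      = ∫ τ in (0 : ℝ)..t, ((dampKernel α μ b (‖ξ‖ ^ σ) (t - τ) : ℝ) : ℂ) * h τ ξ := by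
  rw [dampConv, volterra_eq hb ht]
  refine intervalIntegral.integral_congr fun τ hτ => ?_
  rw [uIcc_of_le ht] at hτ
  simp only [dampSymbol, dampKernel]
  rw [abs_of_nonneg (sub_nonneg.2 hτ.2)]
  push_cast
  ring

theorem intervalIntegrable_dampKernel (hα : 0 < α) (hμ : 0 < μ) {b : ℝ} (hb : 0 < b) (ω t : ℝ) :
    IntervalIntegrable (fun τ => ((dampKernel α μ b ω τ : ℝ) : ℂ)) volume 0 t := by
  refine intervalIntegrable_ofReal ?_
  refine (intervalIntegral.intervalIntegrable_rpow' (by linarith)).mul_continuousOn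
    (Continuous.continuousOn ?_)
  have h2 := Real.continuous_rpow_const hα.le
  exact (continuous_dampML hα hμ hb).comp (by fun_prop)

theorem integral_rlKernel_mul_dampKernel_complex (hα : 0 < α) (hμ : 0 < μ) {a b t : ℝ}
    (ha : 0 < a) (hb : 0 < b) (ht : 0 < t) (ω : ℝ) :
    ∫ r in (0 : ℝ)..t, (((t - r) ^ (a - 1) / Real.Gamma a : ℝ) : ℂ)
        * ((dampKernel α μ b ω r : ℝ) : ℂ) = ((dampKernel α μ (a + b) ω t : ℝ) : ℂ) := by
  rw [← integral_rlKernel_mul_dampKernel hα hμ ha hb ht, ← intervalIntegral.integral_ofReal]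
  simp_rw [Complex.ofReal_mul]

/-- By associativity I^a acts on the kernel, whose order it raises by a. -/
theorem rlIntegral_dampConv (hα : 0 < α) (hμ : 0 < μ) {a b t : ℝ} (ha : 0 ≤ a) (hb : 0 < b)
    (ht : 0 ≤ t) {h : ℝ → Space n → ℂ} (ξ : Space n) (hc : Continuous fun τ => h τ ξ) :
    rlIntegral a (fun τ => dampConv α σ μ b h τ ξ) t = dampConv α σ μ (a + b) h t ξ := by
  rcases ha.eq_or_lt with rfl | ha
  · simp [rlIntegral]
  rw [rlIntegral_of_pos ha, dampConv_eq (by positivity) ht]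
  trans ∫ τ in (0 : ℝ)..t, (((t - τ) ^ (a - 1) / Real.Gamma a : ℝ) : ℂ) *
    ∫ s in (0 : ℝ)..τ, ((dampKernel α μ b (‖ξ‖ ^ σ) (τ - s) : ℝ) : ℂ) * h s ξ
  · refine intervalIntegral.integral_congr fun τ hτ => ?_
    rw [uIcc_of_le ht] at hτ
    simp only [dampConv_eq hb hτ.1]
  · have hrl : IntervalIntegrable (fun r => ((r ^ (a - 1) / Real.Gamma a : ℝ) : ℂ)) volume 0 t :=
      intervalIntegrable_ofReal
        ((intervalIntegral.intervalIntegrable_rpow' (by linarith)).div_const _)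
    rw [intervalIntegral_conv_assoc ht hrl (intervalIntegrable_dampKernel hα hμ hb _ t) hc]
    refine intervalIntegral.integral_congr_ae ?_
    -- The semigroup law for the kernels holds at positive times, hence the point s = t is
    -- discarded.
    filter_upwards [Measure.ae_ne volume t] with s hne hs
    rw [uIoc_of_le ht] at hs
    have hst : 0 < t - s := sub_pos.2 (lt_of_le_of_ne hs.2 hne)
    rw [integral_rlKernel_mul_dampKernel_complex hα hμ ha hb hst]

/-- The same shift of order when I^a acts on the other factor, by commutativity of convolution. -/
theorem dampConv_rlFamily (hα : 0 < α) (hμ : 0 < μ) {a b t : ℝ} (ha : 0 ≤ a) (hb : 0 < b)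
    (ht : 0 ≤ t) {h : ℝ → Space n → ℂ} (ξ : Space n) (hc : Continuous fun τ => h τ ξ) :
    dampConv α σ μ b (rlFamily a h) t ξ = dampConv α σ μ (a + b) h t ξ := by
  rcases ha.eq_or_lt with rfl | ha
  · simp [rlFamily]
  rw [dampConv_eq (by positivity) ht, dampConv_eq (by positivity) ht]
  trans ∫ τ in (0 : ℝ)..t, ((dampKernel α μ b (‖ξ‖ ^ σ) (t - τ) : ℝ) : ℂ) *
    ∫ s in (0 : ℝ)..τ, (((τ - s) ^ (a - 1) / Real.Gamma a : ℝ) : ℂ) * h s ξ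
  · refine intervalIntegral.integral_congr fun τ hτ => ?_
    rw [uIcc_of_le ht] at hτ
    simp only [rlFamily_eq ha.le hτ.1, rlIntegral_of_pos ha]
  · have hrl : IntervalIntegrable (fun r => ((r ^ (a - 1) / Real.Gamma a : ℝ) : ℂ)) volume 0 t :=
      intervalIntegrable_ofReal
        ((intervalIntegral.intervalIntegrable_rpow' (by linarith)).div_const _)
    rw [intervalIntegral_conv_assoc
      (p₁ := fun r => ((dampKernel α μ b (‖ξ‖ ^ σ) r : ℝ) : ℂ))
      (p₂ := fun r => ((r ^ (a - 1) / Real.Gamma a : ℝ) : ℂ))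
      ht (intervalIntegrable_dampKernel hα hμ hb _ t) hrl hc]
    refine intervalIntegral.integral_congr_ae ?_
    filter_upwards [Measure.ae_ne volume t] with s hne hs
    rw [uIoc_of_le ht] at hs
    have hst : 0 < t - s := sub_pos.2 (lt_of_le_of_ne hs.2 hne)
    rw [intervalIntegral_conv_comm (fun r => ((dampKernel α μ b (‖ξ‖ ^ σ) r : ℝ) : ℂ))
      (fun r => ((r ^ (a - 1) / Real.Gamma a : ℝ) : ℂ)),
      integral_rlKernel_mul_dampKernel_complex hα hμ ha hb hst]

/-- `dampKernel_recurrence` convolved with h in time. -/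
theorem dampConv_recurrence (hα : 0 < α) (hμ : 0 < μ) {b t : ℝ} (hb : 0 < b)
    (ht : 0 ≤ t) {h : ℝ → Space n → ℂ} (ξ : Space n) (hc : Continuous fun τ => h τ ξ) :
    dampConv α σ μ b h t ξ + μ * freqPow σ ξ * dampConv α σ μ (b + α) h t ξ
      + freqPow σ ξ ^ 2 * dampConv α σ μ (b + 2 * α) h t ξ = rlFamily b h t ξ := by
  have hint : ∀ c > 0, IntervalIntegrable
      (fun τ => ((dampKernel α μ c (‖ξ‖ ^ σ) (t - τ) : ℝ) : ℂ) * h τ ξ) volume 0 t := by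
    intro c hc0
    have := (intervalIntegrable_dampKernel hα hμ hc0 (‖ξ‖ ^ σ) t).comp_sub_left t
    simp only [sub_zero, sub_self] at this
    exact this.symm.mul_continuousOn hc.continuousOn
  rw [rlFamily_eq hb.le ht, rlIntegral_of_pos hb, dampConv_eq hb ht,
    dampConv_eq (by positivity) ht, dampConv_eq (by positivity) ht,
    ← intervalIntegral.integral_const_mul, ← intervalIntegral.integral_const_mul,
    ← intervalIntegral.integral_add (hint _ hb) ((hint _ (by positivity)).const_mul _),
    ← intervalIntegral.integral_add ((hint _ hb).add ((hint _ (by positivity)).const_mul _))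
      ((hint _ (by positivity)).const_mul _)]
  refine intervalIntegral.integral_congr_ae ?_
  filter_upwards [Measure.ae_ne volume t] with s hne hs
  rw [uIoc_of_le ht] at hs
  have hst : 0 < t - s := sub_pos.2 (lt_of_le_of_ne hs.2 hne)
  rw [← dampKernel_recurrence hα hμ hb hst (‖ξ‖ ^ σ), freqPow]
  push_cast
  ring

/-- The monomial t^c/Γ(c+1) is the Riemann–Liouville kernel of order c+1, so convolving with it
raises the order by c+1. -/
theorem dampConv_rpow (hα : 0 < α) (hμ : 0 < μ) {b c t : ℝ} (hb : 0 < b) (hc : 0 ≤ c)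
    (ht : 0 ≤ t) (φ : Space n → ℂ) (ξ : Space n) :
    dampConv α σ μ b (fun τ ξ => ((τ ^ c / Real.Gamma (c + 1) : ℝ) : ℂ) * φ ξ) t ξ
      = ((dampKernel α μ (b + c + 1) (‖ξ‖ ^ σ) t : ℝ) : ℂ) * φ ξ := by
  rw [dampConv_eq hb ht]
  rcases ht.eq_or_lt with rfl | ht
  · have : b + c + 1 - 1 ≠ 0 := by linarith
    rw [dampKernel, Real.zero_rpow this]
    simp
  have h := integral_rlKernel_mul_dampKernel_complex hα hμ (show 0 < c + 1 by linarith) hb ht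
    (‖ξ‖ ^ σ)
  rw [show b + c + 1 = c + 1 + b by ring, ← h,
    intervalIntegral_conv_comm (fun r => ((r ^ (c + 1 - 1) / Real.Gamma (c + 1) : ℝ) : ℂ))
      (fun r => ((dampKernel α μ b (‖ξ‖ ^ σ) r : ℝ) : ℂ)),
    ← intervalIntegral.integral_mul_const]
  simp_rw [add_sub_cancel_right, mul_assoc]

end

section
variable {n : ℕ}

theorem RapidDecay.continuous_time {h : ℝ → Space n → ℂ} (hh : RapidDecay h) (ξ : Space n) :
    Continuous fun τ => h τ ξ :=
  hh.cont.comp (f := fun τ => (τ, ξ)) (by fun_prop)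

/-! ### Inverse Fourier integrals of families -/

theorem norm_exp_I_mul_le_one (x : ℝ) : ‖Complex.exp (Complex.I * x)‖ ≤ 1 := by
  rw [mul_comm, Complex.norm_exp_ofReal_mul_I]

theorem continuous_character (x : Space n) :
    Continuous fun ξ : Space n => Complex.exp (Complex.I * (inner ℝ x ξ : ℝ)) := by
  fun_prop

theorem RapidDecay.continuous_invFourier {h : ℝ → Space n → ℂ} (hh : RapidDecay h)
    (x : Space n) : Continuous fun t => invFourier (h t) x :=
  continuous_const.mul (hh.continuous_integral (continuous_character x)
    fun _ => norm_exp_I_mul_le_one _)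

theorem RapidDecay.integral_invFourier {h : ℝ → Space n → ℂ} (hh : RapidDecay h) (x : Space n)
    {t : ℝ} (ht : 0 ≤ t) {w : ℝ → ℂ} (hw : IntervalIntegrable w volume 0 t) :
    ∫ τ in (0 : ℝ)..t, w τ * invFourier (h τ) x
      = invFourier (fun ξ => ∫ τ in (0 : ℝ)..t, w τ * h τ ξ) x := by
  unfold invFourier
  rw [← hh.integral_swap (continuous_character x) (fun _ => norm_exp_I_mul_le_one _) ht hw,
    ← intervalIntegral.integral_const_mul]
  simp_rw [mul_left_comm]

theorem RapidDecay.rlIntegral_invFourier {h : ℝ → Space n → ℂ} (hh : RapidDecay h) (x : Space n)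
    {a t : ℝ} (ha : 0 ≤ a) (ht : 0 ≤ t) :
    rlIntegral a (fun τ => invFourier (h τ) x) t = invFourier (rlFamily a h t) x := by
  rcases ha.eq_or_lt with rfl | ha
  · simp [rlIntegral, rlFamily]
  rw [rlIntegral_of_pos ha, hh.integral_invFourier x ht (intervalIntegrable_rlKernel ha t)]
  congr 1
  ext ξ
  rw [rlFamily_eq ha.le ht, rlIntegral_of_pos ha]

theorem RapidDecay.integrable_character {h : ℝ → Space n → ℂ} (hh : RapidDecay h) (x : Space n)
    (t : ℝ) : Integrable fun ξ => h t ξ * Complex.exp (Complex.I * (inner ℝ x ξ : ℝ)) :=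
  hh.integrable_mul (continuous_character x) (fun _ => norm_exp_I_mul_le_one _) t

theorem invFourier_add {g h : ℝ → Space n → ℂ} (hg : RapidDecay g) (hh : RapidDecay h)
    (t : ℝ) (x : Space n) :
    invFourier (fun ξ => g t ξ + h t ξ) x = invFourier (g t) x + invFourier (h t) x := by
  unfold invFourier
  rw [← mul_add, ← integral_add (hg.integrable_character x t) (hh.integrable_character x t)]
  simp_rw [add_mul]

theorem invFourier_sub {g h : ℝ → Space n → ℂ} (hg : RapidDecay g) (hh : RapidDecay h)
    (t : ℝ) (x : Space n) :
    invFourier (fun ξ => g t ξ - h t ξ) x = invFourier (g t) x - invFourier (h t) x := by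
  unfold invFourier
  rw [← mul_sub, ← integral_sub (hg.integrable_character x t) (hh.integrable_character x t)]
  simp_rw [sub_mul]

theorem invFourier_const_mul (c : ℂ) (h : Space n → ℂ) (x : Space n) :
    invFourier (fun ξ => c * h ξ) x = c * invFourier h x := by
  unfold invFourier
  simp_rw [mul_assoc]
  rw [integral_const_mul, mul_left_comm]

theorem invFourier_zero (x : Space n) : invFourier (fun _ => 0) x = 0 := by
  simp [invFourier]

end

/-! ### Fourier transforms of Schwartz functions, and convolution as multiplication -/

section
variable {n : ℕ}

/-- The Fourier transform `∫ φ(x) e^{-i x·ξ} dx`. -/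
noncomputable def hat (φ : 𝓢(Space n, ℂ)) (ξ : Space n) : ℂ :=
  (𝓕 φ : 𝓢(Space n, ℂ)) ((2 * Real.pi)⁻¹ • ξ)

/-- `𝓕` carries the phase e^{-2πi y·ξ}; the dilation by (2π)⁻¹ in `hat` removes the 2π. -/
theorem hat_eq (φ : 𝓢(Space n, ℂ)) (ξ : Space n) :
    hat φ ξ = ∫ y, φ y * Complex.exp (Complex.I * ((-inner ℝ ξ y : ℝ))) := by
  rw [hat, SchwartzMap.fourier_coe, Real.fourier_eq']
  congr 1
  ext y
  rw [smul_eq_mul, mul_comm, inner_smul_right, real_inner_comm]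
  congr 2
  have : (Real.pi : ℂ) ≠ 0 := by exact_mod_cast Real.pi_ne_zero
  push_cast
  field_simp

theorem invFourier_reflect (φ : 𝓢(Space n, ℂ)) (x ξ : Space n) :
    invFourier (fun y => φ (x - y)) ξ = (((2 * Real.pi) ^ n : ℝ) : ℂ)⁻¹
      * (hat φ ξ * Complex.exp (Complex.I * (inner ℝ x ξ : ℝ))) := by
  unfold invFourier
  congr 1
  have h := integral_sub_left_eq_self
    (fun y => φ (x - y) * Complex.exp (Complex.I * (inner ℝ ξ y : ℝ))) volume x
  rw [← h, hat_eq, ← integral_mul_const]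
  congr 1
  ext y
  rw [sub_sub_cancel, mul_assoc, ← Complex.exp_add, inner_sub_right, real_inner_comm]
  congr 2
  push_cast
  ring

/-- The inverse transform of the reflected translate φ(x - ·) is (2π)⁻ⁿ φ̂(ξ) e^{ix·ξ}, so the
distributional pairing is an ordinary multiplier formula. -/
theorem kernelConv_eq (m : Space n → ℂ) (φ : 𝓢(Space n, ℂ)) (x : Space n) :
    kernelConv m φ x = invFourier (fun ξ => m ξ * hat φ ξ) x := by
  unfold kernelConv kernelPairing
  simp_rw [invFourier_reflect]
  rw [invFourier, ← integral_const_mul]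
  congr 1
  ext ξ
  ring

theorem kernelConvExists_of_integrable {m : Space n → ℂ} {φ : 𝓢(Space n, ℂ)} {x : Space n}
    (h : Integrable fun ξ => m ξ * hat φ ξ * Complex.exp (Complex.I * (inner ℝ x ξ : ℝ))) :
    KernelConvExists m φ x := by
  unfold KernelConvExists
  simp_rw [invFourier_reflect]
  refine (h.const_mul (((2 * Real.pi) ^ n : ℝ) : ℂ)⁻¹).congr
    (Filter.Eventually.of_forall fun ξ => ?_)
  simp only
  ring

/-- Fourier inversion; the factor (2π)ⁿ is the Jacobian of the dilation in `hat`. -/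
theorem invFourier_hat (φ : 𝓢(Space n, ℂ)) (x : Space n) : invFourier (hat φ) x = φ x := by
  have hinv : (𝓕⁻ (𝓕 φ) : 𝓢(Space n, ℂ)) x = φ x := by simp
  rw [SchwartzMap.fourierInv_coe, Real.fourierInv_eq'] at hinv
  rw [← hinv]
  have hs := Measure.integral_comp_smul_of_nonneg (volume : Measure (Space n))
    (fun v => Complex.exp (↑(2 * Real.pi * inner ℝ v x) * Complex.I) • (𝓕 φ : 𝓢(Space n, ℂ)) v)
    (2 * Real.pi)⁻¹ (hR := by positivity)
  have hpi : (2 * Real.pi) ≠ 0 := by positivity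
  rw [finrank_euclideanSpace_fin, inv_pow, inv_inv, Complex.real_smul] at hs
  rw [invFourier, inv_mul_eq_iff_eq_mul₀ (by exact_mod_cast pow_ne_zero n hpi), ← hs]
  congr 1
  ext ξ
  rw [hat, smul_eq_mul, mul_comm, inner_smul_left, real_inner_comm]
  congr 2
  have : (Real.pi : ℂ) ≠ 0 := by exact_mod_cast Real.pi_ne_zero
  simp only [map_inv₀]
  push_cast
  simp only [conj_trivial]
  push_cast
  field_simp

/-- Every Schwartz seminorm of g τ is continuous in τ, hence bounded on compact time intervals. -/
theorem rapidDecay_schwartz {g : ℝ → 𝓢(Space n, ℂ)} (hg : Continuous g) :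
    RapidDecay fun τ ξ => g τ ξ where
  cont := by
    have h1 : Continuous fun p : ℝ × Space n =>
        ((SchwartzMap.toBoundedContinuousFunctionCLM ℂ (Space n) ℂ (g p.1)), p.2) :=
      (((SchwartzMap.toBoundedContinuousFunctionCLM ℂ (Space n) ℂ).continuous.comp hg).comp
        continuous_fst).prodMk continuous_snd
    exact continuous_eval.comp h1
  decay T k := by
    have hbd : ∀ j : ℕ, ∃ C, ∀ τ, |τ| ≤ T → ∀ ξ, ‖ξ‖ ^ j * ‖g τ ξ‖ ≤ C := by
      intro j
      have hc : Continuous fun τ => SchwartzMap.seminorm ℂ j 0 (g τ) :=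
        ((schwartz_withSeminorms ℂ (Space n) ℂ).continuous_seminorm (j, 0)).comp hg
      obtain ⟨C, hC⟩ := isCompact_Icc.exists_bound_of_continuousOn
        (hc.continuousOn (s := Icc (-T) T))
      refine ⟨C, fun τ hτ ξ => ?_⟩
      exact (SchwartzMap.norm_pow_mul_le_seminorm ℂ (g τ) j ξ).trans
        ((le_abs_self _).trans (hC τ (abs_le.1 hτ)))
    obtain ⟨C₀, h₀⟩ := hbd 0
    obtain ⟨C₁, h₁⟩ := hbd k
    refine ⟨2 ^ (k - 1) * (C₀ + C₁), fun τ hτ ξ => ?_⟩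
    calc (1 + ‖ξ‖) ^ k * ‖g τ ξ‖ ≤ (2 ^ (k - 1) * (1 ^ k + ‖ξ‖ ^ k)) * ‖g τ ξ‖ := by
          gcongr
          exact add_pow_le zero_le_one (norm_nonneg ξ) k
      _ = 2 ^ (k - 1) * (‖ξ‖ ^ 0 * ‖g τ ξ‖ + ‖ξ‖ ^ k * ‖g τ ξ‖) := by ring
      _ ≤ 2 ^ (k - 1) * (C₀ + C₁) := by
          gcongr
          · exact h₀ τ hτ ξ
          · exact h₁ τ hτ ξ

theorem RapidDecay.comp_smul {h : ℝ → Space n → ℂ} (hh : RapidDecay h) {c : ℝ} (hc : 0 < c) :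
    RapidDecay fun τ ξ => h τ (c • ξ) where
  cont := hh.cont.comp (f := fun p : ℝ × Space n => (p.1, c • p.2)) (by fun_prop)
  decay T k := by
    obtain ⟨C, hC⟩ := hh.decay T k
    refine ⟨(1 + c⁻¹) ^ k * C, fun τ hτ ξ => ?_⟩
    have h1 : 1 + ‖ξ‖ ≤ (1 + c⁻¹) * (1 + ‖c • ξ‖) := by
      rw [norm_smul, Real.norm_of_nonneg hc.le]
      have : c⁻¹ * (c * ‖ξ‖) = ‖ξ‖ := by field_simp
      have h2 : 0 ≤ c⁻¹ := by positivity
      have h3 : 0 ≤ c * ‖ξ‖ := by positivity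
      nlinarith
    calc (1 + ‖ξ‖) ^ k * ‖h τ (c • ξ)‖ ≤ ((1 + c⁻¹) * (1 + ‖c • ξ‖)) ^ k * ‖h τ (c • ξ)‖ := by
          gcongr
      _ = (1 + c⁻¹) ^ k * ((1 + ‖c • ξ‖) ^ k * ‖h τ (c • ξ)‖) := by rw [mul_pow]; ring
      _ ≤ (1 + c⁻¹) ^ k * C := by gcongr; exact hC τ hτ _

theorem rapidDecay_hat {g : ℝ → 𝓢(Space n, ℂ)} (hg : Continuous g) :
    RapidDecay fun τ ξ => hat (g τ) ξ := by
  have h : Continuous fun τ => (𝓕 (g τ) : 𝓢(Space n, ℂ)) :=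
    (FourierTransform.fourierCLM ℂ 𝓢(Space n, ℂ)).continuous.comp hg
  exact (rapidDecay_schwartz h).comp_smul (c := (2 * Real.pi)⁻¹) (by positivity)

/-- The time derivative is given only pointwise in x. The fundamental theorem of calculus is applied
at each point and transformed by Fubini, so no differentiability in the Schwartz topology is needed.
-/
theorem hat_sub_eq_integral {f f' : ℝ → 𝓢(Space n, ℂ)} (hf' : Continuous f')
    (hd : ∀ t ≥ 0, ∀ x, HasDerivWithinAt (fun s => f s x) (f' t x) (Ici 0) t)
    {t : ℝ} (ht : 0 ≤ t) (ξ : Space n) :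
    hat (f t) ξ = hat (f 0) ξ + ∫ r in (0 : ℝ)..t, hat (f' r) ξ := by
  have hR := rapidDecay_schwartz hf'
  have hFTC : ∀ y, f t y = f 0 y + ∫ r in (0 : ℝ)..t, f' r y := by
    intro y
    have h := intervalIntegral.integral_eq_sub_of_hasDerivAt_of_le ht
      (f := fun s => f s y) (f' := fun s => f' s y)
      (fun s hs => ((hd s hs.1 y).continuousWithinAt).mono Icc_subset_Ici_self)
      (fun s hs => (hd s hs.1.le y).hasDerivAt (Ici_mem_nhds hs.1))
      ((hR.continuous_time y).intervalIntegrable _ _)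
    rw [h]
    ring
  set e : Space n → ℂ := fun y => Complex.exp (Complex.I * ((-inner ℝ ξ y : ℝ))) with he
  have hec : Continuous e := by fun_prop
  have hsw := hR.integral_swap (e := e) hec (fun _ => norm_exp_I_mul_le_one _) ht
    (w := fun _ => 1) intervalIntegrable_const
  simp only [one_mul] at hsw
  have h0 : Integrable fun y => f 0 y * e y :=
    ((f 0).integrable).mul_bdd (c := 1) hec.aestronglyMeasurable
      (Filter.Eventually.of_forall fun _ => norm_exp_I_mul_le_one _)
  have ht' : Integrable fun y => f t y * e y :=
    ((f t).integrable).mul_bdd (c := 1) hec.aestronglyMeasurable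
      (Filter.Eventually.of_forall fun _ => norm_exp_I_mul_le_one _)
  have e1 : ∫ y, f t y * e y - f 0 y * e y = ∫ y, (∫ r in (0 : ℝ)..t, f' r y) * e y := by
    congr 1
    ext y
    rw [hFTC y]
    ring
  rw [integral_sub ht' h0, ← hsw] at e1
  rw [hat_eq, hat_eq, ← sub_eq_iff_eq_add', e1]
  simp_rw [hat_eq, he]

/-! ### Real data -/

theorem hat_neg_of_real {φ : 𝓢(Space n, ℂ)} (hφ : ∀ x, (φ x).im = 0) (ξ : Space n) :
    hat φ (-ξ) = (starRingEnd ℂ) (hat φ ξ) := by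
  rw [hat_eq, hat_eq, ← integral_conj]
  congr 1
  ext y
  rw [map_mul, Complex.conj_eq_iff_im.2 (hφ y), ← Complex.exp_conj, map_mul, Complex.conj_I,
    Complex.conj_ofReal, inner_neg_left]
  congr 2
  push_cast
  ring

theorem invFourier_im_eq_zero {h : Space n → ℂ} (hh : ∀ ξ, h (-ξ) = (starRingEnd ℂ) (h ξ))
    (x : Space n) : (invFourier h x).im = 0 := by
  rw [← Complex.conj_eq_iff_im, invFourier, map_mul, ← Complex.ofReal_inv, Complex.conj_ofReal,
    ← integral_conj]
  congr 1
  rw [← integral_neg_eq_self]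
  congr 1
  ext ξ
  rw [map_mul, hh, Complex.conj_conj, ← Complex.exp_conj, map_mul, Complex.conj_I,
    Complex.conj_ofReal, inner_neg_right]
  congr 2
  push_cast
  ring

/-- A real even multiplier preserves the Hermitian symmetry that characterizes transforms of real
functions. -/
theorem kernelConv_im_eq_zero {φ : 𝓢(Space n, ℂ)} (hφ : ∀ x, (φ x).im = 0) {m : Space n → ℝ}
    (hm : ∀ ξ, m (-ξ) = m ξ) (x : Space n) :
    (kernelConv (fun ξ => ((m ξ : ℝ) : ℂ)) φ x).im = 0 := by
  rw [kernelConv_eq]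
  refine invFourier_im_eq_zero (fun ξ => ?_) x
  rw [map_mul, Complex.conj_ofReal, hm, hat_neg_of_real hφ]

end

/-! ### Derivatives of primitives -/

theorem hasDerivWithinAt_of_eq_integral {g G : ℝ → ℂ} (hg : Continuous g)
    (hG : ∀ t ≥ 0, G t = ∫ τ in (0 : ℝ)..t, g τ) {t : ℝ} (ht : 0 ≤ t) :
    HasDerivWithinAt G (g t) (Ici 0) t := by
  have h := intervalIntegral.integral_hasDerivAt_right (hg.intervalIntegrable 0 t)
    (hg.stronglyMeasurableAtFilter volume _) hg.continuousAt
  exact h.hasDerivWithinAt.congr (fun y hy => hG y hy) (hG t ht)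

theorem hasDerivAt_of_eq_integral {g G : ℝ → ℂ} (hg : ContinuousOn g (Ioi 0))
    (hint : ∀ t > 0, IntervalIntegrable g volume 0 t)
    (hG : ∀ t > 0, G t = ∫ τ in (0 : ℝ)..t, g τ) {t : ℝ} (ht : 0 < t) :
    HasDerivAt G (g t) t := by
  have hn : Ioi (0 : ℝ) ∈ nhds t := Ioi_mem_nhds ht
  have h := intervalIntegral.integral_hasDerivAt_right (hint t ht)
    (hg.stronglyMeasurableAtFilter isOpen_Ioi t ht) (hg.continuousAt hn)
  refine h.congr_of_eventuallyEq ?_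
  filter_upwards [hn] with y hy using hG y hy

theorem contDiffOn_one_Ioi {G g : ℝ → ℂ} (h : ∀ t > 0, HasDerivAt G (g t) t)
    (hg : ContinuousOn g (Ioi 0)) : ContDiffOn ℝ 1 G (Ioi 0) := by
  rw [contDiffOn_one_iff_derivWithin (uniqueDiffOn_Ioi 0)]
  refine ⟨fun t ht => (h t ht).differentiableAt.differentiableWithinAt, hg.congr fun t ht => ?_⟩
  rw [derivWithin_of_isOpen isOpen_Ioi ht, (h t ht).deriv]

theorem contDiffOn_two_Ioi {G g g' : ℝ → ℂ} (h : ∀ t > 0, HasDerivAt G (g t) t)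
    (h' : ∀ t > 0, HasDerivAt g (g' t) t) (hg : ContinuousOn g' (Ioi 0)) :
    ContDiffOn ℝ 2 G (Ioi 0) := by
  rw [show (2 : WithTop ℕ∞) = 1 + 1 by norm_num, contDiffOn_succ_iff_deriv_of_isOpen isOpen_Ioi]
  refine ⟨fun t ht => (h t ht).differentiableAt.differentiableWithinAt, fun h => ?_, ?_⟩
  · exact absurd h (by decide)
  · exact (contDiffOn_one_Ioi h' hg).congr fun t ht => (h t ht).deriv

theorem contDiffOn_one_Ici {G g : ℝ → ℂ} (h : ∀ t ≥ 0, HasDerivWithinAt G (g t) (Ici 0) t)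
    (hg : Continuous g) : ContDiffOn ℝ 1 G (Ici 0) := by
  rw [contDiffOn_one_iff_derivWithin (uniqueDiffOn_Ici 0)]
  refine ⟨fun t ht => (h t ht).differentiableWithinAt, hg.continuousOn.congr fun t ht => ?_⟩
  exact (h t ht).derivWithin (uniqueDiffOn_Ici 0 t ht)

theorem iteratedDeriv_two_eq {G g g' : ℝ → ℂ} (h : ∀ t > 0, HasDerivAt G (g t) t)
    (h' : ∀ t > 0, HasDerivAt g (g' t) t) {t : ℝ} (ht : 0 < t) : iteratedDeriv 2 G t = g' t := by
  rw [iteratedDeriv_succ, iteratedDeriv_one, ← (h' t ht).deriv]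
  refine Filter.EventuallyEq.deriv_eq ?_
  filter_upwards [Ioi_mem_nhds ht] with y hy using (h y hy).deriv

/-! ### Powers of time -/

/-- The monomial `t^c / Γ(c + 1)`. -/
noncomputable def rpowC (c t : ℝ) : ℂ := ((t ^ c / Real.Gamma (c + 1) : ℝ) : ℂ)

theorem continuous_rpowC {c : ℝ} (hc : 0 ≤ c) : Continuous (rpowC c) :=
  Complex.continuous_ofReal.comp ((Real.continuous_rpow_const hc).div_const _)

theorem rpowC_zero (t : ℝ) : rpowC 0 t = 1 := by
  simp [rpowC]

theorem rpowC_one (t : ℝ) : rpowC 1 t = t := by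
  simp [rpowC, one_add_one_eq_two]

theorem hasDerivAt_rpowC {c t : ℝ} (hc : 0 ≤ c) (ht : 0 < t) :
    HasDerivAt (rpowC (c + 1)) (rpowC c t) t := by
  have h := ((Real.hasDerivAt_rpow_const (x := t) (p := c + 1) (Or.inl ht.ne')).div_const
    (Real.Gamma (c + 1 + 1))).ofReal_comp
  refine h.congr_deriv ?_
  rw [rpowC, Real.Gamma_add_one (by linarith : c + 1 ≠ 0), add_sub_cancel_right]
  congr 1
  have h1 : c + 1 ≠ 0 := by linarith
  have h2 := (Real.Gamma_pos_of_pos (show 0 < c + 1 by linarith)).ne'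
  field_simp

theorem rlIntegral_rpowC {a c t : ℝ} (ha : 0 ≤ a) (hc : 0 ≤ c) (ht : 0 < t) :
    rlIntegral a (rpowC c) t = rpowC (a + c) t := by
  rcases ha.eq_or_lt with rfl | ha
  · simp [rlIntegral]
  rw [rlIntegral_of_pos ha]
  have h := integral_rlKernel_mul_rpow ha (show 0 < c + 1 by linarith) ht
  rw [rpowC, show a + c + 1 = a + (c + 1) by ring, show a + c = a + (c + 1) - 1 by ring, ← h,
    ← intervalIntegral.integral_ofReal]
  simp_rw [rpowC, add_sub_cancel_right, Complex.ofReal_mul]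

theorem rlIntegral_mul_const_add {a t : ℝ} (ha : 0 ≤ a) {g h : ℝ → ℂ} (hg : Continuous g)
    (hh : Continuous h) (c : ℂ) :
    rlIntegral a (fun τ => g τ * c + h τ) t = rlIntegral a g t * c + rlIntegral a h t := by
  rcases ha.eq_or_lt with rfl | ha
  · simp [rlIntegral]
  rw [rlIntegral_of_pos ha, rlIntegral_of_pos ha, rlIntegral_of_pos ha,
    ← intervalIntegral.integral_mul_const, ← intervalIntegral.integral_add
      (((intervalIntegrable_rlKernel ha t).mul_continuousOn hg.continuousOn).mul_const c)
      ((intervalIntegrable_rlKernel ha t).mul_continuousOn hh.continuousOn)]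
  simp_rw [mul_add, mul_assoc]

theorem rlIntegral_one (g : ℝ → ℂ) (t : ℝ) : rlIntegral 1 g t = ∫ τ in (0 : ℝ)..t, g τ := by
  simp [rlIntegral]

/-! ### Scales of fractional primitives -/

/-- A scale of continuous functions on `[0, ∞)`, vanishing at `0`, on which the fractional
integrals act as a shift of the order. -/
structure FractionalScale (V : ℝ → ℝ → ℂ) : Prop where
  cont : ∀ b > 0, Continuous (V b)
  zero : ∀ b > 0, V b 0 = 0
  rl : ∀ a ≥ 0, ∀ b > 0, ∀ t ≥ 0, rlIntegral a (V b) t = V (a + b) t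

theorem FractionalScale.hasDerivWithinAt {V : ℝ → ℝ → ℂ} (hV : FractionalScale V) {b t : ℝ}
    (hb : 0 < b) (ht : 0 ≤ t) : HasDerivWithinAt (V (b + 1)) (V b t) (Ici 0) t := by
  refine hasDerivWithinAt_of_eq_integral (hV.cont b hb) (fun t ht => ?_) ht
  rw [← rlIntegral_one, hV.rl 1 zero_le_one b hb t ht, add_comm]

theorem FractionalScale.hasDerivAt {V : ℝ → ℝ → ℂ} (hV : FractionalScale V) {b t : ℝ}
    (hb : 0 < b) (ht : 0 < t) : HasDerivAt (V (b + 1)) (V b t) t :=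
  (hV.hasDerivWithinAt hb ht.le).hasDerivAt (Ici_mem_nhds ht)

theorem ceil_order {α : ℝ} (h0 : 0 < α) (h1 : α ≤ 1) : ⌈α⌉₊ = 1 := by
  rw [Nat.ceil_eq_iff one_ne_zero]
  constructor <;> norm_num <;> assumption

/-- The order 2α lies in (1, 2], so the Taylor polynomial involves exactly u(0) and u'(0). -/
theorem ceil_double_order {α : ℝ} (h0 : 1 / 2 < α) (h1 : α ≤ 1) : ⌈2 * α⌉₊ = 2 := by
  rw [Nat.ceil_eq_iff two_ne_zero]
  constructor <;> norm_num <;> linarith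

section
variable {α : ℝ} {V : ℝ → ℝ → ℂ} {u : ℝ → ℂ} {c₀ c₁ : ℂ}

/-- Since 2α - 1 > 0, the derivative stays inside the scale and its V-part vanishes at 0, which
gives the initial velocity c₁. -/
theorem FractionalScale.solution_hasDerivWithinAt (hα : 1 / 2 < α) (hV : FractionalScale V)
    (hu : ∀ t ≥ 0, u t = c₀ + t * c₁ + V (2 * α) t) {t : ℝ} (ht : 0 ≤ t) :
    HasDerivWithinAt u (c₁ + V (2 * α - 1) t) (Ici 0) t := by
  have h1 := hV.hasDerivWithinAt (b := 2 * α - 1) (by linarith) ht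
  rw [sub_add_cancel] at h1
  have h2 : HasDerivWithinAt (fun t : ℝ => c₀ + (t : ℂ) * c₁) c₁ (Ici 0) t := by
    have := (((hasDerivAt_id t).ofReal_comp.mul_const c₁).const_add c₀).hasDerivWithinAt (s := Ici 0)
    simpa using this
  exact (h2.add h1).congr (fun y hy => hu y hy) (hu t ht)

theorem FractionalScale.solution_zero (hα : 1 / 2 < α) (hV : FractionalScale V)
    (hu : ∀ t ≥ 0, u t = c₀ + t * c₁ + V (2 * α) t) : u 0 = c₀ := by
  rw [hu 0 le_rfl, hV.zero _ (by linarith)]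
  simp

theorem FractionalScale.continuousOn_solution (hα : 1 / 2 < α) (hV : FractionalScale V)
    (hu : ∀ t ≥ 0, u t = c₀ + t * c₁ + V (2 * α) t) : ContinuousOn u (Ici 0) := fun _ ht =>
  (hV.solution_hasDerivWithinAt hα hu ht).continuousWithinAt

/-- I^{1-α} turns u - c₀ = t c₁ + V_{2α} into t^{2-α}/Γ(3-α) c₁ + V_{α+1}, which is differentiated
once. -/
theorem FractionalScale.hasWeakCaputoDeriv (hα : 1 / 2 < α) (hα' : α ≤ 1)
    (hV : FractionalScale V) (hu : ∀ t ≥ 0, u t = c₀ + t * c₁ + V (2 * α) t) :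
    HasWeakCaputoDeriv α u (fun t => rpowC (1 - α) t * c₁ + V α t) := by
  have hα0 : 0 < α := by linarith
  have hdiff : ∀ t > 0, HasDerivAt (fun t => rpowC (1 - α + 1) t * c₁ + V (α + 1) t)
      (rpowC (1 - α) t * c₁ + V α t) t := fun t ht =>
    ((hasDerivAt_rpowC (by linarith) ht).mul_const c₁).add (hV.hasDerivAt hα0 ht)
  have hcont : Continuous fun t => rpowC (1 - α) t * c₁ + V α t :=
    ((continuous_rpowC (by linarith)).mul continuous_const).add (hV.cont α hα0)
  have hrl : ∀ t > 0, rlIntegral (1 - α) (fun τ => u τ - taylorAtZero 1 u τ) t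
      = rpowC (1 - α + 1) t * c₁ + V (α + 1) t := by
    intro t ht
    have h1 : rlIntegral (1 - α) (fun τ => u τ - taylorAtZero 1 u τ) t
        = rlIntegral (1 - α) (fun τ => rpowC 1 τ * c₁ + V (2 * α) τ) t := by
      refine rlIntegral_congr ht fun τ hτ => ?_
      simp only [taylorAtZero, Finset.sum_range_one, iteratedDerivWithin_zero, pow_zero,
        Nat.factorial_zero, Nat.cast_one, div_one, Complex.ofReal_one, mul_one]
      rw [hV.solution_zero hα hu, hu τ hτ.1.le, rpowC_one]
      ring
    rw [h1, rlIntegral_mul_const_add (by linarith) (continuous_rpowC zero_le_one)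
      (hV.cont _ (by linarith)),
      rlIntegral_rpowC (by linarith) zero_le_one ht,
      hV.rl _ (by linarith) _ (by linarith) t ht.le]
    congr 2
    ring
  unfold HasWeakCaputoDeriv
  rw [ceil_order hα0 hα']
  simp only [Nat.cast_one, tsub_self]
  refine ⟨contDiffOn_zero.2 (hV.continuousOn_solution hα hu), ?_, fun t ht => ?_⟩
  · exact (contDiffOn_one_Ioi hdiff hcont.continuousOn).congr fun t ht => hrl t ht
  · rw [iteratedDeriv_one, ← (hdiff t ht).deriv]
    refine Filter.EventuallyEq.deriv_eq ?_
    filter_upwards [Ioi_mem_nhds ht] with y hy using (hrl y hy).symm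

/-- Removing the Taylor polynomial leaves V_{2α}, and I^{2-2α}V_{2α} = V_2. Its second derivative is
V_1', formally V_0; as order 0 is outside the scale, W is given with V_1 as its primitive. -/
theorem FractionalScale.hasWeakCaputoDeriv_double (hα : 1 / 2 < α) (hα' : α ≤ 1)
    (hV : FractionalScale V) (hu : ∀ t ≥ 0, u t = c₀ + t * c₁ + V (2 * α) t) {W : ℝ → ℂ}
    (hWc : Continuous W) (hW : ∀ t ≥ 0, V 1 t = ∫ τ in (0 : ℝ)..t, W τ) :
    HasWeakCaputoDeriv (2 * α) u W := by
  have h21 : ∀ t > 0, HasDerivAt (V 2) (V 1 t) t := fun t ht => by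
    have := hV.hasDerivAt one_pos ht
    rwa [one_add_one_eq_two] at this
  have h1W : ∀ t > 0, HasDerivAt (V 1) (W t) t := fun t ht =>
    (hasDerivWithinAt_of_eq_integral hWc hW ht.le).hasDerivAt (Ici_mem_nhds ht)
  have hrl : ∀ t > 0, rlIntegral (2 - 2 * α) (fun τ => u τ - taylorAtZero 2 u τ) t = V 2 t := by
    intro t ht
    have h1 : rlIntegral (2 - 2 * α) (fun τ => u τ - taylorAtZero 2 u τ) t
        = rlIntegral (2 - 2 * α) (V (2 * α)) t := by
      refine rlIntegral_congr ht fun τ hτ => ?_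
      have hd := (hV.solution_hasDerivWithinAt hα hu le_rfl).derivWithin
        (uniqueDiffOn_Ici 0 0 self_mem_Ici)
      rw [hV.zero _ (by linarith), add_zero] at hd
      simp only [taylorAtZero, Finset.sum_range_succ, Finset.range_zero, Finset.sum_empty,
        iteratedDerivWithin_zero, iteratedDerivWithin_one, hd, hV.solution_zero hα hu, hu τ hτ.1.le,
        pow_zero, pow_one, Nat.factorial_zero, Nat.factorial_one, Nat.cast_one, div_one,
        Complex.ofReal_one]
      ring
    rw [h1, hV.rl _ (by linarith) _ (by linarith) t ht.le]
    congr 1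
    ring
  unfold HasWeakCaputoDeriv
  rw [ceil_double_order hα hα']
  simp only [Nat.cast_ofNat]
  refine ⟨?_, ?_, fun t ht => ?_⟩
  · have hc : Continuous fun t => c₁ + V (2 * α - 1) t :=
      continuous_const.add (hV.cont _ (by linarith))
    have := contDiffOn_one_Ici (fun t ht => hV.solution_hasDerivWithinAt hα hu ht) hc
    simpa using this
  · exact (contDiffOn_two_Ioi h21 h1W hWc.continuousOn).congr fun t ht => hrl t ht
  · rw [← iteratedDeriv_two_eq h21 h1W ht]
    refine Filter.EventuallyEq.iteratedDeriv_eq 2 ?_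
    filter_upwards [Ioi_mem_nhds ht] with y hy using (hrl y hy).symm

/-- A scale of continuous functions on `(0, ∞)`, possibly singular at `0`, on which the
fractional integrals act as a shift of the order. -/
structure SingularScale (Z : ℝ → ℝ → ℂ) : Prop where
  cont : ∀ b > 0, ContinuousOn (Z b) (Ioi 0)
  integrable : ∀ a > 0, ∀ b > 0, ∀ t > 0, IntervalIntegrable (fun τ =>
    (((t - τ) ^ (a - 1) / Real.Gamma a : ℝ) : ℂ) * Z b τ) volume 0 t
  rl : ∀ a > 0, ∀ b > 0, ∀ t > 0, ∫ τ in (0 : ℝ)..t,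
    (((t - τ) ^ (a - 1) / Real.Gamma a : ℝ) : ℂ) * Z b τ = Z (a + b) t

theorem SingularScale.intervalIntegrable {Z : ℝ → ℝ → ℂ} (hZ : SingularScale Z) {b t : ℝ}
    (hb : 0 < b) (ht : 0 < t) : IntervalIntegrable (Z b) volume 0 t := by
  simpa using hZ.integrable 1 one_pos b hb t ht

theorem SingularScale.hasDerivAt {Z : ℝ → ℝ → ℂ} (hZ : SingularScale Z) {b t : ℝ}
    (hb : 0 < b) (ht : 0 < t) : HasDerivAt (Z (b + 1)) (Z b t) t := by
  refine hasDerivAt_of_eq_integral (hZ.cont b hb) (fun t ht => hZ.intervalIntegrable hb ht)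
    (fun t ht => ?_) ht
  have := hZ.rl 1 one_pos b hb t ht
  rw [add_comm, ← this]
  simp

theorem intervalIntegrable_congr_Ioc {g h : ℝ → ℂ} {t : ℝ} (ht : 0 ≤ t)
    (hg : IntervalIntegrable g volume 0 t) (hgh : ∀ τ ∈ Ioc 0 t, g τ = h τ) :
    IntervalIntegrable h volume 0 t := by
  rw [intervalIntegrable_iff_integrableOn_Ioc_of_le ht] at hg ⊢
  exact hg.congr_fun hgh measurableSet_Ioc

theorem intervalIntegral_congr_Ioc {g h : ℝ → ℂ} {t : ℝ} (ht : 0 ≤ t)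
    (hgh : ∀ τ ∈ Ioc 0 t, g τ = h τ) :
    ∫ τ in (0 : ℝ)..t, g τ = ∫ τ in (0 : ℝ)..t, h τ := by
  rw [intervalIntegral.integral_of_le ht, intervalIntegral.integral_of_le ht]
  exact setIntegral_congr_fun measurableSet_Ioc hgh

/-- Here u' = c₁ + V_{2α-1} is continuous, and I^{1-α}u' is the stated derivative. For α = 1 no
integral is taken. -/
theorem FractionalScale.hasCaputoDeriv (hα : 1 / 2 < α) (hα' : α ≤ 1)
    (hV : FractionalScale V) (hu : ∀ t ≥ 0, u t = c₀ + t * c₁ + V (2 * α) t) :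
    HasCaputoDeriv α u (fun t => rpowC (1 - α) t * c₁ + V α t) := by
  have hα0 : 0 < α := by linarith
  have hd : ∀ t > 0, HasDerivAt u (c₁ + V (2 * α - 1) t) t := fun t ht =>
    (hV.solution_hasDerivWithinAt hα hu ht.le).hasDerivAt (Ici_mem_nhds ht)
  have hc : Continuous fun t => c₁ + V (2 * α - 1) t :=
    continuous_const.add (hV.cont _ (by linarith))
  unfold HasCaputoDeriv caputoDeriv
  rw [ceil_order hα0 hα']
  simp only [Nat.cast_one, iteratedDeriv_one]
  refine ⟨contDiffOn_one_Ioi hd hc.continuousOn, fun t ht => ⟨?_, fun hne => ?_, ?_⟩⟩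
  · exact intervalIntegrable_congr_Ioc ht.le (hc.intervalIntegrable 0 t)
      fun τ hτ => (hd τ hτ.1).deriv.symm
  · have hlt : 0 < 1 - α := sub_pos.2 (lt_of_le_of_ne hα' hne)
    refine intervalIntegrable_congr_Ioc ht.le
      ((intervalIntegrable_rlKernel hlt t).mul_continuousOn hc.continuousOn) fun τ hτ => ?_
    rw [(hd τ hτ.1).deriv]
  · split_ifs with h1
    · rw [(hd t ht).deriv, h1, sub_self, rpowC_zero, one_mul, mul_one,
        show (2 - 1 : ℝ) = 1 by norm_num]
    · have hlt : 0 < 1 - α := sub_pos.2 (lt_of_le_of_ne hα' h1)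
      have e1 : ∫ τ in (0 : ℝ)..t, (((t - τ) ^ (1 - α - 1) / Real.Gamma (1 - α) : ℝ) : ℂ)
          * deriv u τ = rlIntegral (1 - α) (fun τ => rpowC 0 τ * c₁ + V (2 * α - 1) τ) t := by
        rw [rlIntegral_of_pos hlt]
        refine intervalIntegral_congr_Ioc ht.le fun τ hτ => ?_
        rw [(hd τ hτ.1).deriv, rpowC_zero, one_mul]
      rw [e1, rlIntegral_mul_const_add hlt.le (continuous_rpowC le_rfl)
        (hV.cont _ (by linarith)), rlIntegral_rpowC hlt.le le_rfl ht,
        hV.rl _ hlt.le _ (by linarith) t ht.le, add_zero]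
      congr 2
      ring

/-- Z_b is the derivative of V_b and may be singular at 0, so u'' = Z_{2α-1} is integrable rather
than continuous there. Then I^{2-2α}u'' = Z_1 = V_1' = W, and for α = 1 directly u'' = Z_1. -/
theorem FractionalScale.hasCaputoDeriv_double (hα : 1 / 2 < α) (hα' : α ≤ 1)
    (hV : FractionalScale V) (hu : ∀ t ≥ 0, u t = c₀ + t * c₁ + V (2 * α) t) {W : ℝ → ℂ}
    (hWc : Continuous W) (hW : ∀ t ≥ 0, V 1 t = ∫ τ in (0 : ℝ)..t, W τ) {Z : ℝ → ℝ → ℂ}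
    (hZ : SingularScale Z) (hZV : ∀ b > 0, ∀ t > 0, Z (b + 1) t = V b t) :
    HasCaputoDeriv (2 * α) u W := by
  have hb : 0 < 2 * α - 1 := by linarith
  have hd : ∀ t > 0, HasDerivAt u (c₁ + V (2 * α - 1) t) t := fun t ht =>
    (hV.solution_hasDerivWithinAt hα hu ht.le).hasDerivAt (Ici_mem_nhds ht)
  have hVZ : ∀ b > 0, ∀ t > 0, HasDerivAt (V b) (Z b t) t := fun b hb t ht => by
    refine (hZ.hasDerivAt hb ht).congr_of_eventuallyEq ?_
    filter_upwards [Ioi_mem_nhds ht] with y hy using (hZV b hb y hy).symm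
  have hd2 : ∀ t > 0, HasDerivAt (fun t => c₁ + V (2 * α - 1) t) (Z (2 * α - 1) t) t :=
    fun t ht => (hVZ _ hb t ht).const_add c₁
  have hZW : ∀ t > 0, Z 1 t = W t := fun t ht =>
    (hVZ 1 one_pos t ht).unique
      ((hasDerivWithinAt_of_eq_integral hWc hW ht.le).hasDerivAt (Ici_mem_nhds ht))
  have hit : ∀ t > 0, iteratedDeriv 2 u t = Z (2 * α - 1) t := fun t ht =>
    iteratedDeriv_two_eq hd hd2 ht
  unfold HasCaputoDeriv caputoDeriv
  rw [ceil_double_order hα hα']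
  simp only [Nat.cast_ofNat]
  refine ⟨contDiffOn_two_Ioi hd hd2 (hZ.cont _ hb), fun t ht => ⟨?_, fun hne => ?_, ?_⟩⟩
  · exact intervalIntegrable_congr_Ioc ht.le (hZ.intervalIntegrable hb ht)
      fun τ hτ => (hit τ hτ.1).symm
  · have hlt : 0 < 2 - 2 * α := sub_pos.2 (lt_of_le_of_ne (by linarith) hne)
    refine intervalIntegrable_congr_Ioc ht.le (hZ.integrable _ hlt _ hb t ht) fun τ hτ => ?_
    rw [hit τ hτ.1]
  · split_ifs with h1
    · rw [hit t ht, h1, ← hZW t ht]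
      norm_num
    · have hlt : 0 < 2 - 2 * α := sub_pos.2 (lt_of_le_of_ne (by linarith) h1)
      rw [← hZW t ht, show (1 : ℝ) = 2 - 2 * α + (2 * α - 1) by ring,
        ← hZ.rl _ hlt _ hb t ht]
      refine intervalIntegral_congr_Ioc ht.le fun τ hτ => ?_
      rw [hit τ hτ.1]
      norm_num

end

section
variable {n : ℕ} {α β σ μ : ℝ}

/-! ### The solution on the Fourier side -/

/-- The family `t^c / Γ(c + 1) φ(ξ)`. -/
noncomputable def rpowFamily (c : ℝ) (φ : Space n → ℂ) (t : ℝ) (ξ : Space n) : ℂ :=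
  rpowC c t * φ ξ

theorem RapidDecay.rpow {c : ℝ} (hc : 0 ≤ c) {φ : Space n → ℂ}
    (hφ : RapidDecay fun _ : ℝ => φ) : RapidDecay (rpowFamily c φ) :=
  (PolyGrowth.of_time (continuous_rpowC hc)).mul_rapid hφ

theorem RapidDecay.freq_mul (hσ : 0 < σ) (c : ℂ) {h : ℝ → Space n → ℂ} (hh : RapidDecay h) :
    RapidDecay fun τ ξ => c * freqPow σ ξ * h τ ξ :=
  ((PolyGrowth.of_time continuous_const).mul (PolyGrowth.freqPow hσ)).mul_rapid hh

theorem RapidDecay.freq_sq_mul (hσ : 0 < σ) {h : ℝ → Space n → ℂ} (hh : RapidDecay h) :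
    RapidDecay fun τ ξ => freqPow σ ξ ^ 2 * h τ ξ := by
  simp_rw [pow_two]
  exact ((PolyGrowth.freqPow hσ).mul (PolyGrowth.freqPow hσ)).mul_rapid hh

theorem dampConv_rpowFamily (hα : 0 < α) (hμ : 0 < μ) {b c t : ℝ} (hb : 0 < b) (hc : 0 ≤ c)
    (ht : 0 ≤ t) (φ : Space n → ℂ) (ξ : Space n) :
    dampConv α σ μ b (rpowFamily c φ) t ξ
      = ((dampKernel α μ (b + c + 1) (‖ξ‖ ^ σ) t : ℝ) : ℂ) * φ ξ :=
  dampConv_rpow hα hμ hb hc ht φ ξ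

theorem dampConv_rpowFamily_shift (hα : 0 < α) (hμ : 0 < μ) {b c t : ℝ} (hb : 0 < b)
    (hc : 0 ≤ c) (ht : 0 ≤ t) (φ : Space n → ℂ) (ξ : Space n) :
    dampConv α σ μ b (rpowFamily c φ) t ξ = dampConv α σ μ (b + c) (rpowFamily 0 φ) t ξ := by
  rw [dampConv_rpowFamily hα hμ hb hc ht, dampConv_rpowFamily hα hμ (by linarith) le_rfl ht,
    add_zero]

/-- The source term of the equation with vanishing initial data that is solved by the Fourier
transform of `u - u₀ - t u₁`. -/
noncomputable def source (α β σ μ : ℝ) (φ₀ φ₁ : Space n → ℂ) (g : ℝ → Space n → ℂ) (τ : ℝ)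
    (ξ : Space n) : ℂ :=
  rlFamily (β - 2 * α) g τ ξ - freqPow σ ξ ^ 2 * rpowFamily 0 φ₀ τ ξ
    - μ * freqPow σ ξ * rpowFamily (1 - α) φ₁ τ ξ - freqPow σ ξ ^ 2 * rpowFamily 1 φ₁ τ ξ

theorem RapidDecay.source (hα' : α ≤ 1) (hβ : 2 * α ≤ β) (hσ : 0 < σ) {φ₀ φ₁ : Space n → ℂ}
    {g : ℝ → Space n → ℂ} (h₀ : RapidDecay fun _ : ℝ => φ₀) (h₁ : RapidDecay fun _ : ℝ => φ₁)
    (hg : RapidDecay g) : RapidDecay (source α β σ μ φ₀ φ₁ g) :=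
  (((hg.rl (sub_nonneg.2 hβ)).sub ((h₀.rpow le_rfl).freq_sq_mul hσ)).sub
    ((h₁.rpow (sub_nonneg.2 hα')).freq_mul hσ μ)).sub ((h₁.rpow zero_le_one).freq_sq_mul hσ)

/-- The powers of time and the fractional integral in the source are absorbed into the order of the
kernel, leaving convolutions with g and with data constant in time. -/
theorem dampConv_source (hα : 1 / 2 < α) (hα' : α ≤ 1) (hβ : 2 * α ≤ β) (hσ : 0 < σ)
    (hμ : 0 < μ) {φ₀ φ₁ : Space n → ℂ} {g : ℝ → Space n → ℂ}
    (h₀ : RapidDecay fun _ : ℝ => φ₀) (h₁ : RapidDecay fun _ : ℝ => φ₁) (hg : RapidDecay g)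
    {b t : ℝ} (hb : 0 < b) (ht : 0 ≤ t) (ξ : Space n) :
    dampConv α σ μ b (source α β σ μ φ₀ φ₁ g) t ξ
      = dampConv α σ μ (b + (β - 2 * α)) g t ξ
        - freqPow σ ξ ^ 2 * dampConv α σ μ b (rpowFamily 0 φ₀) t ξ
        - μ * freqPow σ ξ * dampConv α σ μ (b + (1 - α)) (rpowFamily 0 φ₁) t ξ
        - freqPow σ ξ ^ 2 * dampConv α σ μ (b + 1) (rpowFamily 0 φ₁) t ξ := by
  have hα0 : 0 < α := by linarith
  have hq := PolyGrowth.dampSymbol (n := n) hα hα' hσ hμ hb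
  have r1 := hg.rl (sub_nonneg.2 hβ)
  have r2 := (h₀.rpow le_rfl).freq_sq_mul hσ
  have r3 := (h₁.rpow (sub_nonneg.2 hα')).freq_mul hσ μ
  have r4 := (h₁.rpow zero_le_one).freq_sq_mul hσ
  have e : dampConv α σ μ b (FracDamped.source α β σ μ φ₀ φ₁ g) t ξ
      = dampConv α σ μ b (rlFamily (β - 2 * α) g) t ξ
        - freqPow σ ξ ^ 2 * dampConv α σ μ b (rpowFamily 0 φ₀) t ξ
        - μ * freqPow σ ξ * dampConv α σ μ b (rpowFamily (1 - α) φ₁) t ξ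
        - freqPow σ ξ ^ 2 * dampConv α σ μ b (rpowFamily 1 φ₁) t ξ := by
    unfold dampConv
    rw [← volterra_mul_left b _ _ (fun ξ => freqPow σ ξ ^ 2),
      ← volterra_mul_left b _ _ (fun ξ => freqPow σ ξ ^ 2),
      ← volterra_mul_left b _ _ (fun ξ => μ * freqPow σ ξ),
      ← volterra_sub hb hq r1 r2, ← volterra_sub hb hq (r1.sub r2) r3,
      ← volterra_sub hb hq ((r1.sub r2).sub r3) r4]
    rfl
  rw [e, dampConv_rlFamily hα0 hμ (sub_nonneg.2 hβ) hb ht ξ (hg.continuous_time ξ),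
    dampConv_rpowFamily_shift hα0 hμ hb (sub_nonneg.2 hα') ht,
    dampConv_rpowFamily_shift hα0 hμ hb zero_le_one ht, add_comm (β - 2 * α)]

/-- The Fourier transform of the solution. -/
noncomputable def solutionHat (α β σ μ : ℝ) (φ₀ φ₁ : Space n → ℂ) (g : ℝ → Space n → ℂ) (t : ℝ)
    (ξ : Space n) : ℂ :=
  rpowFamily 0 φ₀ t ξ + rpowFamily 1 φ₁ t ξ
    + dampConv α σ μ (2 * α) (source α β σ μ φ₀ φ₁ g) t ξ

/-- The Fourier transform of the derivative of order `α` of the solution. -/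
noncomputable def derivHat (α β σ μ : ℝ) (φ₀ φ₁ : Space n → ℂ) (g : ℝ → Space n → ℂ) (t : ℝ)
    (ξ : Space n) : ℂ :=
  rpowFamily (1 - α) φ₁ t ξ + dampConv α σ μ α (source α β σ μ φ₀ φ₁ g) t ξ

/-- The Fourier transform of the derivative of order `2α` of the solution with source `h` and
vanishing initial data. -/
noncomputable def derivTwoHat (α σ μ : ℝ) (h : ℝ → Space n → ℂ) (t : ℝ) (ξ : Space n) : ℂ :=
  h t ξ - μ * freqPow σ ξ * dampConv α σ μ α h t ξ
    - freqPow σ ξ ^ 2 * dampConv α σ μ (2 * α) h t ξ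

/-- The equation in Fourier variables. It is purely algebraic; that `derivTwoHat` represents the
derivative of order 2α comes from `rlFamily_one_derivTwoHat`. -/
theorem derivTwoHat_add (t : ℝ) (φ₀ φ₁ : Space n → ℂ) (g : ℝ → Space n → ℂ) (ξ : Space n) :
    derivTwoHat α σ μ (source α β σ μ φ₀ φ₁ g) t ξ
      + μ * (freqPow σ ξ * derivHat α β σ μ φ₀ φ₁ g t ξ)
      + freqPow σ ξ ^ 2 * solutionHat α β σ μ φ₀ φ₁ g t ξ = rlFamily (β - 2 * α) g t ξ := by
  unfold derivTwoHat derivHat solutionHat source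
  ring

theorem RapidDecay.derivTwoHat (hα : 1 / 2 < α) (hα' : α ≤ 1) (hσ : 0 < σ) (hμ : 0 < μ)
    {h : ℝ → Space n → ℂ} (hh : RapidDecay h) : RapidDecay (derivTwoHat α σ μ h) :=
  (hh.sub ((hh.dampConv hα hα' hσ hμ (by linarith)).freq_mul hσ μ)).sub
    ((hh.dampConv hα hα' hσ hμ (by linarith)).freq_sq_mul hσ)

/-- Integrating raises all orders by one, and the recurrence at b = 1 solves for k_1 * h. -/
theorem rlFamily_one_derivTwoHat (hα : 1 / 2 < α) (hα' : α ≤ 1) (hσ : 0 < σ) (hμ : 0 < μ)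
    {h : ℝ → Space n → ℂ} (hh : RapidDecay h) {t : ℝ} (ht : 0 ≤ t) (ξ : Space n) :
    rlFamily 1 (derivTwoHat α σ μ h) t ξ = dampConv α σ μ 1 h t ξ := by
  have hα0 : 0 < α := by linarith
  have h1 := hh.dampConv hα hα' hσ hμ hα0
  have h2 := hh.dampConv hα hα' hσ hμ (show 0 < 2 * α by linarith)
  have hq : PolyGrowth fun (_ : ℝ) (_ : Space n) => (((Real.Gamma 1)⁻¹ : ℝ) : ℂ) :=
    PolyGrowth.of_time continuous_const
  have e : rlFamily 1 (FracDamped.derivTwoHat α σ μ h) t ξ = rlFamily 1 h t ξ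
      - μ * freqPow σ ξ * rlFamily 1 (dampConv α σ μ α h) t ξ
      - freqPow σ ξ ^ 2 * rlFamily 1 (dampConv α σ μ (2 * α) h) t ξ := by
    unfold rlFamily
    simp only [one_ne_zero, if_false]
    rw [← volterra_mul_left 1 _ _ (fun ξ => freqPow σ ξ ^ 2),
      ← volterra_mul_left 1 _ _ (fun ξ => μ * freqPow σ ξ),
      ← volterra_sub one_pos hq hh (h1.freq_mul hσ μ),
      ← volterra_sub one_pos hq (hh.sub (h1.freq_mul hσ μ)) (h2.freq_sq_mul hσ)]
    rfl
  rw [e, rlFamily_eq (h := dampConv α σ μ α h) zero_le_one ht,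
    rlFamily_eq (h := dampConv α σ μ (2 * α) h) zero_le_one ht,
    rlIntegral_dampConv hα0 hμ zero_le_one hα0 ht ξ (hh.continuous_time ξ),
    rlIntegral_dampConv hα0 hμ zero_le_one (by linarith) ht ξ (hh.continuous_time ξ),
    ← dampConv_recurrence hα0 hμ one_pos ht ξ (hh.continuous_time ξ)]
  ring

/-! ### The scales in physical space -/

theorem fractionalScale_dampConv (hα : 1 / 2 < α) (hα' : α ≤ 1) (hσ : 0 < σ) (hμ : 0 < μ)
    {h : ℝ → Space n → ℂ} (hh : RapidDecay h) (x : Space n) :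
    FractionalScale fun b t => invFourier (dampConv α σ μ b h t) x where
  cont b hb := (hh.dampConv hα hα' hσ hμ hb).continuous_invFourier x
  zero b hb := by
    have : dampConv α σ μ b h 0 = fun _ => 0 := by
      ext ξ
      exact volterra_zero hb _ _ ξ
    rw [this, invFourier_zero]
  rl a ha b hb t ht := by
    rw [(hh.dampConv hα hα' hσ hμ hb).rlIntegral_invFourier x ha ht]
    congr 1
    ext ξ
    rw [rlFamily_eq ha ht,
      rlIntegral_dampConv (by linarith) hμ ha hb ht ξ (hh.continuous_time ξ)]

theorem invFourier_dampConv_one (hα : 1 / 2 < α) (hα' : α ≤ 1) (hσ : 0 < σ) (hμ : 0 < μ)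
    {h : ℝ → Space n → ℂ} (hh : RapidDecay h) (x : Space n) {t : ℝ} (ht : 0 ≤ t) :
    invFourier (dampConv α σ μ 1 h t) x
      = ∫ τ in (0 : ℝ)..t, invFourier (derivTwoHat α σ μ h τ) x := by
  rw [← rlIntegral_one, (hh.derivTwoHat hα hα' hσ hμ).rlIntegral_invFourier x zero_le_one ht]
  congr 1
  ext ξ
  rw [rlFamily_one_derivTwoHat hα hα' hσ hμ hh ht]

/-! ### The kernels in terms of the fundamental solution -/

/-- Kernels of order above 1 are time convolutions with a constant, so products with φ inherit decay
and continuity from `dampConv`. -/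
theorem dampKernel_mul_eq (hα : 0 < α) (hμ : 0 < μ) {b t : ℝ} (hb : 1 < b)
    (ht : 0 ≤ t) (φ : Space n → ℂ) (ξ : Space n) :
    ((dampKernel α μ b (‖ξ‖ ^ σ) t : ℝ) : ℂ) * φ ξ
      = dampConv α σ μ (b - 1) (rpowFamily 0 φ) t ξ := by
  rw [dampConv_rpowFamily hα hμ (sub_pos.2 hb) le_rfl ht, add_zero, sub_add_cancel]

theorem symbolM_mul_eq (hα : 0 < α) (hμ : 0 < μ) (hβ : 1 < β) {t : ℝ} (ht : 0 ≤ t)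
    (φ : Space n → ℂ) (ξ : Space n) :
    symbolM α β σ μ t ξ * φ ξ = dampConv α σ μ (β - 1) (rpowFamily 0 φ) t ξ := by
  rw [symbolM_eq hα hμ hβ, ← dampKernel_mul_eq hα hμ hβ ht]
  rfl

theorem symbolJ_mul_eq (hα : 0 < α) (hμ : 0 < μ) {t : ℝ} (ht : 0 ≤ t)
    (φ : Space n → ℂ) (ξ : Space n) :
    symbolJ α σ μ t ξ * φ ξ = dampConv α σ μ 1 (rpowFamily 0 φ) t ξ := by
  rw [symbolJ_eq hα hμ, dampConv_rpowFamily hα hμ one_pos le_rfl ht, dampKernel]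
  congr 3
  · rw [show (1 : ℝ) + 0 + 1 - 1 = 1 by norm_num, Real.rpow_one]
  · norm_num

theorem symbolN_mul_eq (hα : 0 < α) (hμ : 0 < μ) {t : ℝ} (ht : 0 ≤ t)
    (φ : Space n → ℂ) (ξ : Space n) :
    symbolN α σ μ t ξ * φ ξ = rpowFamily 0 φ t ξ
      - freqPow σ ξ ^ 2 * dampConv α σ μ (2 * α) (rpowFamily 0 φ) t ξ := by
  rw [symbolN_eq hα hμ, dampConv_rpowFamily hα hμ (by linarith) le_rfl ht, dampKernel, freqPow,
    rpowFamily, rpowC_zero, show 2 * α + 0 + 1 = 2 * α + 1 by ring, add_sub_cancel_right,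
    show 2 * α = α * ((2 : ℕ) : ℝ) by push_cast; ring, Real.rpow_mul_natCast ht]
  push_cast
  ring

theorem rapidDecay_hat_const (φ : 𝓢(Space n, ℂ)) : RapidDecay fun _ : ℝ => hat φ :=
  rapidDecay_hat (g := fun _ => φ) continuous_const

theorem kernelConvExists_symbols (hα : 1 / 2 < α) (hα' : α ≤ 1) (hβ : 1 < β) (hσ : 0 < σ)
    (hμ : 0 < μ) {t : ℝ} (ht : 0 ≤ t) (φ : 𝓢(Space n, ℂ)) (x : Space n) :
    KernelConvExists (symbolN α σ μ t) φ x ∧ KernelConvExists (symbolJ α σ μ t) φ x ∧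
      KernelConvExists (symbolM α β σ μ t) φ x := by
  have hα0 : 0 < α := by linarith
  have h0 := (rapidDecay_hat_const φ).rpow (c := 0) le_rfl
  refine ⟨kernelConvExists_of_integrable ?_, kernelConvExists_of_integrable ?_,
    kernelConvExists_of_integrable ?_⟩
  · simp_rw [symbolN_mul_eq hα0 hμ ht (hat φ)]
    exact (h0.sub ((h0.dampConv hα hα' hσ hμ (by linarith)).freq_sq_mul hσ)).integrable_character
      x t
  · simp_rw [symbolJ_mul_eq hα0 hμ ht (hat φ)]
    exact (h0.dampConv hα hα' hσ hμ one_pos).integrable_character x t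
  · simp_rw [symbolM_mul_eq hα0 hμ hβ ht (hat φ)]
    exact (h0.dampConv hα hα' hσ hμ (sub_pos.2 hβ)).integrable_character x t

/-- The integrand of the Duhamel term on the Fourier side. -/
noncomputable def duhamelHat (α β σ μ : ℝ) (g : ℝ → Space n → ℂ) (t τ : ℝ) (ξ : Space n) : ℂ :=
  ((|t - τ| ^ (β - 1) : ℝ) : ℂ) * dampSymbol α σ μ β (t - τ) ξ * g τ ξ

theorem RapidDecay.duhamelHat (hα : 1 / 2 < α) (hα' : α ≤ 1) (hβ : 1 < β) (hσ : 0 < σ)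
    (hμ : 0 < μ) {g : ℝ → Space n → ℂ} (hg : RapidDecay g) (t : ℝ) :
    RapidDecay (duhamelHat α β σ μ g t) := by
  have h1 : Continuous fun τ : ℝ => ((|t - τ| ^ (β - 1) : ℝ) : ℂ) :=
    Complex.continuous_ofReal.comp ((Real.continuous_rpow_const (by linarith)).comp
      (continuous_abs.comp (continuous_const.sub continuous_id)))
  exact ((PolyGrowth.of_time h1).mul ((PolyGrowth.dampSymbol hα hα' hσ hμ (by linarith)).comp_time
    (g := fun τ => t - τ) (by fun_prop))).mul_rapid hg

theorem kernelConv_symbolM_eq (hα : 0 < α) (hμ : 0 < μ) (hβ : 1 < β) {f : ℝ → 𝓢(Space n, ℂ)}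
    {t τ : ℝ} (hτ : τ ∈ Icc 0 t) (x : Space n) :
    kernelConv (symbolM α β σ μ (t - τ)) (f τ) x
      = invFourier (duhamelHat α β σ μ (fun τ => hat (f (max τ 0))) t τ) x := by
  rw [kernelConv_eq]
  congr 1
  ext ξ
  rw [symbolM_eq hα hμ hβ, duhamelHat, dampSymbol, abs_of_nonneg (sub_nonneg.2 hτ.2),
    max_eq_left hτ.1]
  push_cast
  ring

theorem integral_duhamelHat (hβ : 0 < β) {g : ℝ → Space n → ℂ} {t : ℝ} (ht : 0 ≤ t)
    (ξ : Space n) :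
    ∫ τ in (0 : ℝ)..t, duhamelHat α β σ μ g t τ ξ = dampConv α σ μ β g t ξ := by
  rw [dampConv_eq hβ ht]
  refine intervalIntegral.integral_congr fun τ hτ => ?_
  rw [uIcc_of_le ht] at hτ
  simp only [duhamelHat, dampSymbol, dampKernel]
  rw [abs_of_nonneg (sub_nonneg.2 hτ.2)]
  push_cast
  ring

/-- Freezing f at its initial value for negative times gives a family continuous on all of ℝ, as
`RapidDecay` demands; values at t ≥ 0 are unchanged. -/
theorem continuous_comp_max {f : ℝ → 𝓢(Space n, ℂ)} (hf : ContinuousOn f (Ici 0)) :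
    Continuous fun τ => f (max τ 0) :=
  hf.comp_continuous (continuous_id.max continuous_const) fun τ => le_max_right τ 0

theorem intervalIntegrable_kernelConv (hα : 1 / 2 < α) (hα' : α ≤ 1) (hβ : 1 < β) (hσ : 0 < σ)
    (hμ : 0 < μ) {f : ℝ → 𝓢(Space n, ℂ)} (hf : ContinuousOn f (Ici 0)) {t : ℝ} (ht : 0 ≤ t)
    (x : Space n) :
    IntervalIntegrable (fun τ => kernelConv (symbolM α β σ μ (t - τ)) (f τ) x) volume 0 t := by
  have hR := (rapidDecay_hat (continuous_comp_max hf)).duhamelHat hα hα' hβ hσ hμ t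
  exact intervalIntegrable_congr_Ioc ht ((hR.continuous_invFourier x).intervalIntegrable 0 t)
    fun τ hτ => (kernelConv_symbolM_eq (by linarith) hμ hβ (Ioc_subset_Icc_self hτ) x).symm

/-- After expanding the source, the terms in u₀ and f match directly. -/
theorem representation_eq (hα : 1 / 2 < α) (hα' : α ≤ 1) (hβ : 2 * α ≤ β) (hσ : 0 < σ)
    (hμ : 0 < μ) (u₀ u₁ : 𝓢(Space n, ℂ)) {f : ℝ → 𝓢(Space n, ℂ)}
    (hf : ContinuousOn f (Ici 0)) {t : ℝ} (ht : 0 ≤ t) (x : Space n) :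
    representation α β σ μ u₀ u₁ f t x
      = invFourier (solutionHat α β σ μ (hat u₀) (hat u₁) (fun τ => hat (f (max τ 0))) t) x := by
  have hα0 : 0 < α := by linarith
  have hβ1 : 1 < β := by linarith
  set g : ℝ → Space n → ℂ := fun τ => hat (f (max τ 0)) with hg
  have hgR : RapidDecay g := rapidDecay_hat (continuous_comp_max hf)
  have r0 := (rapidDecay_hat_const u₀).rpow (c := 0) le_rfl
  have r1 := (rapidDecay_hat_const u₁).rpow (c := 0) le_rfl
  have rN := r0.sub ((r0.dampConv hα hα' hσ hμ (show 0 < 2 * α by linarith)).freq_sq_mul hσ)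
  have rJ := r1.dampConv hα hα' hσ hμ one_pos
  have rM := hgR.dampConv hα hα' hσ hμ (show 0 < β by linarith)
  have eM : ∫ τ in (0 : ℝ)..t, kernelConv (symbolM α β σ μ (t - τ)) (f τ) x
      = invFourier (dampConv α σ μ β g t) x := by
    have h1 : ∫ τ in (0 : ℝ)..t, kernelConv (symbolM α β σ μ (t - τ)) (f τ) x
        = ∫ τ in (0 : ℝ)..t, (1 : ℂ) * invFourier (duhamelHat α β σ μ g t τ) x := by
      refine intervalIntegral_congr_Ioc ht fun τ hτ => ?_
      rw [one_mul, kernelConv_symbolM_eq hα0 hμ hβ1 (Ioc_subset_Icc_self hτ)]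
    rw [h1, (hgR.duhamelHat hα hα' hβ1 hσ hμ t).integral_invFourier x ht intervalIntegrable_const]
    congr 1
    ext ξ
    simp_rw [one_mul]
    exact integral_duhamelHat (by linarith) ht ξ
  unfold representation
  rw [eM, kernelConv_eq, kernelConv_eq]
  simp_rw [symbolN_mul_eq hα0 hμ ht (hat u₀), symbolJ_mul_eq hα0 hμ ht (hat u₁)]
  rw [← invFourier_add rN rJ, ← invFourier_add (rN.add rJ) rM]
  congr 1
  ext ξ
  -- The terms in u₁ match by the recurrence at b = 1 for the constant family û₁, since Ĵû₁ = k_1 *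
  -- û₁ and I¹û₁ = tû₁.
  have hrec := dampConv_recurrence hα0 hμ one_pos ht ξ (r1.continuous_time ξ) (σ := σ)
  have hone : rlFamily 1 (rpowFamily 0 (hat u₁)) t ξ = rpowFamily 1 (hat u₁) t ξ := by
    rw [rlFamily_eq zero_le_one ht, rlIntegral_one]
    simp [rpowFamily, rpowC_zero, rpowC_one]
  rw [hone] at hrec
  rw [solutionHat, dampConv_source hα hα' hβ hσ hμ (rapidDecay_hat_const u₀)
    (rapidDecay_hat_const u₁) hgR (by linarith) ht, show 2 * α + (β - 2 * α) = β by ring,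
    show 2 * α + (1 - α) = 1 + α by ring, add_comm (2 * α) 1, ← hrec]
  ring

end

section
variable {n : ℕ} {α β σ μ : ℝ}

/-! ### Scales of singular functions -/

theorem FractionalScale.singular {V : ℝ → ℝ → ℂ} (hV : FractionalScale V) : SingularScale V where
  cont b hb := (hV.cont b hb).continuousOn
  integrable a ha b hb t _ :=
    (intervalIntegrable_rlKernel ha t).mul_continuousOn (hV.cont b hb).continuousOn
  rl a ha b hb t ht := by rw [← rlIntegral_of_pos ha, hV.rl a ha.le b hb t ht.le]

theorem SingularScale.add {Y Z : ℝ → ℝ → ℂ} (hY : SingularScale Y) (hZ : SingularScale Z) :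
    SingularScale fun b t => Y b t + Z b t where
  cont b hb := (hY.cont b hb).add (hZ.cont b hb)
  integrable a ha b hb t ht := by
    simp_rw [mul_add]
    exact (hY.integrable a ha b hb t ht).add (hZ.integrable a ha b hb t ht)
  rl a ha b hb t ht := by
    simp_rw [mul_add]
    rw [intervalIntegral.integral_add (hY.integrable a ha b hb t ht)
      (hZ.integrable a ha b hb t ht), hY.rl a ha b hb t ht, hZ.rl a ha b hb t ht]

theorem SingularScale.sub {Y Z : ℝ → ℝ → ℂ} (hY : SingularScale Y) (hZ : SingularScale Z) :
    SingularScale fun b t => Y b t - Z b t where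
  cont b hb := (hY.cont b hb).sub (hZ.cont b hb)
  integrable a ha b hb t ht := by
    simp_rw [mul_sub]
    exact (hY.integrable a ha b hb t ht).sub (hZ.integrable a ha b hb t ht)
  rl a ha b hb t ht := by
    simp_rw [mul_sub]
    rw [intervalIntegral.integral_sub (hY.integrable a ha b hb t ht)
      (hZ.integrable a ha b hb t ht), hY.rl a ha b hb t ht, hZ.rl a ha b hb t ht]

theorem SingularScale.shift {Z : ℝ → ℝ → ℂ} (hZ : SingularScale Z) {c : ℝ} (hc : 0 ≤ c) :
    SingularScale fun b t => Z (b + c) t where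
  cont b hb := hZ.cont _ (by linarith)
  integrable a ha b hb t ht := hZ.integrable a ha _ (by linarith) t ht
  rl a ha b hb t ht := by rw [hZ.rl a ha (b + c) (by linarith) t ht, add_assoc]

/-- The convolution of the fundamental solution of order `b` with the function whose Fourier
transform is `φ`. -/
noncomputable def kernelScale (α σ μ : ℝ) (φ : Space n → ℂ) (x : Space n) (b t : ℝ) : ℂ :=
  ((t ^ (b - 1) : ℝ) : ℂ) * invFourier (fun ξ => dampSymbol α σ μ b t ξ * φ ξ) x

theorem kernelScale_eq (φ : Space n → ℂ) (x : Space n) (b : ℝ) {t : ℝ} (ht : 0 ≤ t) :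
    kernelScale α σ μ φ x b t
      = invFourier (fun ξ => ((dampKernel α μ b (‖ξ‖ ^ σ) t : ℝ) : ℂ) * φ ξ) x := by
  rw [kernelScale, ← invFourier_const_mul]
  congr 1
  ext ξ
  rw [dampKernel, dampSymbol, abs_of_nonneg ht]
  push_cast
  ring

/-- The power t^{b-1} stays outside the inverse Fourier integral. The remaining factor is continuous
up to t = 0, so the only singularities are those of a Beta integrand. -/
theorem singularScale_kernelScale (hα : 1 / 2 < α) (hα' : α ≤ 1) (hσ : 0 < σ) (hμ : 0 < μ)
    {φ : Space n → ℂ} (hφ : RapidDecay fun _ : ℝ => φ) (x : Space n) :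
    SingularScale (kernelScale α σ μ φ x) := by
  have hα0 : 0 < α := by linarith
  have hR : ∀ b > 0, RapidDecay fun t ξ => dampSymbol α σ μ b t ξ * φ ξ := fun b hb =>
    (PolyGrowth.dampSymbol hα hα' hσ hμ hb).mul_rapid hφ
  have hw : ∀ a > (0 : ℝ), ∀ b > (0 : ℝ), ∀ t > (0 : ℝ), IntervalIntegrable (fun τ =>
      (((t - τ) ^ (a - 1) / Real.Gamma a : ℝ) : ℂ) * ((τ ^ (b - 1) : ℝ) : ℂ)) volume 0 t := by
    intro a ha b hb t ht
    have h := intervalIntegrable_ofReal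
      ((intervalIntegrable_sub_rpow_mul_rpow ha hb ht).const_mul (Real.Gamma a)⁻¹)
    refine h.congr fun τ _ => ?_
    push_cast
    ring
  refine ⟨fun b hb => ?_, fun a ha b hb t ht => ?_, fun a ha b hb t ht => ?_⟩
  · refine ContinuousOn.mul ?_ ((hR b hb).continuous_invFourier x).continuousOn
    refine Complex.continuous_ofReal.comp_continuousOn ?_
    exact continuousOn_id.rpow_const fun τ hτ => Or.inl (ne_of_gt hτ)
  · have := (hw a ha b hb t ht).mul_continuousOn
      ((hR b hb).continuous_invFourier x).continuousOn
    simpa only [kernelScale, mul_assoc] using this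
  · simp_rw [kernelScale_eq φ x (a + b) ht.le, kernelScale, ← mul_assoc]
    rw [(hR b hb).integral_invFourier x ht.le (hw a ha b hb t ht)]
    congr 1
    ext ξ
    rw [← integral_rlKernel_mul_dampKernel_complex hα0 hμ ha hb ht,
      ← intervalIntegral.integral_mul_const]
    refine intervalIntegral_congr_Ioc ht.le fun τ hτ => ?_
    rw [dampKernel, dampSymbol, abs_of_pos hτ.1]
    push_cast
    ring

/-- The time derivative of the scale of the solution, for a continuously differentiable source
with initial value `ψ` and derivative `g'`. -/
noncomputable def derivScale (α β σ μ : ℝ) (φ₀ φ₁ ψ : Space n → ℂ) (g' : ℝ → Space n → ℂ)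
    (x : Space n) (b t : ℝ) : ℂ :=
  kernelScale α σ μ ψ x (b + (β - 2 * α)) t
    + invFourier (dampConv α σ μ (b + (β - 2 * α)) g' t) x
    - kernelScale α σ μ (fun ξ => freqPow σ ξ ^ 2 * φ₀ ξ) x b t
    - kernelScale α σ μ (fun ξ => μ * freqPow σ ξ * φ₁ ξ) x (b + (1 - α)) t
    - kernelScale α σ μ (fun ξ => freqPow σ ξ ^ 2 * φ₁ ξ) x (b + 1) t

theorem singularScale_derivScale (hα : 1 / 2 < α) (hα' : α ≤ 1) (hβ : 2 * α ≤ β) (hσ : 0 < σ)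
    (hμ : 0 < μ) {φ₀ φ₁ ψ : Space n → ℂ} {g' : ℝ → Space n → ℂ}
    (h₀ : RapidDecay fun _ : ℝ => φ₀) (h₁ : RapidDecay fun _ : ℝ => φ₁)
    (hψ : RapidDecay fun _ : ℝ => ψ) (hg' : RapidDecay g') (x : Space n) :
    SingularScale (derivScale α β σ μ φ₀ φ₁ ψ g' x) :=
  (((((singularScale_kernelScale hα hα' hσ hμ hψ x).shift (sub_nonneg.2 hβ)).add
    ((fractionalScale_dampConv hα hα' hσ hμ hg' x).singular.shift (sub_nonneg.2 hβ))).sub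
    (singularScale_kernelScale hα hα' hσ hμ (h₀.freq_sq_mul hσ) x)).sub
    ((singularScale_kernelScale hα hα' hσ hμ (h₁.freq_mul hσ μ) x).shift
      (sub_nonneg.2 hα'))).sub
    ((singularScale_kernelScale hα hα' hσ hμ (h₁.freq_sq_mul hσ) x).shift zero_le_one)

/-- Writing g = ψ + I¹g' and moving I¹ onto the kernel is the one place where differentiability of
the source in time enters. -/
theorem dampConv_of_primitive (hα : 1 / 2 < α) (hα' : α ≤ 1) (hσ : 0 < σ) (hμ : 0 < μ)
    {ψ : Space n → ℂ} {g g' : ℝ → Space n → ℂ} (hψ : RapidDecay fun _ : ℝ => ψ)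
    (hg' : RapidDecay g')
    (hg : ∀ t ≥ 0, ∀ ξ, g t ξ = ψ ξ + ∫ τ in (0 : ℝ)..t, g' τ ξ)
    {b t : ℝ} (hb : 0 < b) (ht : 0 ≤ t) (ξ : Space n) :
    dampConv α σ μ b g t ξ
      = dampConv α σ μ b (rpowFamily 0 ψ) t ξ + dampConv α σ μ (b + 1) g' t ξ := by
  have hα0 : 0 < α := by linarith
  have h1 : dampConv α σ μ b g t ξ
      = dampConv α σ μ b (fun τ ξ => rpowFamily 0 ψ τ ξ + rlFamily 1 g' τ ξ) t ξ := by
    rw [dampConv_eq hb ht, dampConv_eq hb ht]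
    refine intervalIntegral_congr_Ioc ht fun τ hτ => ?_
    rw [hg τ hτ.1.le, rlFamily_eq zero_le_one hτ.1.le, rlIntegral_one, rpowFamily, rpowC_zero,
      one_mul]
  rw [h1, dampConv, volterra_add hb (PolyGrowth.dampSymbol hα hα' hσ hμ hb) (hψ.rpow le_rfl)
    (hg'.rl zero_le_one), ← dampConv, ← dampConv,
    dampConv_rlFamily hα0 hμ zero_le_one hb ht ξ (hg'.continuous_time ξ), add_comm 1 b]

/-- Once the source is split into constants in time and a primitive, every term is k_{c+1}φ or
k_{c+1} * g' with c > 0. Hence the family continues to orders one lower, which are the time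
derivatives. -/
theorem derivScale_eq (hα : 1 / 2 < α) (hα' : α ≤ 1) (hβ : 2 * α ≤ β) (hσ : 0 < σ)
    (hμ : 0 < μ) {φ₀ φ₁ ψ : Space n → ℂ} {g g' : ℝ → Space n → ℂ}
    (h₀ : RapidDecay fun _ : ℝ => φ₀) (h₁ : RapidDecay fun _ : ℝ => φ₁)
    (hψ : RapidDecay fun _ : ℝ => ψ) (hgR : RapidDecay g) (hg' : RapidDecay g')
    (hg : ∀ t ≥ 0, ∀ ξ, g t ξ = ψ ξ + ∫ τ in (0 : ℝ)..t, g' τ ξ) (x : Space n)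
    {b t : ℝ} (hb : 0 < b) (ht : 0 ≤ t) :
    derivScale α β σ μ φ₀ φ₁ ψ g' x (b + 1) t
      = invFourier (dampConv α σ μ b (source α β σ μ φ₀ φ₁ g) t) x := by
  have hα0 : 0 < α := by linarith
  have hk : ∀ {φ : Space n → ℂ}, RapidDecay (fun _ : ℝ => φ) → ∀ {c : ℝ}, 0 < c →
      kernelScale α σ μ φ x (c + 1) t
        = invFourier (dampConv α σ μ c (rpowFamily 0 φ) t) x := by
    intro φ _ c hc
    rw [kernelScale_eq φ x _ ht]
    congr 1
    ext ξ
    rw [dampKernel_mul_eq hα0 hμ (by linarith) ht, add_sub_cancel_right]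
  have r : ∀ {φ : Space n → ℂ}, RapidDecay (fun _ : ℝ => φ) → ∀ {c : ℝ}, 0 < c →
      RapidDecay (dampConv α σ μ c (rpowFamily 0 φ)) := fun hφ _ hc =>
    (hφ.rpow le_rfl).dampConv hα hα' hσ hμ hc
  have hc1 : 0 < b + (β - 2 * α) := by linarith
  have hc2 : 0 < b + (1 - α) := by linarith
  have hc3 : 0 < b + 1 := by linarith
  have hc4 : 0 < b + (β - 2 * α) + 1 := by linarith
  have q₀ := h₀.freq_sq_mul hσ
  have q₁ := h₁.freq_mul hσ μ
  have q₂ := h₁.freq_sq_mul hσ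
  unfold derivScale
  rw [show b + 1 + (β - 2 * α) = b + (β - 2 * α) + 1 by ring,
    show b + 1 + (1 - α) = b + (1 - α) + 1 by ring, hk hψ hc1, hk q₀ hb, hk q₁ hc2, hk q₂ hc3,
    ← invFourier_add (r hψ hc1) (hg'.dampConv hα hα' hσ hμ hc4),
    ← invFourier_sub ((r hψ hc1).add (hg'.dampConv hα hα' hσ hμ hc4)) (r q₀ hb),
    ← invFourier_sub (((r hψ hc1).add (hg'.dampConv hα hα' hσ hμ hc4)).sub (r q₀ hb)) (r q₁ hc2),
    ← invFourier_sub ((((r hψ hc1).add (hg'.dampConv hα hα' hσ hμ hc4)).sub (r q₀ hb)).sub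
      (r q₁ hc2)) (r q₂ hc3)]
  congr 1
  ext ξ
  rw [dampConv_source hα hα' hβ hσ hμ h₀ h₁ hgR hb ht,
    dampConv_of_primitive hα hα' hσ hμ hψ hg' hg hc1 ht,
    dampConv_rpowFamily hα0 hμ hb le_rfl ht (fun ξ => freqPow σ ξ ^ 2 * φ₀ ξ),
    dampConv_rpowFamily hα0 hμ hc2 le_rfl ht (fun ξ => μ * freqPow σ ξ * φ₁ ξ),
    dampConv_rpowFamily hα0 hμ hc3 le_rfl ht (fun ξ => freqPow σ ξ ^ 2 * φ₁ ξ),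
    dampConv_rpowFamily hα0 hμ hb le_rfl ht φ₀, dampConv_rpowFamily hα0 hμ hc2 le_rfl ht φ₁,
    dampConv_rpowFamily hα0 hμ hc3 le_rfl ht φ₁]
  ring

/-! ### The Cauchy problem -/

theorem ofReal_norm_rpow_two_mul (ξ : Space n) :
    ((‖ξ‖ ^ (2 * σ) : ℝ) : ℂ) = freqPow σ ξ ^ 2 := by
  rw [freqPow, mul_comm 2 σ, show σ * 2 = σ * ((2 : ℕ) : ℝ) by push_cast; ring,
    Real.rpow_mul_natCast (norm_nonneg ξ)]
  push_cast
  ring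

theorem invFourier_rpowFamily (c t : ℝ) (φ : 𝓢(Space n, ℂ)) (x : Space n) :
    invFourier (rpowFamily c (hat φ) t) x = rpowC c t * φ x := by
  have : rpowFamily c (hat φ) t = fun ξ => rpowC c t * hat φ ξ := rfl
  rw [this, invFourier_const_mul, invFourier_hat]

theorem invFourier_solutionHat (hα : 1 / 2 < α) (hα' : α ≤ 1) (hσ : 0 < σ)
    (hμ : 0 < μ) (u₀ u₁ : 𝓢(Space n, ℂ)) {g : ℝ → Space n → ℂ}
    (hs : RapidDecay (source α β σ μ (hat u₀) (hat u₁) g)) (t : ℝ) (x : Space n) :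
    invFourier (solutionHat α β σ μ (hat u₀) (hat u₁) g t) x = u₀ x + t * u₁ x
      + invFourier (dampConv α σ μ (2 * α) (source α β σ μ (hat u₀) (hat u₁) g) t) x := by
  have r0 := (rapidDecay_hat_const u₀).rpow (c := 0) le_rfl
  have r1 := (rapidDecay_hat_const u₁).rpow (c := 1) zero_le_one
  have h1 := invFourier_add (r0.add r1)
    (hs.dampConv hα hα' hσ hμ (show 0 < 2 * α by linarith)) t x
  have h2 := invFourier_add r0 r1 t x
  rw [h2, invFourier_rpowFamily, invFourier_rpowFamily, rpowC_zero, rpowC_one, one_mul] at h1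
  exact h1

theorem invFourier_derivHat (hα : 1 / 2 < α) (hα' : α ≤ 1) (hσ : 0 < σ)
    (hμ : 0 < μ) (u₀ u₁ : 𝓢(Space n, ℂ)) {g : ℝ → Space n → ℂ}
    (hs : RapidDecay (source α β σ μ (hat u₀) (hat u₁) g)) (t : ℝ) (x : Space n) :
    invFourier (derivHat α β σ μ (hat u₀) (hat u₁) g t) x = rpowC (1 - α) t * u₁ x
      + invFourier (dampConv α σ μ α (source α β σ μ (hat u₀) (hat u₁) g) t) x := by
  have h1 := invFourier_add ((rapidDecay_hat_const u₁).rpow (sub_nonneg.2 hα'))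
    (hs.dampConv hα hα' hσ hμ (show 0 < α by linarith)) t x
  rw [invFourier_rpowFamily] at h1
  exact h1

/-- Common part for the two notions of derivative. Order α is handled for any scale, while order 2α
is required only for this solution, because the classical version also needs the singular scale
built from f'. -/
theorem solvesCauchyProblem_of_caputo {IsCaputo : ℝ → (ℝ → ℂ) → (ℝ → ℂ) → Prop}
    (hα : 1 / 2 < α) (hα' : α ≤ 1) (hβ : 2 * α ≤ β) (hσ : 0 < σ) (hμ : 0 < μ)
    (u₀ u₁ : 𝓢(Space n, ℂ)) {f : ℝ → 𝓢(Space n, ℂ)} (hf : ContinuousOn f (Ici 0))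
    (hone : ∀ (V : ℝ → ℝ → ℂ) (u : ℝ → ℂ) (c₀ c₁ : ℂ), FractionalScale V →
      (∀ t ≥ 0, u t = c₀ + t * c₁ + V (2 * α) t) →
      IsCaputo α u (fun t => rpowC (1 - α) t * c₁ + V α t))
    (htwo : ∀ (x : Space n) (u : ℝ → ℂ),
      (∀ t ≥ 0, u t = u₀ x + t * u₁ x + invFourier (dampConv α σ μ (2 * α)
        (source α β σ μ (hat u₀) (hat u₁) fun τ => hat (f (max τ 0))) t) x) →
      IsCaputo (2 * α) u (fun t => invFourier (derivTwoHat α σ μ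
        (source α β σ μ (hat u₀) (hat u₁) fun τ => hat (f (max τ 0))) t) x)) :
    SolvesCauchyProblem IsCaputo α β σ μ u₀ u₁ f (representation α β σ μ u₀ u₁ f) := by
  set g : ℝ → Space n → ℂ := fun τ => hat (f (max τ 0)) with hg
  have hgR : RapidDecay g := rapidDecay_hat (continuous_comp_max hf)
  have r0 := rapidDecay_hat_const u₀
  have r1 := rapidDecay_hat_const u₁
  have hs : RapidDecay (source α β σ μ (hat u₀) (hat u₁) g) := r0.source hα' hβ hσ r1 hgR
  have hu : ∀ x, ∀ t ≥ 0, representation α β σ μ u₀ u₁ f t x = u₀ x + t * u₁ x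
      + invFourier (dampConv α σ μ (2 * α) (source α β σ μ (hat u₀) (hat u₁) g) t) x := by
    intro x t ht
    rw [representation_eq hα hα' hβ hσ hμ u₀ u₁ hf ht,
      invFourier_solutionHat hα hα' hσ hμ u₀ u₁ hs]
  have hV : ∀ x, FractionalScale fun b t =>
      invFourier (dampConv α σ μ b (source α β σ μ (hat u₀) (hat u₁) g) t) x :=
    fractionalScale_dampConv hα hα' hσ hμ hs
  have rS : RapidDecay (solutionHat α β σ μ (hat u₀) (hat u₁) g) :=
    ((r0.rpow le_rfl).add (r1.rpow zero_le_one)).add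
      (hs.dampConv hα hα' hσ hμ (by linarith))
  have rD : RapidDecay (derivHat α β σ μ (hat u₀) (hat u₁) g) :=
    (r1.rpow (sub_nonneg.2 hα')).add (hs.dampConv hα hα' hσ hμ (by linarith))
  have rW := hs.derivTwoHat hα hα' hσ hμ
  have rwD : RapidDecay fun t ξ => freqPow σ ξ * derivHat α β σ μ (hat u₀) (hat u₁) g t ξ :=
    (PolyGrowth.freqPow hσ).mul_rapid rD
  have rwS := rS.freq_sq_mul hσ
  refine ⟨fun x => (hV x).solution_zero hα (hu x), fun x => ?_,
    fun t => invFourier (derivHat α β σ μ (hat u₀) (hat u₁) g t),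
    fun t => invFourier (derivTwoHat α σ μ (source α β σ μ (hat u₀) (hat u₁) g) t),
    fun t => invFourier fun ξ => freqPow σ ξ * derivHat α β σ μ (hat u₀) (hat u₁) g t ξ,
    fun t => invFourier fun ξ => freqPow σ ξ ^ 2 * solutionHat α β σ μ (hat u₀) (hat u₁) g t ξ,
    fun x => ?_, fun x => htwo x _ (hu x), fun t ht => ⟨?_, ?_, fun x => ?_⟩⟩
  · have h := (hV x).solution_hasDerivWithinAt hα (hu x) (le_refl (0 : ℝ))
    rwa [(hV x).zero _ (by linarith), add_zero] at h
  · simp_rw [invFourier_derivHat hα hα' hσ hμ u₀ u₁ hs]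
    exact hone _ _ _ _ (hV x) (hu x)
  · exact ⟨_, rD.integrable t, rwD.integrable t, fun x => rfl, fun x => rfl⟩
  · refine ⟨_, rS.integrable t, ?_, fun x => ?_, fun x => ?_⟩
    · simp_rw [ofReal_norm_rpow_two_mul]
      exact rwS.integrable t
    · exact representation_eq hα hα' hβ hσ hμ u₀ u₁ hf ht.le x
    · simp_rw [ofReal_norm_rpow_two_mul]
  · have rμ : RapidDecay fun t ξ =>
        (μ : ℂ) * (freqPow σ ξ * derivHat α β σ μ (hat u₀) (hat u₁) g t ξ) :=
      (PolyGrowth.of_time continuous_const).mul_rapid rwD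
    have h1 := invFourier_add (rW.add rμ) rwS t x
    have h2 := invFourier_add rW rμ t x
    rw [h2, invFourier_const_mul] at h1
    simp_rw [derivTwoHat_add] at h1
    refine h1.symm.trans ?_
    have h3 := hgR.rlIntegral_invFourier x (sub_nonneg.2 hβ) ht.le
    refine h3.symm.trans (rlIntegral_congr ht fun τ hτ => ?_)
    rw [hg, invFourier_hat, max_eq_left hτ.1.le]

theorem solvesCauchyProblem_weak (hα : 1 / 2 < α) (hα' : α ≤ 1) (hβ : 2 * α ≤ β) (hσ : 0 < σ)
    (hμ : 0 < μ) (u₀ u₁ : 𝓢(Space n, ℂ)) {f : ℝ → 𝓢(Space n, ℂ)}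
    (hf : ContinuousOn f (Ici 0)) :
    SolvesCauchyProblem HasWeakCaputoDeriv α β σ μ u₀ u₁ f
      (representation α β σ μ u₀ u₁ f) := by
  have hs := (rapidDecay_hat_const u₀).source (β := β) (μ := μ) hα' hβ hσ
    (rapidDecay_hat_const u₁) (rapidDecay_hat (continuous_comp_max hf))
  refine solvesCauchyProblem_of_caputo hα hα' hβ hσ hμ u₀ u₁ hf
    (fun V u c₀ c₁ hV hu => hV.hasWeakCaputoDeriv hα hα' hu) fun x u hu => ?_
  exact (fractionalScale_dampConv hα hα' hσ hμ hs x).hasWeakCaputoDeriv_double hα hα' hu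
    ((hs.derivTwoHat hα hα' hσ hμ).continuous_invFourier x)
    fun t ht => invFourier_dampConv_one hα hα' hσ hμ hs x ht

theorem solvesCauchyProblem_classical (hα : 1 / 2 < α) (hα' : α ≤ 1) (hβ : 2 * α ≤ β)
    (hσ : 0 < σ) (hμ : 0 < μ) (u₀ u₁ : 𝓢(Space n, ℂ)) {f : ℝ → 𝓢(Space n, ℂ)}
    (hf : ContinuousOn f (Ici 0)) (hf1 : IsC1InTime f) :
    SolvesCauchyProblem HasCaputoDeriv α β σ μ u₀ u₁ f (representation α β σ μ u₀ u₁ f) := by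
  obtain ⟨f', hf'c, hf'⟩ := hf1
  have r0 := rapidDecay_hat_const u₀
  have r1 := rapidDecay_hat_const u₁
  have rψ := rapidDecay_hat_const (f 0)
  have hgR := rapidDecay_hat (continuous_comp_max hf)
  have hgR' := rapidDecay_hat (continuous_comp_max hf'c)
  have hs := r0.source (β := β) (μ := μ) hα' hβ hσ r1 hgR
  have hd : ∀ t ≥ 0, ∀ ξ, hat (f (max t 0)) ξ
      = hat (f 0) ξ + ∫ r in (0 : ℝ)..t, hat (f' (max r 0)) ξ := by
    intro t ht ξ
    rw [max_eq_left ht]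
    refine hat_sub_eq_integral (continuous_comp_max hf'c) (fun s hs x => ?_) ht ξ
    rw [max_eq_left hs]
    exact hf' s hs x
  refine solvesCauchyProblem_of_caputo hα hα' hβ hσ hμ u₀ u₁ hf
    (fun V u c₀ c₁ hV hu => hV.hasCaputoDeriv hα hα' hu) fun x u hu => ?_
  exact (fractionalScale_dampConv hα hα' hσ hμ hs x).hasCaputoDeriv_double hα hα' hu
    ((hs.derivTwoHat hα hα' hσ hμ).continuous_invFourier x)
    (fun t ht => invFourier_dampConv_one hα hα' hσ hμ hs x ht)
    (singularScale_derivScale hα hα' hβ hσ hμ r0 r1 rψ hgR' x)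
    fun b hb t ht => derivScale_eq hα hα' hβ hσ hμ r0 r1 rψ hgR hgR' hd x hb ht.le

/-- Written through `dampML`, the three symbols are real and depend on ξ only through |ξ|, even when
λ₊ and λ₋ are complex. -/
theorem representation_im_eq_zero (hα : 0 < α) (hβ : 1 < β) (hμ : 0 < μ)
    {u₀ u₁ : 𝓢(Space n, ℂ)} {f : ℝ → 𝓢(Space n, ℂ)} (h₀ : ∀ x, (u₀ x).im = 0)
    (h₁ : ∀ x, (u₁ x).im = 0) (hf : ∀ t ≥ 0, ∀ x, (f t x).im = 0) {t : ℝ} (ht : 0 ≤ t)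
    (x : Space n) : (representation α β σ μ u₀ u₁ f t x).im = 0 := by
  have hN : (kernelConv (symbolN α σ μ t) u₀ x).im = 0 := by
    rw [funext fun ξ => symbolN_eq (σ := σ) hα hμ t ξ]
    exact kernelConv_im_eq_zero h₀ (fun ξ => by rw [norm_neg]) x
  have hJ : (kernelConv (symbolJ α σ μ t) u₁ x).im = 0 := by
    rw [funext fun ξ => symbolJ_eq (σ := σ) hα hμ t ξ]
    exact kernelConv_im_eq_zero h₁ (fun ξ => by rw [norm_neg]) x
  have hM : ∫ τ in (0 : ℝ)..t, kernelConv (symbolM α β σ μ (t - τ)) (f τ) x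
      = ∫ τ in (0 : ℝ)..t, (((kernelConv (symbolM α β σ μ (t - τ)) (f τ) x).re : ℝ) : ℂ) := by
    refine intervalIntegral_congr_Ioc ht fun τ hτ => ?_
    refine Complex.ext rfl ?_
    rw [Complex.ofReal_im, funext fun ξ => symbolM_eq (σ := σ) hα hμ hβ (t - τ) ξ]
    exact kernelConv_im_eq_zero (hf τ hτ.1.le) (fun ξ => by rw [norm_neg]) x
  rw [representation, hM, intervalIntegral.integral_ofReal]
  simp [hN, hJ]

end

end FracDamped

theorem theorem2 (n : ℕ) (α β σ μ : ℝ) (hα : 1 / 2 < α) (hα' : α ≤ 1)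
    (hβ : 2 * α ≤ β) (hβ' : β < 2 * α + 1) (hσ : 0 < σ) (hμ : 0 < μ)
    (u₀ u₁ : 𝓢(FracDamped.Space n, ℂ)) (f : ℝ → 𝓢(FracDamped.Space n, ℂ))
    (hf : ContinuousOn f (Set.Ici 0)) :
    -- the convolutions with the kernels are well defined
    (∀ t ≥ 0, ∀ (φ : 𝓢(FracDamped.Space n, ℂ)) (x : FracDamped.Space n),
      FracDamped.KernelConvExists (FracDamped.symbolN α σ μ t) φ x ∧
      FracDamped.KernelConvExists (FracDamped.symbolJ α σ μ t) φ x ∧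
      FracDamped.KernelConvExists (FracDamped.symbolM α β σ μ t) φ x) ∧
    -- the time integral converges
    (∀ t ≥ 0, ∀ x : FracDamped.Space n, IntervalIntegrable
      (fun τ => FracDamped.kernelConv (FracDamped.symbolM α β σ μ (t - τ)) (f τ) x)
      MeasureTheory.volume 0 t) ∧
    -- for `f` continuous in time, the equation holds with generalized Caputo derivatives
    FracDamped.SolvesCauchyProblem FracDamped.HasWeakCaputoDeriv α β σ μ u₀ u₁ f
      (FracDamped.representation α β σ μ u₀ u₁ f) ∧
    -- for `f` continuously differentiable in time, with classical Caputo derivatives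
    (FracDamped.IsC1InTime f →
      FracDamped.SolvesCauchyProblem FracDamped.HasCaputoDeriv α β σ μ u₀ u₁ f
        (FracDamped.representation α β σ μ u₀ u₁ f)) ∧
    -- real data give a real-valued solution
    ((∀ x, (u₀ x).im = 0) → (∀ x, (u₁ x).im = 0) → (∀ t ≥ 0, ∀ x, (f t x).im = 0) →
      ∀ t ≥ 0, ∀ x, (FracDamped.representation α β σ μ u₀ u₁ f t x).im = 0) := by
  have hβ1 : 1 < β := by linarith
  exact ⟨fun t ht φ x => FracDamped.kernelConvExists_symbols hα hα' hβ1 hσ hμ ht φ x,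
    fun t ht x => FracDamped.intervalIntegrable_kernelConv hα hα' hβ1 hσ hμ hf ht x,
    FracDamped.solvesCauchyProblem_weak hα hα' hβ hσ hμ u₀ u₁ hf,
    FracDamped.solvesCauchyProblem_classical hα hα' hβ hσ hμ u₀ u₁ hf,
    fun h₀ h₁ hr t ht x =>
      FracDamped.representation_im_eq_zero (by linarith) hβ1 hμ h₀ h₁ hr ht x⟩
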